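/- Let $0<\alpha<1$ and $T>0$. Let $\Omega\subset\mathbb R^2$ be a nonempty bounded open set (for instance a bounded polygonal domain with Lipschitz boundary), let $V=H^2_0(\Omega)$ be the closure of $C_c^\infty(\Omega)$ in $H^2(\Omega)$, let $(\cdot,\cdot)$ and $\|\cdot\|$ be the inner product and the norm of the real space $L^2(\Omega)$, let $\langle\cdot,\cdot\rangle$ be the duality pairing of $V^*$ with $V$, and let $a(v,w)=\int_\Omega D^2v:D^2w\,dx$. Let $A\phi=\Delta^2\phi$ for $\phi\in D(A)=\{\phi\in V:\Delta^2\phi\in L^2(\Omega)\}$. There is an orthonormal basis $(\phi_j)_{j\ge1}$ of $L^2(\Omega)$ with $\phi_j\in D(A)$ and $A\phi_j=\mu_j\phi_j$, $\mu_j>0$. Fix any such basis and put, for $r\in\mathbb R$ and $v\in L^2(\Omega)$, $$\|v\|_{D(A^r)}=\Big(\sum_{j\ge1}\mu_j^{2r}(v,\phi_j)^2\Big)^{1/2}\in[0,\infty].$$ Write $\mathcal I^\beta g(t)=\frac1{\Gamma(\beta)}\int_0^t(t-s)^{\beta-1}g(s)\,ds$ and $\partial_t^\alpha u=\mathcal I^{1-\alpha}u'$.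 There is a constant $C>0$ depending only on $\alpha$ and $T$ such that the following holds. Let $q\in[-1,1]$ and $f\in W^{1,\infty}(0,T;D(A^{q/2}))\cap W^{2,1}(0,T;L^2(\Omega))$, where $f$ and $f'$ denote the representatives that are continuous on $[0,T]$ with values in $L^2(\Omega)$. Let $u\in L^1(0,T;V)\cap W^{1,1}(0,T;V^*)$ be the weak solution of $\partial_t^\alpha u+Au=f$, $u(0)=0$, that is, for every $v\in V$, $$\mathcal I^{1-\alpha}\big(\langle u'(\cdot),v\rangle\big)(t)+a(u(t),v)=(f(t),v)\quad\text{for a.e. }t\in(0,T),\qquad \lim_{t\to0}\|u(t)\|_{V^*}=0,$$ where the limit is that of the representative of $u$ that is continuous on $[0,T]$ with values in $V^*$. Then $u$ has a representative in $C([0,T];L^2(\Omega))$, again denoted by $u$, which is differentiable in $L^2(\Omega)$ at every $t\in(0,T]$ (from the left at $t=T$). The derivative $u'$ is absolutely continuous on $[\delta,T]$ for every $\delta\in(0,T)$ and differentiable a.e. with values in $L^2(\Omega)$, and it is the integral of its a.e. derivative $u''$. The Bochner integral defining $\partial_t^\alpha u(t)$ converges in $L^2(\Omega)$ for every $t\in[0,T]$.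 For all $\epsilon\in(0,1)$, $$\|u(t)\|_{D(A^{q/2+1-\epsilon/2})}\le C\epsilon^{-1}t^{\alpha\epsilon/2}\|f\|_{L^\infty(0,t;D(A^{q/2}))},\quad t\in[0,T],$$ $$\|u'(t)\|_{D(A^{q/2+1-\epsilon/2})}\le C\big(\epsilon^{-1}t^{\alpha\epsilon/2}\|f'\|_{L^\infty(0,t;D(A^{q/2}))}+t^{-1+\alpha\epsilon/2}\|f(0)\|_{D(A^{q/2})}\big),\quad t\in(0,T],$$ $$\|u''(t)\|\le C\big(\mathcal I^\alpha\|f''(\cdot)\|(t)+t^{\alpha-1}\|f'(0)\|+t^{\alpha-2}\|f(0)\|\big)\quad\text{for a.e. }t\in(0,T),$$ $$\|\partial_t^\alpha u(t)\|\le C\big(\epsilon^{-1}t^{\alpha\epsilon/2}\|f\|_{L^\infty(0,t;D(A^{\epsilon/2}))}+\|f(t)\|\big),\quad t\in[0,T],$$ where the last bound is trivial if $t>0$ and $\|f\|_{L^\infty(0,t;D(A^{\epsilon/2}))}=\infty$. -/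

import Mathlib

open MeasureTheory Set Filter Topology
open scoped ENNReal ContDiff

noncomputable section

namespace TimeFracBiharmonic

/-! ### Function spaces on a planar domain -/

/-- The Euclidean plane. -/
abbrev Plane : Type := EuclideanSpace ℝ (Fin 2)

/-- The real Hilbert space `L²(Ω)`. -/
abbrev L2 (Ω : Set Plane) : Type := Lp ℝ 2 (volume.restrict Ω)

/-- Test functions: smooth functions with compact support contained in `Ω`. -/
def IsTest (Ω : Set Plane) (φ : Plane → ℝ) : Prop :=
  ContDiff ℝ ∞ φ ∧ HasCompactSupport φ ∧ tsupport φ ⊆ Ω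

/-- The `i`-th classical partial derivative. -/
def partialD (i : Fin 2) (φ : Plane → ℝ) : Plane → ℝ :=
  fun x => fderiv ℝ φ x (EuclideanSpace.single i 1)

/-- Labels of the entries of a second order jet: the function, its two first derivatives,
its four second derivatives. -/
abbrev JetIdx : Type := Unit ⊕ Fin 2 ⊕ (Fin 2 × Fin 2)

/-- Second order jets `(v, ∂ᵢv, ∂ⱼ∂ᵢv)` with entries in `L²(Ω)`; the Hilbert norm of this space
is the `H²`-norm. -/
abbrev H2Jet (Ω : Set Plane) : Type := PiLp 2 (fun _ : JetIdx => L2 Ω)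

/-- The jets of the test functions on `Ω`. -/
def testJets (Ω : Set Plane) : Set (H2Jet Ω) :=
  {J | ∃ φ : Plane → ℝ, IsTest Ω φ ∧
    (J (Sum.inl ()) : Plane → ℝ) =ᵐ[volume.restrict Ω] φ ∧
    (∀ i, (J (Sum.inr (Sum.inl i)) : Plane → ℝ) =ᵐ[volume.restrict Ω] partialD i φ) ∧
    (∀ i j, (J (Sum.inr (Sum.inr (i, j))) : Plane → ℝ)
      =ᵐ[volume.restrict Ω] partialD j (partialD i φ))}

/-- `H²₀(Ω)`, the closure of the test functions in the `H²`-norm; an element is stored together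
with its weak derivatives. (The jets of test functions already form a linear space.) -/
def H20Sub (Ω : Set Plane) : Submodule ℝ (H2Jet Ω) :=
  (Submodule.span ℝ (testJets Ω)).topologicalClosure

/-- The Hilbert space `V = H²₀(Ω)`. -/
def H20 (Ω : Set Plane) : Type := ↥(H20Sub Ω)

instance (Ω : Set Plane) : NormedAddCommGroup (H20 Ω) :=
  inferInstanceAs (NormedAddCommGroup ↥(H20Sub Ω))

instance (Ω : Set Plane) : InnerProductSpace ℝ (H20 Ω) :=
  inferInstanceAs (InnerProductSpace ℝ ↥(H20Sub Ω))

instance (Ω : Set Plane) : CompleteSpace (H20 Ω) :=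
  inferInstanceAs (CompleteSpace ↥((Submodule.span ℝ (testJets Ω)).topologicalClosure))

/-- The jet of an element of `V`. -/
def H20.jet (Ω : Set Plane) : H20 Ω →L[ℝ] H2Jet Ω := (H20Sub Ω).subtypeL

/-- The embedding `V → L²(Ω)`. -/
def H20.toL2 (Ω : Set Plane) : H20 Ω →L[ℝ] L2 Ω :=
  (PiLp.proj 2 (fun _ : JetIdx => L2 Ω) (Sum.inl ())).comp (H20.jet Ω)

/-- The weak second derivative `∂ⱼ∂ᵢ v` of `v ∈ V`. -/
def H20.hess {Ω : Set Plane} (v : H20 Ω) (i j : Fin 2) : L2 Ω :=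
  H20.jet Ω v (Sum.inr (Sum.inr (i, j)))

/-- The bilinear form `a(v, w) = ∫_Ω D²v : D²w`. -/
def aForm {Ω : Set Plane} (v w : H20 Ω) : ℝ :=
  ∑ i : Fin 2, ∑ j : Fin 2, inner ℝ (v.hess i j) (w.hess i j)

/-- The dual space `V*`. -/
abbrev H20Dual (Ω : Set Plane) : Type := H20 Ω →L[ℝ] ℝ

/-- The embedding `L²(Ω) → V*`, `⟨g, v⟩ = (g, v)`. -/
def toDual {Ω : Set Plane} (g : L2 Ω) : H20Dual Ω :=
  (innerSL ℝ g).comp (H20.toL2 Ω)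

/-! ### The biharmonic operator with clamped boundary conditions and its powers -/

/-- `v ∈ D(A)` and `A v = g`: here `v ∈ H²₀(Ω)`, and the distribution `Δ²v` is the function
`g ∈ L²(Ω)`. -/
def HasBilaplacian {Ω : Set Plane} (v : H20 Ω) (g : L2 Ω) : Prop :=
  ∀ ψ : Plane → ℝ, IsTest Ω ψ →
    ∫ x in Ω, (H20.toL2 Ω v) x * Laplacian.laplacian (Laplacian.laplacian ψ) x
      = ∫ x in Ω, g x * ψ x

/-- An orthonormal basis of `L²(Ω)` consisting of eigenfunctions of `A`, with the corresponding
eigenvalues. The order in which the eigenvalues are listed does not matter below. -/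
structure EigenSystem (Ω : Set Plane) where
  /-- the eigenvalues -/
  μ : ℕ → ℝ
  /-- the eigenfunctions -/
  φ : HilbertBasis ℕ ℝ (L2 Ω)
  pos : ∀ j, 0 < μ j
  eigen : ∀ j, ∃ v : H20 Ω, H20.toL2 Ω v = φ j ∧ HasBilaplacian v (μ j • φ j)

/-- The norm of `D(A^r)`, `r ∈ ℝ`, on elements of `L²(Ω)`:
`(∑ⱼ μⱼ^(2r) (v, φⱼ)²)^(1/2)`. It is `∞` exactly if `v ∉ D(A^r)`. -/
def EigenSystem.powNorm {Ω : Set Plane} (e : EigenSystem Ω) (r : ℝ) (v : L2 Ω) : ℝ≥0∞ :=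
  (∑' j, ENNReal.ofReal (e.μ j ^ (2 * r) * (inner ℝ (e.φ j) v) ^ 2)) ^ (1 / 2 : ℝ)

/-- The norm of `L^∞(0, t; D(A^r))`, for functions with values in `L²(Ω)`. -/
def EigenSystem.supNorm {Ω : Set Plane} (e : EigenSystem Ω) (r t : ℝ) (g : ℝ → L2 Ω) : ℝ≥0∞ :=
  essSup (fun s => e.powNorm r (g s)) (volume.restrict (Ioo 0 t))

/-! ### Calculus in time -/

section Time

variable {X : Type*} [NormedAddCommGroup X] [NormedSpace ℝ X]

/-- The kernel `κ_β(x) = x^(β-1) / Γ(β)`. -/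
def rlKernel (β x : ℝ) : ℝ := x ^ (β - 1) / Real.Gamma β

/-- The Riemann-Liouville fractional integral `I^β g (t)`. -/
def rlIntegral (β : ℝ) (g : ℝ → X) (t : ℝ) : X :=
  ∫ s in (0 : ℝ)..t, rlKernel β (t - s) • g s

/-- The Caputo derivative of order `α` at `t`, of a function whose time derivative is `g'`. -/
def caputo (α : ℝ) (g' : ℝ → X) (t : ℝ) : X := rlIntegral (1 - α) g' t

/-- `g'` is the weak derivative of `g` on the interval `(0, T)`, both being Bochner
integrable there: `g ∈ W^{1,1}(0, T; X)`. -/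
structure HasW11Deriv (T : ℝ) (g g' : ℝ → X) : Prop where
  integrable : IntegrableOn g (Ioo 0 T)
  integrable_deriv : IntegrableOn g' (Ioo 0 T)
  integral_eq : ∀ θ : ℝ → ℝ, ContDiff ℝ ∞ θ → HasCompactSupport θ → tsupport θ ⊆ Ioo 0 T →
    ∫ t in Ioo 0 T, deriv θ t • g t = - ∫ t in Ioo 0 T, θ t • g' t

/-- `f ∈ W^{2,1}(0, T; X)` with weak derivatives `f' = f₁` and `f'' = f₂`, where `f` and `f₁` are
the representatives that are continuous on `[0, T]`. -/
structure MemW21 (T : ℝ) (f f₁ f₂ : ℝ → X) : Prop where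
  deriv₁ : HasW11Deriv T f f₁
  deriv₂ : HasW11Deriv T f₁ f₂
  cont : ContinuousOn f (Icc 0 T)
  cont₁ : ContinuousOn f₁ (Icc 0 T)

end Time

/-- Weak solutions `u ∈ L¹(0, T; V) ∩ W^{1,1}(0, T; V*)` of `∂ₜ^α u + A u = f`, `u(0) = u₀`.
The initial condition refers to the representative of `u` that is continuous with values
in `V*`. -/
def IsWeakSolution {Ω : Set Plane} (α T : ℝ) (f : ℝ → H20Dual Ω) (u₀ : L2 Ω)
    (u : ℝ → H20 Ω) : Prop :=
  IntegrableOn u (Ioo 0 T) ∧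
  ∃ u' : ℝ → H20Dual Ω,
    HasW11Deriv T (fun t => toDual (H20.toL2 Ω (u t))) u' ∧
    (∀ v : H20 Ω, ∀ᵐ t ∂(volume.restrict (Ioo 0 T)),
      caputo α (fun s => u' s v) t + aForm (u t) v = f t v) ∧
    ∃ U : ℝ → H20Dual Ω, ContinuousOn U (Icc 0 T) ∧
      (∀ᵐ t ∂(volume.restrict (Ioo 0 T)), U t = toDual (H20.toL2 Ω (u t))) ∧
      Tendsto (fun t => ‖U t - toDual u₀‖) (𝓝[>] 0) (𝓝 0)

end TimeFracBiharmonic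

end

open TimeFracBiharmonic

open MeasureTheory Set Filter Topology
open scoped ENNReal ContDiff

namespace TimeFracBiharmonic

/-! ### The Riemann-Liouville kernels -/

/-! In an eigenbasis the equation decouples into scalar problems ∂ₜ^α w + l w = g, w(0) = 0, with l
= μⱼ > 0. Their solution is w = E * g, where E(t) = t^(α-1) E_{α,α}(-l t^α) is `relaxKernel` and *
is `halfConv`. The theorem reduces to bounds on E that are uniform in l ≥ 0, which is why the
constant sees neither Ω nor q: 0 ≤ E ≤ κ_α, l E ≤ 1/t and |E'| ≤ (5/Γ(α)) t^(α-2). Interpolating the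
first two (`rpow_mul_relaxKernel_le`) gives l^(1-ε/2) E(t) ≤ B t^(-1+αε/2) with B = max(1, 1/Γ(α)).
Integrating this in time costs the factor 2/(αε), the source of ε⁻¹ in the estimates.

The kernel bounds use no complex analysis. The power series of E yields three identities: the
Volterra equation E = κ_α - l κ_α * E, the formula κ_{1-α} * E = 1 - l ∫E, and t E = α ∫(E - l E *
E). Nonnegativity of E (`relaxKernel_nonneg`) is a first-zero argument in the Volterra equation,
based on the log-convexity of κ_α. The upper bounds then come from discarding nonnegative terms in
these identities.

For u = E * f one has u' = E f(0) + E * f', u'' = E' f(0) + E f'(0) + E * f'' and ∂ₜ^α u = f - A u.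
All of these are proved coefficient by coefficient from associativity of the convolution. Norms in
D(A^r) are suprema over finite spectral sections (`EigenSystem.powNorm_le_iff`), so unbounded
operators are never needed.

A weak solution is identified with Duhamel's formula by testing with φⱼ: the du Bois-Reymond lemma
turns the weak derivative into an integral, and `relaxation_unique` solves the resulting scalar
equation.

Existence of an eigenbasis rests on a planar estimate: the L² norm of ∂₁∂₀φ controls both the sup
norm and the Hölder-1/2 seminorm of a test function φ (`sq_sub_le_of_mixed_deriv`). The sup bound
gives coercivity of a, and both together give compactness of V → L² by Arzelà-Ascoli. Lax-Milgram
and the spectral theorem for compact symmetric operators finish the argument. -/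

/-- The one-sided convolution `(a * b)(t) = ∫₀ᵗ a(t - s) b(s) ds`. -/
noncomputable def halfConv (a b : ℝ → ℝ) (t : ℝ) : ℝ := ∫ s in (0 : ℝ)..t, a (t - s) * b s

lemma rlKernel_pos {b x : ℝ} (hb : 0 < b) (hx : 0 < x) : 0 < rlKernel b x :=
  div_pos (Real.rpow_pos_of_pos hx _) (Real.Gamma_pos_of_pos hb)

lemma rlKernel_nonneg {b x : ℝ} (hb : 0 < b) (hx : 0 ≤ x) : 0 ≤ rlKernel b x :=
  div_nonneg (Real.rpow_nonneg hx _) (Real.Gamma_pos_of_pos hb).le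

lemma rlKernel_one (x : ℝ) : rlKernel 1 x = 1 := by simp [rlKernel]

lemma measurable_rlKernel (b : ℝ) : Measurable (rlKernel b) := by
  unfold rlKernel; fun_prop

lemma continuousOn_rlKernel (b : ℝ) : ContinuousOn (rlKernel b) (Ioi 0) := by
  unfold rlKernel
  exact (continuousOn_id.rpow_const fun x hx => Or.inl (ne_of_gt hx)).div_const _

lemma intervalIntegrable_rpow_mul_rpow {a b t : ℝ} (ha : 0 < a) (hb : 0 < b) (ht : 0 < t) :
    IntervalIntegrable (fun s => s ^ (b - 1) * (t - s) ^ (a - 1)) volume 0 t ∧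
    ∫ s in (0 : ℝ)..t, s ^ (b - 1) * (t - s) ^ (a - 1)
      = t ^ (a + b - 1) * ProbabilityTheory.beta b a := by
  have key := Complex.betaIntegral_scaled (b : ℂ) (a : ℂ) ht
  have hbeta : Complex.betaIntegral b a = (ProbabilityTheory.beta b a : ℝ) := by
    rw [Complex.betaIntegral_eq_Gamma_mul_div _ _ (by simpa) (by simpa), ProbabilityTheory.beta,
      ← Complex.ofReal_add, Complex.Gamma_ofReal, Complex.Gamma_ofReal, Complex.Gamma_ofReal]
    norm_cast
  have hrhs : (t : ℂ) ^ ((b : ℂ) + a - 1) * Complex.betaIntegral b a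
      = ((t ^ (a + b - 1) * ProbabilityTheory.beta b a : ℝ) : ℂ) := by
    rw [hbeta, Complex.ofReal_mul, Complex.ofReal_cpow ht.le]
    push_cast
    rw [add_comm (a : ℂ)]
  have hcongr : ∫ x in (0 : ℝ)..t, (x : ℂ) ^ ((b : ℂ) - 1) * ((t : ℂ) - x) ^ ((a : ℂ) - 1)
      = ∫ x in (0 : ℝ)..t, ((x ^ (b - 1) * (t - x) ^ (a - 1) : ℝ) : ℂ) := by
    refine intervalIntegral.integral_congr fun x hx => ?_
    rw [uIcc_of_le ht.le] at hx
    rw [Complex.ofReal_mul, Complex.ofReal_cpow hx.1, Complex.ofReal_cpow (by linarith [hx.2])]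
    push_cast
    rfl
  rw [hcongr, hrhs, intervalIntegral.integral_ofReal, Complex.ofReal_inj] at key
  refine ⟨?_, key⟩
  -- The integral of a non-integrable function is 0 by convention, whereas the Beta value is
  -- positive; so the formula itself proves integrability.
  by_contra h
  rw [intervalIntegral.integral_undef h] at key
  exact absurd key.symm
    (mul_pos (Real.rpow_pos_of_pos ht _) (ProbabilityTheory.beta_pos hb ha)).ne'

lemma intervalIntegrable_rlKernel_mul {a b t : ℝ} (ha : 0 < a) (hb : 0 < b) (ht : 0 < t) :
    IntervalIntegrable (fun s => rlKernel a (t - s) * rlKernel b s) volume 0 t := by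
  have := ((intervalIntegrable_rpow_mul_rpow ha hb ht).1).const_mul
    ((Real.Gamma a)⁻¹ * (Real.Gamma b)⁻¹)
  refine this.congr fun s _ => ?_
  simp only [rlKernel]
  ring

lemma halfConv_rlKernel {a b t : ℝ} (ha : 0 < a) (hb : 0 < b) (ht : 0 < t) :
    halfConv (rlKernel a) (rlKernel b) t = rlKernel (a + b) t := by
  have h : ∀ s, rlKernel a (t - s) * rlKernel b s
      = ((Real.Gamma a)⁻¹ * (Real.Gamma b)⁻¹) * (s ^ (b - 1) * (t - s) ^ (a - 1)) := fun s => by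
    simp only [rlKernel]; ring
  simp only [halfConv, h]
  rw [intervalIntegral.integral_const_mul, (intervalIntegrable_rpow_mul_rpow ha hb ht).2,
    ProbabilityTheory.beta, rlKernel, add_comm b a]
  have h1 := (Real.Gamma_pos_of_pos ha).ne'
  have h2 := (Real.Gamma_pos_of_pos hb).ne'
  field_simp

lemma intervalIntegrable_rlKernel {b : ℝ} (hb : 0 < b) (s t : ℝ) :
    IntervalIntegrable (rlKernel b) volume s t := by
  unfold rlKernel
  exact (intervalIntegral.intervalIntegrable_rpow' (by linarith)).div_const _

lemma integral_rlKernel {b t : ℝ} (hb : 0 < b) (ht : 0 < t) :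
    ∫ s in (0 : ℝ)..t, rlKernel b s = rlKernel (1 + b) t := by
  rw [← halfConv_rlKernel one_pos hb ht]
  simp [halfConv, rlKernel_one]

lemma mul_rlKernel {b t : ℝ} (hb : 0 < b) (ht : 0 < t) :
    t * rlKernel b t = b * rlKernel (b + 1) t := by
  rw [rlKernel, rlKernel, Real.Gamma_add_one hb.ne', add_sub_cancel_right, Real.rpow_sub_one ht.ne']
  have h2 := (Real.Gamma_pos_of_pos hb).ne'
  field_simp

/-- Superexponential growth of the Gamma function. -/
lemma inv_Gamma_le {R y : ℝ} (hR : 0 < R) (hy : 0 < y) :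
    (Real.Gamma y)⁻¹ ≤ Real.exp (R * Real.exp 1) * (R ^ y)⁻¹ := by
  -- Γ(y+1) is at least its tail integral over x > Q, hence at least Q^y e^(-Q). The extra factor e
  -- in Q supplies e^y, which absorbs the y in Γ(y+1) = y Γ(y).
  set Q := R * Real.exp 1 with hQ
  have hQ0 : 0 < Q := mul_pos hR (Real.exp_pos 1)
  have h1 : Q ^ y * Real.exp (-Q) ≤ Real.Gamma (y + 1) := by
    rw [Real.Gamma_eq_integral (by linarith), ← integral_exp_neg_Ioi Q, ← integral_const_mul]
    have hint := Real.GammaIntegral_convergent (s := y + 1) (by linarith)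
    calc ∫ x in Ioi Q, Q ^ y * Real.exp (-x)
        ≤ ∫ x in Ioi Q, Real.exp (-x) * x ^ (y + 1 - 1) := by
          refine setIntegral_mono_on ((integrableOn_exp_neg_Ioi Q).const_mul _)
            (hint.mono_set (Ioi_subset_Ioi hQ0.le)) measurableSet_Ioi fun x hx => ?_
          rw [mul_comm, add_sub_cancel_right]
          exact mul_le_mul_of_nonneg_left (Real.rpow_le_rpow hQ0.le (le_of_lt hx) hy.le)
            (Real.exp_pos _).le
      _ ≤ _ := setIntegral_mono_set hint
          ((ae_restrict_mem measurableSet_Ioi).mono fun x hx =>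
            mul_nonneg (Real.exp_pos _).le (Real.rpow_nonneg (le_of_lt hx) _))
          (Ioi_subset_Ioi hQ0.le).eventuallyLE
  rw [Real.Gamma_add_one hy.ne'] at h1
  have hG := Real.Gamma_pos_of_pos hy
  have h2 : Q ^ y = R ^ y * Real.exp y := by
    rw [hQ, Real.mul_rpow hR.le (Real.exp_pos 1).le, Real.exp_one_rpow]
  have h3 : y ≤ Real.exp y := by linarith [Real.add_one_le_exp y]
  have hRy := Real.rpow_pos_of_pos hR y
  rw [h2, Real.exp_neg] at h1
  have h4 : R ^ y * Real.exp y * (Real.exp Q)⁻¹ ≤ Real.exp y * Real.Gamma y :=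
    h1.trans (mul_le_mul_of_nonneg_right h3 hG.le)
  have h5 : R ^ y * (Real.exp Q)⁻¹ ≤ Real.Gamma y := by
    have := Real.exp_pos y
    refine le_of_mul_le_mul_left ?_ this
    linarith
  rw [inv_le_comm₀ hG (by positivity), mul_inv, inv_inv]
  linarith

/-- Log-convexity of the kernel. -/
lemma rlKernel_mul_le {a x y h : ℝ} (ha₀ : 0 < a) (ha : a < 1) (hx : 0 < x) (hxy : x ≤ y)
    (hh : 0 ≤ h) :
    rlKernel a (x + h) * rlKernel a y ≤ rlKernel a (y + h) * rlKernel a x := by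
  have hG := Real.Gamma_pos_of_pos ha₀
  have hy : 0 < y := hx.trans_le hxy
  simp only [rlKernel]
  rw [div_mul_div_comm, div_mul_div_comm, ← Real.mul_rpow (by linarith) hy.le,
    ← Real.mul_rpow (by linarith) hx.le]
  refine div_le_div_of_nonneg_right ?_ (mul_pos hG hG).le
  refine Real.rpow_le_rpow_of_nonpos (by positivity) ?_ (by linarith)
  nlinarith

/-! ### Weakly singular functions and their one-sided convolutions -/

/-- Functions on `(0, T]` that are dominated by the kernel `κ_p`. -/
structure IsWeaklySingular (p T : ℝ) (g : ℝ → ℝ) : Prop where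
  meas : AEStronglyMeasurable g (volume.restrict (Ioc 0 T))
  bound : ∃ K : ℝ, 0 ≤ K ∧ ∀ x ∈ Ioc 0 T, |g x| ≤ K * rlKernel p x

lemma isWeaklySingular_rlKernel {p : ℝ} (hp : 0 < p) (T : ℝ) :
    IsWeaklySingular p T (rlKernel p) :=
  ⟨(measurable_rlKernel p).aestronglyMeasurable, 1, zero_le_one, fun x hx => by
    rw [one_mul, abs_of_nonneg (rlKernel_nonneg hp hx.1.le)]⟩

lemma IsWeaklySingular.intervalIntegrable {p T : ℝ} {g : ℝ → ℝ} (hg : IsWeaklySingular p T g)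
    (hp : 0 < p) (hT : 0 ≤ T) : IntervalIntegrable g volume 0 T := by
  obtain ⟨hm, K, hK, hb⟩ := hg
  refine ((intervalIntegrable_rlKernel hp 0 T).const_mul K).mono_fun' (by rwa [uIoc_of_le hT]) ?_
  rw [uIoc_of_le hT]
  exact (ae_restrict_mem measurableSet_Ioc).mono fun x hx => hb x hx

lemma aestronglyMeasurable_comp_sub {g : ℝ → ℝ} {t : ℝ}
    (hg : AEStronglyMeasurable g (volume.restrict (Ioc 0 t))) :
    AEStronglyMeasurable (fun s => g (t - s)) (volume.restrict (Ioc 0 t)) := by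
  have hpre : (fun s : ℝ => t - s) ⁻¹' (Ico 0 t) = Ioc 0 t := by ext; simp
  have h := (Measure.measurePreserving_sub_left volume t).restrict_preimage
    (measurableSet_Ico (a := (0 : ℝ)) (b := t))
  rw [hpre] at h
  rw [← restrict_Ico_eq_restrict_Ioc] at hg
  exact hg.comp_measurePreserving h

lemma IsWeaklySingular.intervalIntegrable_mul {p q t : ℝ} {g h : ℝ → ℝ}
    (hg : IsWeaklySingular p t g) (hh : IsWeaklySingular q t h) (hp : 0 < p) (hq : 0 < q)
    (ht : 0 < t) : IntervalIntegrable (fun s => g (t - s) * h s) volume 0 t := by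
  obtain ⟨hm, K, hK, hb⟩ := hg
  obtain ⟨hm', K', hK', hb'⟩ := hh
  refine ((intervalIntegrable_rlKernel_mul hp hq ht).const_mul (K * K')).mono_fun' ?_ ?_
  · rw [uIoc_of_le ht.le]
    exact (aestronglyMeasurable_comp_sub hm).mul hm'
  -- At s = t the first factor is g 0, about which the bound says nothing; this endpoint is dropped
  -- as a null set.
  · rw [uIoc_of_le ht.le, ← restrict_Ioo_eq_restrict_Ioc]
    refine (ae_restrict_mem measurableSet_Ioo).mono fun s hs => ?_
    have h1 := hb (t - s) ⟨by linarith [hs.2], by linarith [hs.1]⟩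
    have h2 := hb' s ⟨hs.1, hs.2.le⟩
    beta_reduce
    rw [Real.norm_eq_abs, abs_mul]
    calc |g (t - s)| * |h s| ≤ (K * rlKernel p (t - s)) * (K' * rlKernel q s) :=
          mul_le_mul h1 h2 (abs_nonneg _)
            (mul_nonneg hK (rlKernel_nonneg hp (by linarith [hs.2])))
      _ = _ := by ring

lemma halfConv_comm (a b : ℝ → ℝ) (t : ℝ) : halfConv a b t = halfConv b a t := by
  have := intervalIntegral.integral_comp_sub_left (fun s => b (t - s) * a s) t
    (a := 0) (b := t)
  simp only [sub_zero, sub_self, sub_sub_cancel] at this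
  rw [halfConv, halfConv, ← this]
  exact intervalIntegral.integral_congr fun s _ => mul_comm _ _

lemma halfConv_congr {a a' b b' : ℝ → ℝ} {t : ℝ} (ht : 0 ≤ t)
    (ha : ∀ s ∈ Ioo 0 t, a s = a' s) (hb : ∀ s ∈ Ioo 0 t, b s = b' s) :
    halfConv a b t = halfConv a' b' t := by
  simp only [halfConv, intervalIntegral.integral_of_le ht, ← restrict_Ioo_eq_restrict_Ioc]
  refine setIntegral_congr_fun measurableSet_Ioo fun s hs => ?_
  rw [ha _ ⟨by linarith [hs.2], by linarith [hs.1]⟩, hb _ hs]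

/-! ### Series of kernels (two-parameter Mittag-Leffler functions) -/

/-- The series `∑ₙ cₙ κ_{nα+b}(t)`; for `cₙ = (-λ)ⁿ` it is `t^(b-1) E_{α,b}(-λ t^α)`. -/
noncomputable def kernelSeries (α b : ℝ) (c : ℕ → ℝ) (t : ℝ) : ℝ :=
  ∑' n : ℕ, c n * rlKernel (n * α + b) t

/-- Coefficients of at most geometric growth. -/
def GeomBounded (c : ℕ → ℝ) : Prop := ∃ K B : ℝ, 0 ≤ K ∧ 0 < B ∧ ∀ n, |c n| ≤ K * B ^ n

section Series

variable {α b : ℝ} {c : ℕ → ℝ}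

lemma add_index_pos (hα : 0 < α) (hb : 0 < b) (n : ℕ) : 0 < n * α + b := by positivity

/-- Gamma beats every geometric sequence. In `inv_Gamma_le` choose R with R^α = 2 B T^α: then
1/Γ(nα+b) carries (2 B T^α)^(-n), which cancels B^n t^(nα) and leaves 2^(-n). Keeping κ_b(t) as a
factor preserves the exact singularity at t = 0. -/
lemma GeomBounded.exists_term_bound (hc : GeomBounded c) (hα : 0 < α) (hb : 0 < b) {T : ℝ}
    (hT : 0 < T) : ∃ M : ℝ, 0 ≤ M ∧ ∀ n : ℕ, ∀ t ∈ Ioc 0 T,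
      |c n| * rlKernel (n * α + b) t ≤ M * (1 / 2) ^ n * rlKernel b t := by
  obtain ⟨K, B, hK, hB, hcn⟩ := hc
  set X := 2 * B * T ^ α with hX
  have hTα : 0 < T ^ α := Real.rpow_pos_of_pos hT _
  have hX0 : 0 < X := by positivity
  set R := X ^ (α⁻¹) with hR
  have hR0 : 0 < R := Real.rpow_pos_of_pos hX0 _
  have hRα : R ^ α = X := by rw [hR, ← Real.rpow_mul hX0.le, inv_mul_cancel₀ hα.ne', Real.rpow_one]
  set C := Real.exp (R * Real.exp 1) with hC
  have hG := Real.Gamma_pos_of_pos hb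
  have hRb := Real.rpow_pos_of_pos hR0 b
  refine ⟨K * C * (R ^ b)⁻¹ * Real.Gamma b, by positivity, fun n t ht => ?_⟩
  have hidx := add_index_pos hα hb n
  have hGn := Real.Gamma_pos_of_pos hidx
  have h1 := inv_Gamma_le hR0 hidx
  have h2 : R ^ (n * α + b) = X ^ n * R ^ b := by
    rw [Real.rpow_add hR0, mul_comm (n : ℝ) α, Real.rpow_mul_natCast hR0.le, hRα]
  have h3 : t ^ (n * α + b - 1) = (t ^ α) ^ n * t ^ (b - 1) := by
    rw [add_sub_assoc, Real.rpow_add ht.1, mul_comm (n : ℝ) α, Real.rpow_mul_natCast ht.1.le]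
  have h4 : (t ^ α) ^ n ≤ (T ^ α) ^ n :=
    pow_le_pow_left₀ (Real.rpow_nonneg ht.1.le _) (Real.rpow_le_rpow ht.1.le ht.2 hα.le) n
  have htb := Real.rpow_nonneg ht.1.le (b - 1)
  rw [rlKernel, rlKernel, h3, div_eq_mul_inv]
  rw [h2] at h1
  calc |c n| * ((t ^ α) ^ n * t ^ (b - 1) * (Real.Gamma (n * α + b))⁻¹)
      ≤ (K * B ^ n) * ((T ^ α) ^ n * t ^ (b - 1) * (C * (X ^ n * R ^ b)⁻¹)) := by
        have h5 : 0 ≤ (Real.Gamma (n * α + b))⁻¹ := inv_nonneg.2 hGn.le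
        have h6 : 0 ≤ (t ^ α) ^ n := pow_nonneg (Real.rpow_nonneg ht.1.le _) n
        exact mul_le_mul (hcn n) (mul_le_mul (mul_le_mul_of_nonneg_right h4 htb) h1 h5
          (by positivity)) (by positivity) (by positivity)
    _ = _ := by
        rw [hX, mul_pow, mul_pow, div_pow, one_pow]
        field_simp

lemma GeomBounded.summable (hc : GeomBounded c) (hα : 0 < α) (hb : 0 < b) {t : ℝ} (ht : 0 < t) :
    Summable fun n : ℕ => c n * rlKernel (n * α + b) t := by
  obtain ⟨M, hM, h⟩ := hc.exists_term_bound hα hb ht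
  refine Summable.of_norm_bounded
    ((summable_geometric_of_lt_one (r := (1 : ℝ) / 2) (by norm_num) (by norm_num)).mul_left
      (M * rlKernel b t)) fun n => ?_
  rw [Real.norm_eq_abs, abs_mul, abs_of_nonneg (rlKernel_nonneg (add_index_pos hα hb n) ht.le)]
  linarith [h n t ⟨ht, le_rfl⟩]

lemma GeomBounded.abs_kernelSeries_le (hc : GeomBounded c) (hα : 0 < α) (hb : 0 < b) {T : ℝ}
    (hT : 0 < T) : ∃ K : ℝ, 0 ≤ K ∧ ∀ t ∈ Ioc 0 T, |kernelSeries α b c t| ≤ K * rlKernel b t := by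
  obtain ⟨M, hM, h⟩ := hc.exists_term_bound hα hb hT
  refine ⟨M * 2, by positivity, fun t ht => ?_⟩
  have hg := (hasSum_geometric_two).mul_left (M * rlKernel b t)
  have := tsum_of_norm_bounded hg (f := fun n : ℕ => c n * rlKernel (n * α + b) t) fun n => by
    rw [Real.norm_eq_abs, abs_mul, abs_of_nonneg (rlKernel_nonneg (add_index_pos hα hb n) ht.1.le)]
    linarith [h n t ht]
  rw [Real.norm_eq_abs] at this
  rw [kernelSeries]
  linarith

lemma GeomBounded.continuousOn_kernelSeries (hc : GeomBounded c) (hα : 0 < α) (hb : 0 < b) :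
    ContinuousOn (kernelSeries α b c) (Ioi 0) := by
  have key : ∀ r R : ℝ, 0 < r → r < R → ContinuousOn (kernelSeries α b c) (Icc r R) := by
    intro r R hr hrR
    obtain ⟨M, hM, h⟩ := hc.exists_term_bound hα hb (hr.trans hrR)
    have hsub : Icc r R ⊆ Ioi 0 := fun x hx => hr.trans_le hx.1
    obtain ⟨N, hN⟩ := isCompact_Icc.exists_bound_of_continuousOn
      ((continuousOn_rlKernel b).mono hsub)
    refine continuousOn_tsum (u := fun n => M * (1 / 2) ^ n * N)
      (fun n => (continuousOn_const.mul ((continuousOn_rlKernel _).mono hsub)))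
      (((summable_geometric_of_lt_one (by norm_num) (by norm_num)).mul_left M).mul_right N) ?_
    intro n t ht
    have ht0 : 0 < t := hsub ht
    rw [Real.norm_eq_abs, abs_mul, abs_of_nonneg (rlKernel_nonneg (add_index_pos hα hb n) ht0.le)]
    refine (h n t ⟨ht0, ht.2⟩).trans ?_
    exact mul_le_mul_of_nonneg_left ((le_abs_self _).trans (hN t ht)) (by positivity)
  intro t ht
  have ht0 : (0 : ℝ) < t := ht
  have := (key (t / 2) (2 * t) (by linarith) (by linarith)).continuousAt
    (Icc_mem_nhds (half_lt_self ht0) (by linarith))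
  exact this.continuousWithinAt

lemma GeomBounded.isWeaklySingular (hc : GeomBounded c) (hα : 0 < α) (hb : 0 < b) {T : ℝ}
    (hT : 0 < T) : IsWeaklySingular b T (kernelSeries α b c) :=
  ⟨((hc.continuousOn_kernelSeries hα hb).mono fun _ hx => hx.1).aestronglyMeasurable
    measurableSet_Ioc, hc.abs_kernelSeries_le hα hb hT⟩

/-- Termwise integration: with |g| ≤ K κ_p, the n-th term has L¹ norm at most K |cₙ| κ_{nα+p+b}(t),
which is summable by `exists_term_bound` with p + b in place of b. -/
lemma GeomBounded.halfConv_kernelSeries (hc : GeomBounded c) (hα : 0 < α) (hb : 0 < b) {p t : ℝ}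
    (hp : 0 < p) (ht : 0 < t) {g : ℝ → ℝ} (hg : IsWeaklySingular p t g) :
    halfConv g (kernelSeries α b c) t = ∑' n : ℕ, c n * halfConv g (rlKernel (n * α + b)) t := by
  have hint : ∀ n : ℕ, IntervalIntegrable (fun s => g (t - s) * rlKernel (n * α + b) s)
      volume 0 t := fun n => hg.intervalIntegrable_mul
        (isWeaklySingular_rlKernel (add_index_pos hα hb n) t) hp (add_index_pos hα hb n) ht
  obtain ⟨hm, K, hK, hgb⟩ := hg
  obtain ⟨M, hM, h⟩ := hc.exists_term_bound hα (add_pos hp hb) ht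
  have hsum := hasSum_integral_of_summable_integral_norm (μ := volume.restrict (Ioc 0 t))
    (F := fun (n : ℕ) s => c n * (g (t - s) * rlKernel (n * α + b) s))
    (fun n => ((intervalIntegrable_iff_integrableOn_Ioc_of_le ht.le).1 (hint n)).const_mul _) ?_
  · have h2 := hsum.tsum_eq
    simp only [← intervalIntegral.integral_of_le ht.le, intervalIntegral.integral_const_mul] at h2
    simp only [halfConv]
    rw [h2]
    refine intervalIntegral.integral_congr fun s _ => ?_
    simp only [kernelSeries]
    rw [← tsum_mul_left]
    exact tsum_congr fun n => by ring
  · refine Summable.of_nonneg_of_le (fun n => integral_nonneg fun s => norm_nonneg _) (fun n => ?_)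
      ((summable_geometric_of_lt_one (r := (1 : ℝ) / 2) (by norm_num) (by norm_num)).mul_left
        (K * M * rlKernel (p + b) t))
    have hidx := add_index_pos hα hb n
    calc ∫ s in Ioc 0 t, ‖c n * (g (t - s) * rlKernel (n * α + b) s)‖
        ≤ ∫ s in Ioc 0 t, |c n| * (K * (rlKernel p (t - s) * rlKernel (n * α + b) s)) := by
          rw [← restrict_Ioo_eq_restrict_Ioc]
          have hi := hint n
          have hi2 := intervalIntegrable_rlKernel_mul hp hidx ht
          rw [intervalIntegrable_iff_integrableOn_Ioo_of_le ht.le] at hi hi2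
          refine setIntegral_mono_on (hi.const_mul _).norm ((hi2.const_mul _).const_mul _)
            measurableSet_Ioo fun s hs => ?_
          rw [Real.norm_eq_abs, abs_mul, abs_mul, abs_of_nonneg (rlKernel_nonneg hidx hs.1.le),
            ← mul_assoc K]
          exact mul_le_mul_of_nonneg_left (mul_le_mul_of_nonneg_right
            (hgb _ ⟨by linarith [hs.2], by linarith [hs.1]⟩) (rlKernel_nonneg hidx hs.1.le))
            (abs_nonneg _)
      _ = K * (|c n| * rlKernel (n * α + (p + b)) t) := by
          rw [integral_const_mul, integral_const_mul, ← intervalIntegral.integral_of_le ht.le]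
          have := halfConv_rlKernel hp hidx ht
          rw [halfConv] at this
          rw [this]
          ring_nf
      _ ≤ _ := by
          have := mul_le_mul_of_nonneg_left (h n t ⟨ht, le_rfl⟩) hK
          linarith

lemma GeomBounded.halfConv_rlKernel_kernelSeries (hc : GeomBounded c) (hα : 0 < α) (hb : 0 < b)
    {p t : ℝ} (hp : 0 < p) (ht : 0 < t) :
    halfConv (rlKernel p) (kernelSeries α b c) t = kernelSeries α (p + b) c t := by
  rw [hc.halfConv_kernelSeries hα hb hp ht (isWeaklySingular_rlKernel hp t), kernelSeries]
  refine tsum_congr fun n => ?_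
  rw [halfConv_rlKernel hp (add_index_pos hα hb n) ht]
  ring_nf

lemma GeomBounded.integral_kernelSeries (hc : GeomBounded c) (hα : 0 < α) (hb : 0 < b)
    {t : ℝ} (ht : 0 < t) :
    ∫ s in (0 : ℝ)..t, kernelSeries α b c s = kernelSeries α (1 + b) c t := by
  rw [← hc.halfConv_rlKernel_kernelSeries hα hb one_pos ht]
  simp [halfConv, rlKernel_one]

end Series

lemma geomBounded_pow (l : ℝ) : GeomBounded fun n => (-l) ^ n :=
  ⟨1, |l| + 1, zero_le_one, by positivity, fun n => by
    rw [abs_pow, abs_neg, one_mul]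
    exact pow_le_pow_left₀ (abs_nonneg _) (by linarith) n⟩

lemma geomBounded_succ_mul_pow (l : ℝ) : GeomBounded fun n => ((n : ℝ) + 1) * (-l) ^ n := by
  refine ⟨1, 2 * (|l| + 1), zero_le_one, by positivity, fun n => ?_⟩
  have h : (n : ℝ) + 1 ≤ 2 ^ n := by exact_mod_cast Nat.succ_le_of_lt Nat.lt_two_pow_self
  rw [abs_mul, abs_pow, abs_neg, one_mul, mul_pow, abs_of_nonneg (by positivity)]
  exact mul_le_mul h (pow_le_pow_left₀ (abs_nonneg _) (by linarith) n) (by positivity)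
    (by positivity)

/-- The term n = 0 is split off. With b = α this becomes the Volterra equation for E, and with b = 1
the formula for κ_{1-α} * E. -/
lemma kernelSeries_pow_eq {α b l t : ℝ} (hα : 0 < α) (hb : 0 < b) (ht : 0 < t) :
    kernelSeries α b (fun n => (-l) ^ n) t
      = rlKernel b t - l * kernelSeries α (α + b) (fun n => (-l) ^ n) t := by
  rw [kernelSeries, ((geomBounded_pow l).summable hα hb ht).tsum_eq_zero_add, kernelSeries,
    ← tsum_mul_left]
  simp only [pow_zero, one_mul, Nat.cast_zero, zero_mul, zero_add, sub_eq_add_neg, ← tsum_neg]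
  congr 1
  refine tsum_congr fun n => ?_
  rw [pow_succ]
  push_cast
  ring_nf

/-! ### The resolvent kernel of the scalar fractional relaxation equation -/

/-- `E_l(t) = t^(α-1) E_{α,α}(-l t^α)`, the kernel of the solution operator of
`∂ₜ^α u + l u = f`, `u(0) = 0`. -/
noncomputable def relaxKernel (α l : ℝ) : ℝ → ℝ := kernelSeries α α fun n => (-l) ^ n

/-- The self-convolution of `relaxKernel`. -/
noncomputable def relaxSquare (α l : ℝ) : ℝ → ℝ :=
  kernelSeries α (α + α) fun n => ((n : ℝ) + 1) * (-l) ^ n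

/-- The derivative of `relaxKernel`. -/
noncomputable def relaxDeriv (α l t : ℝ) : ℝ :=
  ((α - 1) * relaxKernel α l t - α * (l * relaxSquare α l t)) / t

section Kernel

variable {α l : ℝ}

lemma continuousOn_relaxKernel (hα : 0 < α) : ContinuousOn (relaxKernel α l) (Ioi 0) :=
  (geomBounded_pow l).continuousOn_kernelSeries hα hα

lemma continuousOn_relaxSquare (hα : 0 < α) : ContinuousOn (relaxSquare α l) (Ioi 0) :=
  (geomBounded_succ_mul_pow l).continuousOn_kernelSeries hα (add_pos hα hα)

lemma isWeaklySingular_relaxKernel (hα : 0 < α) {T : ℝ} (hT : 0 < T) :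
    IsWeaklySingular α T (relaxKernel α l) :=
  (geomBounded_pow l).isWeaklySingular hα hα hT

lemma relaxKernel_eq (hα : 0 < α) {t : ℝ} (ht : 0 < t) :
    relaxKernel α l t = rlKernel α t - l * halfConv (rlKernel α) (relaxKernel α l) t := by
  rw [relaxKernel, (geomBounded_pow l).halfConv_rlKernel_kernelSeries hα hα hα ht]
  exact kernelSeries_pow_eq hα hα ht

lemma halfConv_rlKernel_relaxKernel (hα : 0 < α) (hα₁ : α < 1) {t : ℝ} (ht : 0 < t) :
    halfConv (rlKernel (1 - α)) (relaxKernel α l) t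
      = 1 - l * ∫ s in (0 : ℝ)..t, relaxKernel α l s := by
  rw [relaxKernel, (geomBounded_pow l).halfConv_rlKernel_kernelSeries hα hα (by linarith) ht,
    (geomBounded_pow l).integral_kernelSeries hα hα ht, sub_add_cancel,
    kernelSeries_pow_eq hα one_pos ht, rlKernel_one, add_comm α]

/-- Cauchy product: κ_{mα+α} * κ_{nα+α} depends on m + n only, so the double series may be summed
over antidiagonals. -/
lemma halfConv_relaxKernel_self (hα : 0 < α) {t : ℝ} (ht : 0 < t) :
    halfConv (relaxKernel α l) (relaxKernel α l) t = relaxSquare α l t := by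
  have hg := geomBounded_pow l
  rw [relaxKernel, hg.halfConv_kernelSeries hα hα hα ht (hg.isWeaklySingular hα hα ht)]
  have h1 : ∀ m : ℕ, (-l) ^ m * halfConv (kernelSeries α α fun n => (-l) ^ n)
      (rlKernel (m * α + α)) t
      = ∑' n : ℕ, (-l) ^ (m + n) * rlKernel (((m + n : ℕ) : ℝ) * α + (α + α)) t := fun m => by
    rw [halfConv_comm, hg.halfConv_rlKernel_kernelSeries hα hα (add_index_pos hα hα m) ht,
      kernelSeries, ← tsum_mul_left]
    refine tsum_congr fun n => ?_
    rw [pow_add, mul_assoc]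
    push_cast
    ring_nf
  rw [tsum_congr h1]
  set F : ℕ × ℕ → ℝ := fun p =>
    (-l) ^ (p.1 + p.2) * rlKernel (((p.1 + p.2 : ℕ) : ℝ) * α + (α + α)) t with hF
  have hsum : Summable F := by
    obtain ⟨M, hM, h⟩ := hg.exists_term_bound hα (add_pos hα hα) ht
    have h2 := (summable_geometric_of_lt_one (r := (1 : ℝ) / 2) (by norm_num) (by norm_num))
    refine Summable.of_norm_bounded ((h2.mul_of_nonneg h2 (fun n => by positivity)
      (fun n => by positivity)).mul_left (M * rlKernel (α + α) t)) fun p => ?_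
    rw [hF, Real.norm_eq_abs, abs_mul,
      abs_of_nonneg (rlKernel_nonneg (add_index_pos hα (add_pos hα hα) _) ht.le)]
    have := h (p.1 + p.2) t ⟨ht, le_rfl⟩
    rw [pow_add (1 / 2 : ℝ)] at this
    linarith
  have h3 : ∑' m : ℕ, ∑' n : ℕ, F (m, n) = ∑' p : ℕ × ℕ, F p := (hsum.tsum_prod).symm
  rw [show (∑' m : ℕ, ∑' n : ℕ, (-l) ^ (m + n) * rlKernel (((m + n : ℕ) : ℝ) * α + (α + α)) t)
    = ∑' p : ℕ × ℕ, F p from h3, ← Finset.HasAntidiagonal.sigmaAntidiagonalEquivProd.tsum_eq F,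
    Summable.tsum_sigma' (f := fun c => F (Finset.HasAntidiagonal.sigmaAntidiagonalEquivProd c))
      (fun n => (hasSum_fintype _).summable)
      (Finset.HasAntidiagonal.sigmaAntidiagonalEquivProd.summable_iff.mpr hsum), relaxSquare,
    kernelSeries]
  refine tsum_congr fun N => ?_
  rw [tsum_fintype, Finset.sum_congr rfl (g := fun _ => (-l) ^ N * rlKernel (N * α + (α + α)) t)]
  -- The antidiagonal of N has N + 1 elements, the coefficient in `relaxSquare`.
  · rw [Finset.sum_const, nsmul_eq_mul, Finset.card_univ, Fintype.card_coe,
      Finset.Nat.card_antidiagonal]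
    push_cast
    ring
  · rintro ⟨p, hp⟩ -
    rw [Finset.HasAntidiagonal.mem_antidiagonal] at hp
    simp only [Finset.HasAntidiagonal.sigmaAntidiagonalEquivProd_apply, hF, hp]

lemma kernelSeries_succ_mul_pow_eq {b t : ℝ} (hα : 0 < α) (hb : 0 < b) (ht : 0 < t) :
    kernelSeries α b (fun n => ((n : ℝ) + 1) * (-l) ^ n) t
      = kernelSeries α b (fun n => (-l) ^ n) t
        - l * kernelSeries α (α + b) (fun n => ((n : ℝ) + 1) * (-l) ^ n) t := by
  have h1 := (geomBounded_succ_mul_pow l).summable hα hb ht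
  have h2 := (geomBounded_pow l).summable hα hb ht
  have h3 := h1.sub h2
  have h4 : kernelSeries α b (fun n => ((n : ℝ) + 1) * (-l) ^ n) t
      - kernelSeries α b (fun n => (-l) ^ n) t
      = - (l * kernelSeries α (α + b) (fun n => ((n : ℝ) + 1) * (-l) ^ n) t) := by
    rw [kernelSeries, kernelSeries, ← h1.tsum_sub h2, h3.tsum_eq_zero_add, kernelSeries,
      ← tsum_mul_left, ← tsum_neg]
    simp only [CharP.cast_eq_zero, zero_add, pow_zero, one_mul, sub_self]
    refine tsum_congr fun n => ?_
    rw [pow_succ]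
    push_cast
    ring_nf
  linarith

/-- From t κ_b = b κ_{b+1} with b = (n+1)α, multiplication by t produces the weights α(n+1) and
raises every index by one, which is one integration. On the Laplace side this is -d/ds (s^α + l)⁻¹ =
α s⁻¹ ((s^α + l)⁻¹ - l (s^α + l)⁻²). -/
lemma mul_relaxKernel (hα : 0 < α) {t : ℝ} (ht : 0 < t) :
    t * relaxKernel α l t
      = ∫ s in (0 : ℝ)..t, α * (relaxKernel α l s - l * relaxSquare α l s) := by
  have hi1 := ((geomBounded_pow l).isWeaklySingular hα hα ht).intervalIntegrable hα ht.le
  have hi2 := ((geomBounded_succ_mul_pow l).isWeaklySingular hα (add_pos hα hα)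
    ht).intervalIntegrable (add_pos hα hα) ht.le
  rw [intervalIntegral.integral_const_mul, relaxKernel, relaxSquare,
    intervalIntegral.integral_sub hi1 (hi2.const_mul l), intervalIntegral.integral_const_mul,
    (geomBounded_pow l).integral_kernelSeries hα hα ht,
    (geomBounded_succ_mul_pow l).integral_kernelSeries hα (add_pos hα hα) ht,
    add_left_comm, ← kernelSeries_succ_mul_pow_eq hα (by linarith) ht, kernelSeries, kernelSeries,
    ← tsum_mul_left, ← tsum_mul_left]
  refine tsum_congr fun n => ?_
  have := mul_rlKernel (add_index_pos hα hα n) ht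
  rw [mul_left_comm, this, show (n : ℝ) * α + (1 + α) = n * α + α + 1 by ring]
  ring

/-- By `mul_relaxKernel`, E(t) is 1/t times the primitive of a function continuous on t > 0, so the
quotient rule applies and the series need not be differentiated termwise. -/
lemma hasDerivAt_relaxKernel (hα : 0 < α) {t : ℝ} (ht : 0 < t) :
    HasDerivAt (relaxKernel α l) (relaxDeriv α l t) t := by
  set Q : ℝ → ℝ := fun s => α * (relaxKernel α l s - l * relaxSquare α l s) with hQ
  have hQc : ContinuousOn Q (Ioi 0) :=
    continuousOn_const.mul ((continuousOn_relaxKernel hα).sub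
      (continuousOn_const.mul (continuousOn_relaxSquare hα)))
  have hQi : IntervalIntegrable Q volume 0 t := by
    have hi1 := ((geomBounded_pow l).isWeaklySingular hα hα ht).intervalIntegrable hα ht.le
    have hi2 := ((geomBounded_succ_mul_pow l).isWeaklySingular hα (add_pos hα hα)
      ht).intervalIntegrable (add_pos hα hα) ht.le
    exact (hi1.sub (hi2.const_mul l)).const_mul α
  have hQt : ContinuousAt Q t := hQc.continuousAt (Ioi_mem_nhds ht)
  have h1 : HasDerivAt (fun x => ∫ s in (0 : ℝ)..x, Q s) (Q t) t :=
    intervalIntegral.integral_hasDerivAt_right hQi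
      (hQc.stronglyMeasurableAtFilter isOpen_Ioi t ht) hQt
  have h2 := h1.div (hasDerivAt_id t) ht.ne'
  have h3 : relaxKernel α l =ᶠ[𝓝 t] fun x => (∫ s in (0 : ℝ)..x, Q s) / x := by
    filter_upwards [Ioi_mem_nhds ht] with x hx
    have hx0 : (0 : ℝ) < x := hx
    rw [hQ, ← mul_relaxKernel hα hx, mul_div_cancel_left₀ _ hx0.ne']
  refine (h2.congr_of_eventuallyEq h3).congr_deriv ?_
  simp only [id, hQ]
  rw [← mul_relaxKernel hα ht, relaxDeriv]
  field_simp
  ring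

/-- After the leading term κ_α, the rest of the series is at most A t^α κ_α(t), and A t^α < 1 for
small t. -/
lemma relaxKernel_pos_near_zero (hα : 0 < α) :
    ∃ δ > 0, ∀ t ∈ Ioo 0 δ, 0 < relaxKernel α l t := by
  obtain ⟨K, hK, hb⟩ := (geomBounded_pow l).abs_kernelSeries_le hα (add_pos hα hα) one_pos
  have hG := Real.Gamma_pos_of_pos hα
  have hG2 := Real.Gamma_pos_of_pos (add_pos hα hα)
  set A := |l| * K * Real.Gamma α / Real.Gamma (α + α) with hA
  have hlim : Tendsto (fun t : ℝ => A * t ^ α) (𝓝 0) (𝓝 0) := by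
    have := ((Real.continuousAt_rpow_const 0 α (Or.inr hα.le)).const_mul A).tendsto
    simpa [Real.zero_rpow hα.ne'] using this
  obtain ⟨δ, hδ, h⟩ := Metric.eventually_nhds_iff.1 (hlim.eventually_lt_const one_pos)
  refine ⟨min δ 1, lt_min hδ one_pos, fun t ht => ?_⟩
  have ht0 := ht.1
  have ht1 : t ≤ 1 := (ht.2.trans_le (min_le_right _ _)).le
  have h1 := h (y := t) (by
    rw [Real.dist_eq, sub_zero, abs_of_pos ht0]; exact ht.2.trans_le (min_le_left _ _))
  have h2 := hb t ⟨ht0, ht1⟩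
  have h3 : |l| * (K * rlKernel (α + α) t) = A * t ^ α * rlKernel α t := by
    rw [rlKernel, rlKernel, hA, add_sub_assoc, Real.rpow_add ht0]
    field_simp
  rw [relaxKernel, kernelSeries_pow_eq hα hα ht0]
  have h4 := rlKernel_pos hα ht0
  have h5 : l * kernelSeries α (α + α) (fun n => (-l) ^ n) t
      ≤ |l| * (K * rlKernel (α + α) t) :=
    (le_abs_self _).trans (by rw [abs_mul]; exact mul_le_mul_of_nonneg_left h2 (abs_nonneg l))
  rw [h3] at h5
  nlinarith

/-- At a first zero t₀ of E, the Volterra equation is compared with itself at a slightly earlier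
maximum point t₁. Log-convexity makes the memory of (0, t₁) decay at least as fast as the source
κ_α, and the memory of the short interval (t₁, t₀) is too small to bring E down from its maximum to
0. -/
lemma relaxKernel_nonneg (hα : 0 < α) (hα₁ : α < 1) (hl : 0 ≤ l) {t : ℝ} (ht : 0 < t) :
    0 ≤ relaxKernel α l t := by
  by_contra! hneg
  obtain ⟨δ, hδ, hpos⟩ := relaxKernel_pos_near_zero (l := l) hα
  have hδt : δ ≤ t := by
    by_contra! h
    exact absurd (hpos t ⟨ht, h⟩) (not_lt.2 hneg.le)
  have hsub : Icc (δ / 2) t ⊆ Ioi 0 := fun x hx => (half_pos hδ).trans_le hx.1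
  have hcomp : IsCompact (Icc (δ / 2) t ∩ relaxKernel α l ⁻¹' Iic 0) :=
    isCompact_Icc.of_isClosed_subset
      (((continuousOn_relaxKernel hα).mono hsub).preimage_isClosed_of_isClosed isClosed_Icc
        isClosed_Iic) inter_subset_left
  -- t₀ is the first time with E ≤ 0. The search starts at δ/2, because E > 0 is known on (0, δ).
  obtain ⟨t₀, ⟨ht₀, ht₀neg⟩, hmin⟩ := hcomp.exists_isLeast
    ⟨t, ⟨by linarith, le_rfl⟩, hneg.le⟩
  have ht₀pos : 0 < t₀ := hsub ht₀
  have hEpos : ∀ s ∈ Ioo 0 t₀, 0 < relaxKernel α l s := fun s hs => by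
    by_contra! h
    have h1 : δ ≤ s := by
      by_contra! h'
      exact absurd (hpos s ⟨hs.1, h'⟩) (not_lt.2 h)
    exact absurd (hmin ⟨⟨by linarith, hs.2.le.trans ht₀.2⟩, h⟩) (not_le.2 hs.2)
  have hlim : Tendsto (fun x : ℝ => l * rlKernel (1 + α) x) (𝓝 0) (𝓝 0) := by
    have := (((Real.continuousAt_rpow_const 0 α (Or.inr hα.le)).div_const
      (Real.Gamma (1 + α))).const_mul l).tendsto
    simpa [rlKernel, Real.zero_rpow hα.ne'] using this
  obtain ⟨η, hη, hηl⟩ := Metric.eventually_nhds_iff.1 (hlim.eventually_lt_const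
    (show (0 : ℝ) < 1 / 2 by norm_num))
  -- The bound η/2 makes l ∫κ_α over (0, t₀ - t₁) less than 1/2. The bound t₀/2 gives t₁ ≥ t₀/2 and
  -- hence κ_α(t₁) ≤ 2^(1-α) κ_α(t₀) ≤ 2 κ_α(t₀).
  set r := min (η / 2) (t₀ / 2) with hr
  have hr0 : 0 < r := lt_min (half_pos hη) (half_pos ht₀pos)
  have hrt : r ≤ t₀ / 2 := min_le_right _ _
  obtain ⟨t₁, ht₁, hmax⟩ := isCompact_Icc.exists_isMaxOn (s := Icc (t₀ - r) t₀)
    ⟨t₀, by linarith, le_rfl⟩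
    ((continuousOn_relaxKernel (l := l) hα).mono fun x hx =>
      (show (0 : ℝ) < x by linarith [hx.1]))
  set M := relaxKernel α l t₁ with hM
  have hM0 : 0 < M := (hEpos (t₀ - r) ⟨by linarith, by linarith⟩).trans_le
    (hmax ⟨le_rfl, by linarith⟩)
  have ht₁t₀ : t₁ < t₀ := lt_of_le_of_ne ht₁.2 fun h => by
    rw [hM, h] at hM0
    exact absurd hM0 (not_lt.2 ht₀neg)
  have ht₁pos : 0 < t₁ := by linarith [ht₁.1]
  have hE0 := relaxKernel_eq (l := l) hα ht₀pos
  have hE1 := relaxKernel_eq (l := l) hα ht₁pos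
  have hI0 := (isWeaklySingular_rlKernel hα t₀).intervalIntegrable_mul
    (isWeaklySingular_relaxKernel (l := l) hα ht₀pos) hα hα ht₀pos
  have hI1 := (isWeaklySingular_rlKernel hα t₁).intervalIntegrable_mul
    (isWeaklySingular_relaxKernel (l := l) hα ht₁pos) hα hα ht₁pos
  have hI01 : IntervalIntegrable (fun s => rlKernel α (t₀ - s) * relaxKernel α l s) volume 0 t₁ :=
    hI0.mono_set (by rw [uIcc_of_le ht₁pos.le, uIcc_of_le ht₀pos.le]; exact Icc_subset_Icc_right ht₁.2)
  have hI02 : IntervalIntegrable (fun s => rlKernel α (t₀ - s) * relaxKernel α l s) volume t₁ t₀ :=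
    hI0.mono_set (by rw [uIcc_of_le ht₁.2, uIcc_of_le ht₀pos.le]; exact Icc_subset_Icc_left ht₁pos.le)
  have hsplit : halfConv (rlKernel α) (relaxKernel α l) t₀
      = (∫ s in (0 : ℝ)..t₁, rlKernel α (t₀ - s) * relaxKernel α l s)
        + ∫ s in t₁..t₀, rlKernel α (t₀ - s) * relaxKernel α l s :=
    (intervalIntegral.integral_add_adjacent_intervals hI01 hI02).symm
  have hk0 := rlKernel_pos hα ht₀pos
  have hk1 := rlKernel_pos hα ht₁pos
  -- Log-convexity: κ_α(t₀ - s)/κ_α(t₁ - s) ≤ κ_α(t₀)/κ_α(t₁), integrated against E > 0 on (0, t₁).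
  have hA : rlKernel α t₁ * (∫ s in (0 : ℝ)..t₁, rlKernel α (t₀ - s) * relaxKernel α l s)
      ≤ rlKernel α t₀ * halfConv (rlKernel α) (relaxKernel α l) t₁ := by
    rw [halfConv, ← intervalIntegral.integral_const_mul, ← intervalIntegral.integral_const_mul]
    refine intervalIntegral.integral_mono_on_of_le_Ioo ht₁pos.le (hI01.const_mul _)
      (hI1.const_mul _) fun s hs => ?_
    have := rlKernel_mul_le (a := α) (x := t₁ - s) (y := t₁) (h := t₀ - t₁) hα hα₁
      (by linarith [hs.2]) (by linarith [hs.1]) (by linarith)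
    rw [show t₁ - s + (t₀ - t₁) = t₀ - s by ring, show t₁ + (t₀ - t₁) = t₀ by ring] at this
    have h1 := (hEpos s ⟨hs.1, hs.2.trans ht₁t₀⟩).le
    nlinarith
  have hB : (∫ s in t₁..t₀, rlKernel α (t₀ - s) * relaxKernel α l s)
      ≤ rlKernel (1 + α) (t₀ - t₁) * M := by
    have hshift : ∫ s in t₁..t₀, rlKernel α (t₀ - s) = rlKernel (1 + α) (t₀ - t₁) := by
      rw [intervalIntegral.integral_comp_sub_left (fun s => rlKernel α s), sub_self,
        integral_rlKernel hα (by linarith)]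
    have hi : IntervalIntegrable (fun s => rlKernel α (t₀ - s)) volume t₁ t₀ := by
      have := (intervalIntegrable_rlKernel hα (t₀ - t₁) (t₀ - t₀)).comp_sub_left t₀
      simpa using this
    rw [← hshift, ← intervalIntegral.integral_mul_const]
    refine intervalIntegral.integral_mono_on_of_le_Ioo ht₁.2 hI02 (hi.mul_const _) fun s hs => ?_
    exact mul_le_mul_of_nonneg_left (hmax ⟨by linarith [hs.1, ht₁.1], hs.2.le⟩)
      (rlKernel_nonneg hα (by linarith [hs.2]))
  have hsmall : l * rlKernel (1 + α) (t₀ - t₁) < 1 / 2 := by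
    refine hηl ?_
    rw [Real.dist_eq, sub_zero, abs_of_pos (by linarith)]
    linarith [ht₁.1, min_le_left (η / 2) (t₀ / 2)]
  have hratio : rlKernel α t₁ ≤ 2 * rlKernel α t₀ := by
    rw [rlKernel, rlKernel, ← mul_div_assoc]
    refine div_le_div_of_nonneg_right ?_ (Real.Gamma_pos_of_pos hα).le
    have h2 : t₁ ^ (α - 1) ≤ (t₀ / 2) ^ (α - 1) :=
      Real.rpow_le_rpow_of_nonpos (by linarith) (by linarith [ht₁.1]) (by linarith)
    refine h2.trans ?_
    rw [Real.div_rpow ht₀pos.le (by norm_num), div_eq_mul_inv, mul_comm,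
      ← Real.rpow_neg (by norm_num)]
    refine mul_le_mul_of_nonneg_right ?_ (Real.rpow_nonneg ht₀pos.le _)
    calc (2 : ℝ) ^ (-(α - 1)) ≤ 2 ^ (1 : ℝ) :=
          Real.rpow_le_rpow_of_exponent_le (by norm_num) (by linarith)
      _ = 2 := Real.rpow_one 2
  have ht₀' : relaxKernel α l t₀ ≤ 0 := ht₀neg
  rw [hsplit] at hE0
  rw [← hM] at hE1
  set X := ∫ s in (0 : ℝ)..t₁, rlKernel α (t₀ - s) * relaxKernel α l s
  set Y := ∫ s in t₁..t₀, rlKernel α (t₀ - s) * relaxKernel α l s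
  set Z := halfConv (rlKernel α) (relaxKernel α l) t₁
  set k₀ := rlKernel α t₀
  set k₁ := rlKernel α t₁
  have hY : l * Y ≤ 1 / 2 * M := by
    calc l * Y ≤ l * (rlKernel (1 + α) (t₀ - t₁) * M) := mul_le_mul_of_nonneg_left hB hl
      _ = (l * rlKernel (1 + α) (t₀ - t₁)) * M := by ring
      _ ≤ _ := mul_le_mul_of_nonneg_right hsmall.le hM0.le
  have hY' : l * Y < 1 / 2 * M := by
    calc l * Y ≤ l * (rlKernel (1 + α) (t₀ - t₁) * M) := mul_le_mul_of_nonneg_left hB hl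
      _ = (l * rlKernel (1 + α) (t₀ - t₁)) * M := by ring
      _ < _ := mul_lt_mul_of_pos_right hsmall hM0
  have hX : l * (k₁ * X) ≤ l * (k₀ * Z) := mul_le_mul_of_nonneg_left hA hl
  -- From k₀ - l(X + Y) = E(t₀) ≤ 0, M = k₁ - l Z and k₁ X ≤ k₀ Z it follows that k₀ M ≤ k₁ l Y < k₁
  -- M/2 ≤ k₀ M, a contradiction.
  have h1 : k₁ * (k₀ - l * (X + Y)) ≤ 0 := mul_nonpos_of_nonneg_of_nonpos hk1.le (by linarith)
  have h2 : k₀ * M = k₀ * k₁ - l * (k₀ * Z) := by rw [hE1]; ring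
  have h3 : k₁ * (l * Y) < k₁ * (1 / 2 * M) := mul_lt_mul_of_pos_left hY' hk1
  have h4 : k₁ * M ≤ 2 * k₀ * M := mul_le_mul_of_nonneg_right hratio hM0.le
  nlinarith

lemma relaxKernel_le (hα : 0 < α) (hα₁ : α < 1) (hl : 0 ≤ l) {t : ℝ} (ht : 0 < t) :
    relaxKernel α l t ≤ rlKernel α t := by
  rw [relaxKernel_eq hα ht]
  have : 0 ≤ halfConv (rlKernel α) (relaxKernel α l) t :=
    intervalIntegral.integral_nonneg_of_ae_restrict ht.le (by
      rw [← restrict_Ioo_eq_restrict_Icc]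
      exact (ae_restrict_mem measurableSet_Ioo).mono fun s hs =>
        mul_nonneg (rlKernel_nonneg hα (by linarith [hs.2])) (relaxKernel_nonneg hα hα₁ hl hs.1))
  nlinarith [mul_nonneg hl this]

/-- The defect 1 - l ∫E equals κ_{1-α} * E, a convolution of nonnegative functions. -/
lemma mul_integral_relaxKernel_le (hα : 0 < α) (hα₁ : α < 1) (hl : 0 ≤ l) {t : ℝ} (ht : 0 < t) :
    l * ∫ s in (0 : ℝ)..t, relaxKernel α l s ≤ 1 := by
  have h := halfConv_rlKernel_relaxKernel (l := l) hα hα₁ ht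
  have : 0 ≤ halfConv (rlKernel (1 - α)) (relaxKernel α l) t :=
    intervalIntegral.integral_nonneg_of_ae_restrict ht.le (by
      rw [← restrict_Ioo_eq_restrict_Icc]
      exact (ae_restrict_mem measurableSet_Ioo).mono fun s hs =>
        mul_nonneg (rlKernel_nonneg (by linarith) (by linarith [hs.2]))
          (relaxKernel_nonneg hα hα₁ hl hs.1))
  linarith

lemma relaxSquare_nonneg (hα : 0 < α) (hα₁ : α < 1) (hl : 0 ≤ l) {t : ℝ} (ht : 0 < t) :
    0 ≤ relaxSquare α l t := by
  rw [← halfConv_relaxKernel_self hα ht]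
  exact intervalIntegral.integral_nonneg_of_ae_restrict ht.le (by
      rw [← restrict_Ioo_eq_restrict_Icc]
      exact (ae_restrict_mem measurableSet_Ioo).mono fun s hs =>
        mul_nonneg (relaxKernel_nonneg hα hα₁ hl (by linarith [hs.2]))
          (relaxKernel_nonneg hα hα₁ hl hs.1))

/-- Dropping -l E * E ≤ 0 in `mul_relaxKernel` leaves t E ≤ α ∫E; then l ∫E ≤ 1 and α < 1. -/
lemma mul_mul_relaxKernel_le (hα : 0 < α) (hα₁ : α < 1) (hl : 0 ≤ l) {t : ℝ} (ht : 0 < t) :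
    l * relaxKernel α l t ≤ t⁻¹ := by
  have hi1 := ((geomBounded_pow l).isWeaklySingular hα hα ht).intervalIntegrable hα ht.le
  have hi2 := ((geomBounded_succ_mul_pow l).isWeaklySingular hα (add_pos hα hα)
    ht).intervalIntegrable (add_pos hα hα) ht.le
  have h1 : t * relaxKernel α l t ≤ α * ∫ s in (0 : ℝ)..t, relaxKernel α l s := by
    rw [mul_relaxKernel hα ht, ← intervalIntegral.integral_const_mul]
    refine intervalIntegral.integral_mono_on_of_le_Ioo ht.le
      ((hi1.sub (hi2.const_mul l)).const_mul α) (hi1.const_mul α) fun s hs => ?_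
    have := mul_nonneg hl (relaxSquare_nonneg hα hα₁ hl hs.1)
    exact mul_le_mul_of_nonneg_left (by linarith) hα.le
  have h2 := mul_integral_relaxKernel_le hα hα₁ hl ht
  have h3 : l * (t * relaxKernel α l t) ≤ l * (α * ∫ s in (0 : ℝ)..t, relaxKernel α l s) :=
    mul_le_mul_of_nonneg_left h1 hl
  rw [← one_div, le_div_iff₀ ht]
  nlinarith

/-- In E(t-s) E(s) one of the two arguments is at least t/2, so that factor is at most κ_α(t/2) ≤ 2
κ_α(t). Hence the product is at most κ_α(t/2)(E(s) + E(t-s)), and each summand integrates to ∫E,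
with l ∫E ≤ 1. -/
lemma mul_relaxSquare_le (hα : 0 < α) (hα₁ : α < 1) (hl : 0 ≤ l) {t : ℝ} (ht : 0 < t) :
    l * relaxSquare α l t ≤ 4 * rlKernel α t := by
  have hE := isWeaklySingular_relaxKernel (l := l) hα ht
  have hi := hE.intervalIntegrable hα ht.le
  have hi' : IntervalIntegrable (fun s => relaxKernel α l (t - s)) volume 0 t := by
    have := (hi.comp_sub_left t).symm
    simpa using this
  have hk : rlKernel α (t / 2) ≤ 2 * rlKernel α t := by
    rw [rlKernel, rlKernel, ← mul_div_assoc]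
    refine div_le_div_of_nonneg_right ?_ (Real.Gamma_pos_of_pos hα).le
    rw [Real.div_rpow ht.le (by norm_num), div_eq_mul_inv, mul_comm,
      ← Real.rpow_neg (by norm_num)]
    refine mul_le_mul_of_nonneg_right ?_ (Real.rpow_nonneg ht.le _)
    calc (2 : ℝ) ^ (-(α - 1)) ≤ 2 ^ (1 : ℝ) :=
          Real.rpow_le_rpow_of_exponent_le (by norm_num) (by linarith)
      _ = 2 := Real.rpow_one 2
  have hmono : ∀ x, t / 2 ≤ x → relaxKernel α l x ≤ rlKernel α (t / 2) := fun x hx => by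
    refine (relaxKernel_le hα hα₁ hl (by linarith)).trans ?_
    rw [rlKernel, rlKernel]
    exact div_le_div_of_nonneg_right
      (Real.rpow_le_rpow_of_nonpos (by linarith) hx (by linarith)) (Real.Gamma_pos_of_pos hα).le
  have h1 : relaxSquare α l t
      ≤ rlKernel α (t / 2) * (2 * ∫ s in (0 : ℝ)..t, relaxKernel α l s) := by
    have hsym : ∫ s in (0 : ℝ)..t, relaxKernel α l (t - s)
        = ∫ s in (0 : ℝ)..t, relaxKernel α l s := by
      rw [intervalIntegral.integral_comp_sub_left (fun s => relaxKernel α l s), sub_self, sub_zero]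
    rw [two_mul]
    nth_rewrite 2 [← hsym]
    rw [← intervalIntegral.integral_add hi hi', ← intervalIntegral.integral_const_mul,
      ← halfConv_relaxKernel_self hα ht]
    refine intervalIntegral.integral_mono_on_of_le_Ioo ht.le
      (hE.intervalIntegrable_mul hE hα hα ht) ((hi.add hi').const_mul _) fun s hs => ?_
    have hp1 := relaxKernel_nonneg (l := l) hα hα₁ hl hs.1
    have hp2 := relaxKernel_nonneg (l := l) hα hα₁ hl (sub_pos.2 hs.2)
    have hp3 := rlKernel_nonneg hα (half_pos ht).le
    rcases le_total s (t / 2) with h | h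
    · have := hmono (t - s) (by linarith)
      nlinarith
    · have := hmono s h
      nlinarith
  have h2 := mul_integral_relaxKernel_le hα hα₁ hl ht
  have hp3 := rlKernel_nonneg hα (half_pos ht).le
  calc l * relaxSquare α l t
      ≤ l * (rlKernel α (t / 2) * (2 * ∫ s in (0 : ℝ)..t, relaxKernel α l s)) :=
        mul_le_mul_of_nonneg_left h1 hl
    _ = 2 * rlKernel α (t / 2) * (l * ∫ s in (0 : ℝ)..t, relaxKernel α l s) := by ring
    _ ≤ 2 * rlKernel α (t / 2) * 1 := mul_le_mul_of_nonneg_left h2 (by linarith)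
    _ ≤ _ := by linarith

/-- The 5 is 1 from E ≤ κ_α plus 4 from l E * E ≤ 4 κ_α; division by t turns t^(α-1) into t^(α-2).
-/
lemma abs_relaxDeriv_le (hα : 0 < α) (hα₁ : α < 1) (hl : 0 ≤ l) {t : ℝ} (ht : 0 < t) :
    |relaxDeriv α l t| ≤ 5 / Real.Gamma α * t ^ (α - 2) := by
  have h1 := relaxKernel_nonneg hα hα₁ hl ht
  have h2 := relaxKernel_le hα hα₁ hl ht
  have h3 := mul_relaxSquare_le hα hα₁ hl ht
  have h4 := mul_nonneg hl (relaxSquare_nonneg hα hα₁ hl ht)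
  have h5 : |(α - 1) * relaxKernel α l t - α * (l * relaxSquare α l t)| ≤ 5 * rlKernel α t := by
    rw [abs_le]
    constructor <;> nlinarith
  rw [relaxDeriv, abs_div, abs_of_pos ht, div_le_iff₀ ht]
  refine h5.trans (le_of_eq ?_)
  rw [rlKernel, show α - 2 = α - 1 - 1 by ring, Real.rpow_sub_one ht.ne' (α - 1)]
  field_simp

/-- The smoothing estimate, interpolated between `E ≤ κ_α` and `l E ≤ 1/t`. -/
lemma rpow_mul_relaxKernel_le (hα : 0 < α) (hα₁ : α < 1) (hl : 0 ≤ l) {t θ : ℝ} (ht : 0 < t)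
    (hθ₀ : 0 ≤ θ) (hθ₁ : θ ≤ 1) :
    l ^ θ * relaxKernel α l t ≤ max 1 (Real.Gamma α)⁻¹ * t ^ (-1 + α * (1 - θ)) := by
  have h1 := relaxKernel_nonneg hα hα₁ hl ht
  have h2 := relaxKernel_le hα hα₁ hl ht
  have h3 := mul_mul_relaxKernel_le hα hα₁ hl ht
  have hG := Real.Gamma_pos_of_pos hα
  have hsplit : l ^ θ * relaxKernel α l t
      = (l * relaxKernel α l t) ^ θ * relaxKernel α l t ^ (1 - θ) := by
    rw [Real.mul_rpow hl h1, mul_assoc, ← Real.rpow_add' h1 (by simp)]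
    simp
  have h4 : (l * relaxKernel α l t) ^ θ ≤ (t⁻¹) ^ θ :=
    Real.rpow_le_rpow (mul_nonneg hl h1) h3 hθ₀
  have h5 : relaxKernel α l t ^ (1 - θ) ≤ (max 1 (Real.Gamma α)⁻¹ * t ^ (α - 1)) ^ (1 - θ) := by
    refine Real.rpow_le_rpow h1 (h2.trans ?_) (by linarith)
    rw [rlKernel, div_eq_mul_inv, mul_comm]
    exact mul_le_mul_of_nonneg_right (le_max_right _ _) (Real.rpow_nonneg ht.le _)
  rw [hsplit]
  refine (mul_le_mul h4 h5 (Real.rpow_nonneg h1 _) (by positivity)).trans ?_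
  rw [Real.mul_rpow (by positivity) (Real.rpow_nonneg ht.le _), Real.inv_rpow ht.le,
    ← Real.rpow_neg ht.le, ← Real.rpow_mul ht.le, mul_left_comm, ← Real.rpow_add ht]
  rw [show -θ + (α - 1) * (1 - θ) = -1 + α * (1 - θ) by ring]
  refine mul_le_mul_of_nonneg_right ?_ (Real.rpow_nonneg ht.le _)
  -- Having 1 in the maximum makes its power 1 - θ at most the maximum itself, so the constant does
  -- not depend on θ.
  calc (max 1 (Real.Gamma α)⁻¹) ^ (1 - θ) ≤ (max 1 (Real.Gamma α)⁻¹) ^ (1 : ℝ) :=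
        Real.rpow_le_rpow_of_exponent_le (le_max_left _ _) (by linarith)
    _ = _ := Real.rpow_one _

end Kernel

/-! ### Associativity of the one-sided convolution -/

section Assoc

open ContinuousLinearMap (mul)
open scoped Convolution

variable {a b c : ℝ → ℝ} {t T : ℝ}

lemma integrable_indicator_Ioo (hT : 0 ≤ T) (ha : IntervalIntegrable a volume 0 T) :
    Integrable ((Ioo 0 T).indicator a) :=
  ((intervalIntegrable_iff_integrableOn_Ioo_of_le hT).1 ha).integrable_indicator measurableSet_Ioo

lemma indicator_mul_indicator_comp_sub (htT : t ≤ T) (s : ℝ) :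
    (Ioo 0 T).indicator a s * (Ioo 0 T).indicator b (t - s)
      = (Ioo 0 t).indicator (fun s => a s * b (t - s)) s := by
  by_cases hs : s ∈ Ioo 0 t
  · rw [indicator_of_mem hs,
      indicator_of_mem (show s ∈ Ioo 0 T from ⟨hs.1, hs.2.trans_le htT⟩),
      indicator_of_mem (show t - s ∈ Ioo 0 T from ⟨by linarith [hs.2], by linarith [hs.1]⟩)]
  · rw [indicator_of_notMem hs]
    by_cases h1 : s ∈ Ioo 0 T
    · rw [indicator_of_notMem (s := Ioo 0 T) (a := t - s), mul_zero]
      intro h2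
      exact hs ⟨h1.1, by linarith [h2.1]⟩
    · rw [indicator_of_notMem h1, zero_mul]

/-- For t ≤ T only values on (0, t) enter, so cutting both functions off outside (0, T) changes
nothing. This makes Fubini for convolutions on the whole line available on a bounded time interval.
-/
lemma convolution_indicator_eq_halfConv (ht : 0 ≤ t) (htT : t ≤ T) :
    ((Ioo 0 T).indicator a ⋆[mul ℝ ℝ, volume] (Ioo 0 T).indicator b) t = halfConv a b t := by
  rw [halfConv_comm, halfConv, intervalIntegral.integral_of_le ht, ← restrict_Ioo_eq_restrict_Ioc,
    ← integral_indicator measurableSet_Ioo]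
  simp only [convolution, ContinuousLinearMap.mul_apply', indicator_mul_indicator_comp_sub htT]
  simp only [mul_comm]

lemma convolution_indicator_eq_zero (ht : t ≤ 0) :
    ((Ioo 0 T).indicator a ⋆[mul ℝ ℝ, volume] (Ioo 0 T).indicator b) t = 0 := by
  simp only [convolution, ContinuousLinearMap.mul_apply']
  refine integral_eq_zero_of_ae (Eventually.of_forall fun s => ?_)
  simp only [Pi.zero_apply]
  by_cases h1 : s ∈ Ioo 0 T
  · rw [indicator_of_notMem (s := Ioo 0 T) (a := t - s), mul_zero]
    intro h2
    linarith [h2.1, h1.1]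
  · rw [indicator_of_notMem h1, zero_mul]

lemma intervalIntegrable_halfConv (hT : 0 ≤ T) (ha : IntervalIntegrable a volume 0 T)
    (hb : IntervalIntegrable b volume 0 T) : IntervalIntegrable (halfConv a b) volume 0 T := by
  rw [intervalIntegrable_iff_integrableOn_Ioo_of_le hT]
  have := (integrable_indicator_Ioo hT ha).integrable_convolution (mul ℝ ℝ)
    (integrable_indicator_Ioo hT hb)
  exact this.integrableOn.congr_fun (fun t ht =>
    convolution_indicator_eq_halfConv ht.1.le ht.2.le) measurableSet_Ioo

lemma ae_intervalIntegrable_halfConv (hT : 0 ≤ T) (ha : IntervalIntegrable a volume 0 T)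
    (hb : IntervalIntegrable b volume 0 T) :
    ∀ᵐ t ∂(volume.restrict (Ioo 0 T)), IntervalIntegrable (fun s => a (t - s) * b s)
      volume 0 t := by
  have := (integrable_indicator_Ioo hT hb).ae_convolution_exists (mul ℝ ℝ)
    (integrable_indicator_Ioo hT ha)
  filter_upwards [ae_restrict_of_ae this, ae_restrict_mem measurableSet_Ioo] with t h ht
  rw [intervalIntegrable_iff_integrableOn_Ioo_of_le ht.1.le]
  simp only [ConvolutionExistsAt, ContinuousLinearMap.mul_apply',
    indicator_mul_indicator_comp_sub ht.2.le] at h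
  rw [integrable_indicator_iff measurableSet_Ioo] at h
  exact h.congr_fun (fun s _ => mul_comm _ _) measurableSet_Ioo

lemma convolution_convolution_indicator_left (ht : 0 ≤ t) (htT : t ≤ T) :
    (((Ioo 0 T).indicator a ⋆[mul ℝ ℝ, volume] (Ioo 0 T).indicator b)
      ⋆[mul ℝ ℝ, volume] (Ioo 0 T).indicator c) t = halfConv (halfConv a b) c t := by
  rw [← convolution_indicator_eq_halfConv (a := halfConv a b) ht htT]
  simp only [convolution_def, ContinuousLinearMap.mul_apply']
  refine integral_congr_ae (Eventually.of_forall fun s => ?_)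
  beta_reduce
  by_cases hs : s ∈ Ioo 0 T
  · rw [indicator_of_mem (a := s) hs,
      ← convolution_indicator_eq_halfConv (T := T) hs.1.le hs.2.le]
    rfl
  · rw [indicator_of_notMem (a := s) hs, zero_mul]
    rcases le_or_gt s 0 with h | h
    · have := convolution_indicator_eq_zero (a := a) (b := b) (T := T) h
      simp only [convolution_def, ContinuousLinearMap.mul_apply'] at this
      rw [this, zero_mul]
    · have hT : T ≤ s := by
        by_contra! h'
        exact hs ⟨h, h'⟩
      rw [indicator_of_notMem (a := t - s) (fun h2 => by linarith [h2.1]), mul_zero]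

lemma convolution_convolution_indicator_right (ht : 0 ≤ t) (htT : t ≤ T) :
    ((Ioo 0 T).indicator a ⋆[mul ℝ ℝ, volume] ((Ioo 0 T).indicator b
      ⋆[mul ℝ ℝ, volume] (Ioo 0 T).indicator c)) t = halfConv a (halfConv b c) t := by
  rw [halfConv_comm, ← convolution_convolution_indicator_left ht htT]
  rw [← convolution_flip]
  congr 1
  ext
  simp

lemma halfConv_assoc_ae (hT : 0 ≤ T) (ha : IntervalIntegrable a volume 0 T)
    (hb : IntervalIntegrable b volume 0 T) (hc : IntervalIntegrable c volume 0 T) :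
    ∀ᵐ t ∂(volume.restrict (Ioo 0 T)),
      halfConv (halfConv a b) c t = halfConv a (halfConv b c) t := by
  have ha' := integrable_indicator_Ioo hT ha
  have hb' := integrable_indicator_Ioo hT hb
  have hc' := integrable_indicator_Ioo hT hc
  have h1 := ha'.ae_convolution_exists (mul ℝ ℝ) hb'
  have h2 := hb'.norm.ae_convolution_exists (mul ℝ ℝ) hc'.norm
  have h3 := ha'.norm.ae_convolution_exists (mul ℝ ℝ)
    (hb'.norm.integrable_convolution (mul ℝ ℝ) hc'.norm)
  filter_upwards [ae_restrict_of_ae h3, ae_restrict_mem measurableSet_Ioo] with t h3 ht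
  rw [← convolution_convolution_indicator_left ht.1.le ht.2.le,
    ← convolution_convolution_indicator_right ht.1.le ht.2.le]
  exact convolution_assoc (mul ℝ ℝ) (mul ℝ ℝ) (mul ℝ ℝ) (mul ℝ ℝ)
    (fun x y z => by simp [mul_assoc]) ha'.aestronglyMeasurable hb'.aestronglyMeasurable
    hc'.aestronglyMeasurable h1 h2 h3

/-- The identity at one prescribed time, under absolute integrability there; the cut-off is made at
t itself. The almost everywhere version needs only integrability of the factors but cannot reach a
given t. -/
lemma halfConv_assoc (ht : 0 ≤ t) (ha : IntervalIntegrable a volume 0 t)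
    (hb : IntervalIntegrable b volume 0 t) (hc : IntervalIntegrable c volume 0 t)
    (h : IntervalIntegrable (fun s => |a (t - s)| * halfConv (fun x => |b x|) (fun x => |c x|) s)
      volume 0 t) :
    halfConv (halfConv a b) c t = halfConv a (halfConv b c) t := by
  have ha' := integrable_indicator_Ioo ht ha
  have hb' := integrable_indicator_Ioo ht hb
  have hc' := integrable_indicator_Ioo ht hc
  have h1 := ha'.ae_convolution_exists (mul ℝ ℝ) hb'
  have h2 := hb'.norm.ae_convolution_exists (mul ℝ ℝ) hc'.norm
  rw [← convolution_convolution_indicator_left ht le_rfl,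
    ← convolution_convolution_indicator_right ht le_rfl]
  refine convolution_assoc (mul ℝ ℝ) (mul ℝ ℝ) (mul ℝ ℝ) (mul ℝ ℝ)
    (fun x y z => by simp [mul_assoc]) ha'.aestronglyMeasurable hb'.aestronglyMeasurable
    hc'.aestronglyMeasurable h1 h2 ?_
  have h4 := (h.comp_sub_left t).symm
  simp only [sub_zero, sub_self, sub_sub_cancel] at h4
  rw [intervalIntegrable_iff_integrableOn_Ioo_of_le ht,
    ← integrable_indicator_iff measurableSet_Ioo] at h4
  refine h4.congr (Eventually.of_forall fun s => ?_)
  have hn : ∀ (g : ℝ → ℝ) x, ‖(Ioo 0 t).indicator g x‖ = (Ioo 0 t).indicator (fun x => |g x|) x :=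
    fun g x => by rw [norm_indicator_eq_indicator_norm]; rfl
  simp only [hn, ContinuousLinearMap.mul_apply']
  by_cases hs : s ∈ Ioo 0 t
  · rw [indicator_of_mem (a := s) hs, indicator_of_mem (a := s) hs]
    rw [convolution_indicator_eq_halfConv (by linarith [hs.2]) (by linarith [hs.1])]
  · rw [indicator_of_notMem (a := s) hs, indicator_of_notMem (a := s) hs, zero_mul]

lemma halfConv_assoc_of_bounded (ht : 0 ≤ t) (ha : IntervalIntegrable a volume 0 t)
    (hb : IntervalIntegrable b volume 0 t) (hc : IntervalIntegrable c volume 0 t) {M : ℝ}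
    (h : ∀ s ∈ Ioo 0 t, |halfConv (fun x => |b x|) (fun x => |c x|) s| ≤ M) :
    halfConv (halfConv a b) c t = halfConv a (halfConv b c) t := by
  refine halfConv_assoc ht ha hb hc ?_
  have h1 := intervalIntegrable_halfConv ht hb.abs hc.abs
  have h2 := (ha.abs.comp_sub_left t).symm
  simp only [sub_zero, sub_self] at h2
  rw [intervalIntegrable_iff_integrableOn_Ioo_of_le ht] at h1 h2 ⊢
  refine h2.mul_bdd (c := M) h1.aestronglyMeasurable ?_
  exact (ae_restrict_mem measurableSet_Ioo).mono fun s hs => h s hs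

lemma halfConv_one_assoc (ht : 0 ≤ t) (hb : IntervalIntegrable b volume 0 t)
    (hc : IntervalIntegrable c volume 0 t) :
    halfConv (halfConv (fun _ => 1) b) c t = halfConv (fun _ => 1) (halfConv b c) t := by
  refine halfConv_assoc ht intervalIntegrable_const hb hc ?_
  simp only [abs_one, one_mul]
  exact intervalIntegrable_halfConv ht hb.abs hc.abs

lemma halfConv_one_left (g : ℝ → ℝ) (t : ℝ) :
    halfConv (fun _ => 1) g t = ∫ s in (0 : ℝ)..t, g s := by simp [halfConv]

/-- Integration of a one-sided convolution. -/
lemma halfConv_integral (ht : 0 ≤ t) (hb : IntervalIntegrable b volume 0 t)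
    (hc : IntervalIntegrable c volume 0 t) :
    halfConv b (fun x => ∫ s in (0 : ℝ)..x, c s) t = ∫ s in (0 : ℝ)..t, halfConv b c s := by
  have h1 : halfConv (halfConv b fun _ => 1) c t = halfConv b (halfConv (fun _ => 1) c) t := by
    refine halfConv_assoc_of_bounded ht hb intervalIntegrable_const hc
      (M := ∫ s in (0 : ℝ)..t, |c s|) fun s hs => ?_
    simp only [abs_one]
    rw [halfConv_one_left, abs_of_nonneg (intervalIntegral.integral_nonneg hs.1.le
      fun _ _ => abs_nonneg _)]
    exact intervalIntegral.integral_mono_interval le_rfl hs.1.le hs.2.le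
      (Eventually.of_forall fun _ => abs_nonneg _) hc.abs
  simp only [funext (halfConv_one_left c)] at h1
  rw [← h1, ← halfConv_one_left, ← halfConv_one_assoc ht hb hc,
    funext (halfConv_comm b fun _ => 1)]

end Assoc

/-! ### The scalar fractional relaxation equation -/

section Relaxation

variable {α l T t : ℝ}

lemma intervalIntegrable_relaxKernel (hα : 0 < α) (ht : 0 ≤ t) :
    IntervalIntegrable (relaxKernel α l) volume 0 t := by
  rcases ht.eq_or_lt with rfl | ht
  · exact IntervalIntegrable.refl
  · exact (isWeaklySingular_relaxKernel hα ht).intervalIntegrable hα ht.le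

lemma halfConv_congr_ae {a b b' : ℝ → ℝ} (ht : t ∈ Icc 0 T)
    (h : b =ᵐ[volume.restrict (Ioo 0 T)] b') : halfConv a b t = halfConv a b' t := by
  simp only [halfConv, intervalIntegral.integral_of_le ht.1, ← restrict_Ioo_eq_restrict_Ioc]
  refine integral_congr_ae ?_
  filter_upwards [ae_restrict_of_ae_restrict_of_subset (Ioo_subset_Ioo_right ht.2) h] with s hs
  rw [hs]

lemma halfConv_add_const_mul {a b c : ℝ → ℝ} {k : ℝ}
    (hb : IntervalIntegrable (fun s => a (t - s) * b s) volume 0 t)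
    (hc : IntervalIntegrable (fun s => a (t - s) * c s) volume 0 t) :
    halfConv a (fun s => b s + k * c s) t = halfConv a b t + k * halfConv a c t := by
  simp only [halfConv]
  rw [← intervalIntegral.integral_const_mul, ← intervalIntegral.integral_add hb (hc.const_mul k)]
  exact intervalIntegral.integral_congr fun s _ => by ring

lemma halfConv_add_const_mul_left {a b c : ℝ → ℝ} {k : ℝ}
    (hb : IntervalIntegrable (fun s => b (t - s) * a s) volume 0 t)
    (hc : IntervalIntegrable (fun s => c (t - s) * a s) volume 0 t) :
    halfConv (fun s => b s + k * c s) a t = halfConv b a t + k * halfConv c a t := by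
  simp only [halfConv]
  rw [← intervalIntegral.integral_const_mul, ← intervalIntegral.integral_add hb (hc.const_mul k)]
  exact intervalIntegral.integral_congr fun s _ => by ring

/-- `l (E * κ_α) * w = κ_α * w - E * w`. -/
lemma ae_halfConv_relaxKernel_rlKernel (hα : 0 < α) (hT : 0 < T) {w : ℝ → ℝ}
    (hw : IntervalIntegrable w volume 0 T) :
    ∀ᵐ t ∂(volume.restrict (Ioo 0 T)),
      l * halfConv (relaxKernel α l) (halfConv (rlKernel α) w) t
        = halfConv (rlKernel α) w t - halfConv (relaxKernel α l) w t := by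
  have hE := intervalIntegrable_relaxKernel (l := l) hα hT.le
  have hk := intervalIntegrable_rlKernel hα 0 T
  filter_upwards [halfConv_assoc_ae hT.le hE hk hw, ae_restrict_mem measurableSet_Ioo,
    ae_intervalIntegrable_halfConv hT.le hE hw, ae_intervalIntegrable_halfConv hT.le
      (intervalIntegrable_halfConv hT.le hE hk) hw] with t h1 ht h2 h3
  rw [← h1]
  have h4 : halfConv (rlKernel α) w t
      = halfConv (fun s => relaxKernel α l s + l * halfConv (relaxKernel α l) (rlKernel α) s)
        w t := by
    refine halfConv_congr ht.1.le (fun s hs => ?_) fun _ _ => rfl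
    have := relaxKernel_eq (l := l) hα hs.1
    rw [halfConv_comm (relaxKernel α l)]
    linarith
  rw [h4, halfConv_add_const_mul_left h2 h3]
  ring

/-- Convolve with E: E * w + l E * κ * w = E * κ * g. By `ae_halfConv_relaxKernel_rlKernel` the left
side is κ * w, so l κ * w = l E * κ * g = κ * g - E * g. Inserting this in the equation leaves w = E
* g. -/
lemma volterra_unique (hα : 0 < α) (hT : 0 < T) {w g : ℝ → ℝ}
    (hw : IntervalIntegrable w volume 0 T) (hg : IntervalIntegrable g volume 0 T)
    (h : ∀ᵐ t ∂(volume.restrict (Ioo 0 T)),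
      w t + l * halfConv (rlKernel α) w t = halfConv (rlKernel α) g t) :
    ∀ᵐ t ∂(volume.restrict (Ioo 0 T)), w t = halfConv (relaxKernel α l) g t := by
  have hE := intervalIntegrable_relaxKernel (l := l) hα hT.le
  have hk := intervalIntegrable_rlKernel hα 0 T
  filter_upwards [h, ae_restrict_mem measurableSet_Ioo,
    ae_halfConv_relaxKernel_rlKernel (l := l) hα hT hw,
    ae_halfConv_relaxKernel_rlKernel (l := l) hα hT hg,
    ae_intervalIntegrable_halfConv hT.le hE hw, ae_intervalIntegrable_halfConv hT.le hE
      (intervalIntegrable_halfConv hT.le hk hw)] with t h0 ht h1 h2 h3 h4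
  have h5 := halfConv_congr_ae (a := relaxKernel α l) (Ioo_subset_Icc_self ht) h
  rw [halfConv_add_const_mul h3 h4] at h5
  rw [← h5] at h2
  have h6 : halfConv (rlKernel α) w t * l = l * halfConv (relaxKernel α l) w t
      + l * (halfConv (rlKernel α) w t - halfConv (relaxKernel α l) w t) := by ring
  rw [← h1] at h6
  linarith

/-- Since κ_α * κ_{1-α} = 1, convolving the fractional equation with κ_α undoes the Caputo
derivative, κ_α * (κ_{1-α} * w') = 1 * w' = w, and a Volterra equation remains. -/
lemma relaxation_unique (hα : 0 < α) (hα₁ : α < 1) (hT : 0 < T) {w w' g : ℝ → ℝ}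
    (hw' : IntervalIntegrable w' volume 0 T) (hg : IntervalIntegrable g volume 0 T)
    (hw : ∀ t ∈ Ioo 0 T, w t = ∫ s in (0 : ℝ)..t, w' s)
    (h : ∀ᵐ t ∂(volume.restrict (Ioo 0 T)),
      halfConv (rlKernel (1 - α)) w' t + l * w t = g t) :
    ∀ᵐ t ∂(volume.restrict (Ioo 0 T)), w t = halfConv (relaxKernel α l) g t := by
  have hk := intervalIntegrable_rlKernel hα 0 T
  have hk' := intervalIntegrable_rlKernel (sub_pos.2 hα₁) 0 T
  have hwi : IntervalIntegrable w volume 0 T := by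
    have := intervalIntegrable_halfConv hT.le intervalIntegrable_const hw' (a := fun _ => (1 : ℝ))
    rw [intervalIntegrable_iff_integrableOn_Ioo_of_le hT.le] at this ⊢
    refine this.congr_fun (fun t ht => ?_) measurableSet_Ioo
    rw [halfConv_one_left, hw t ht]
  refine volterra_unique hα hT hwi hg ?_
  filter_upwards [ae_restrict_mem measurableSet_Ioo, halfConv_assoc_ae hT.le hk hk' hw',
    ae_intervalIntegrable_halfConv hT.le hk hwi, ae_intervalIntegrable_halfConv hT.le hk
      (intervalIntegrable_halfConv hT.le hk' hw')] with t ht h1 h2 h3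
  have h5 := halfConv_congr_ae (a := rlKernel α) (Ioo_subset_Icc_self ht) h
  rw [halfConv_add_const_mul h3 h2, ← h1] at h5
  rw [← h5, hw t ht, ← halfConv_one_left]
  congr 1
  refine halfConv_congr ht.1.le (fun s hs => ?_) fun _ _ => rfl
  rw [halfConv_rlKernel hα (sub_pos.2 hα₁) hs.1, add_sub_cancel, rlKernel_one]

/-- The time derivative of the solution of the relaxation equation. -/
lemma halfConv_relaxKernel_eq_integral (hα : 0 < α) {g g₁ : ℝ → ℝ} {g₀ : ℝ}
    (hg₁ : IntervalIntegrable g₁ volume 0 T)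
    (hg : ∀ t ∈ Icc 0 T, g t = g₀ + ∫ s in (0 : ℝ)..t, g₁ s) (ht : t ∈ Icc 0 T) :
    halfConv (relaxKernel α l) g t
      = ∫ s in (0 : ℝ)..t, (relaxKernel α l s * g₀ + halfConv (relaxKernel α l) g₁ s) := by
  have hE := intervalIntegrable_relaxKernel (l := l) hα ht.1
  have hg₁t : IntervalIntegrable g₁ volume 0 t := hg₁.mono_set (by
    rw [uIcc_of_le ht.1, uIcc_of_le (ht.1.trans ht.2)]; exact Icc_subset_Icc_right ht.2)
  have hE' : IntervalIntegrable (fun s => relaxKernel α l (t - s)) volume 0 t := by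
    have := (hE.comp_sub_left t).symm
    simpa using this
  have h1 : halfConv (relaxKernel α l) g t
      = halfConv (relaxKernel α l) (fun s => g₀ + 1 * ∫ r in (0 : ℝ)..s, g₁ r) t :=
    halfConv_congr ht.1 (fun _ _ => rfl) fun s hs => by
      rw [hg s ⟨hs.1.le, hs.2.le.trans ht.2⟩, one_mul]
  rw [h1, halfConv_add_const_mul (hE'.mul_const g₀), one_mul, halfConv_integral ht.1 hE hg₁t,
    intervalIntegral.integral_add (hE.mul_const g₀) (intervalIntegrable_halfConv ht.1 hE hg₁t)]
  · congr 1
    rw [halfConv, intervalIntegral.integral_mul_const, intervalIntegral.integral_mul_const,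
      intervalIntegral.integral_comp_sub_left (fun s => relaxKernel α l s), sub_self, sub_zero]
  · exact hE'.mul_continuousOn (by
      have := intervalIntegral.continuousOn_primitive_interval' hg₁t left_mem_uIcc
      exact this)

/-- The Caputo derivative of the solution of the relaxation equation. -/
lemma halfConv_rlKernel_relaxation (hα : 0 < α) (hα₁ : α < 1) {g g₁ : ℝ → ℝ} {g₀ M : ℝ}
    (hg₁ : IntervalIntegrable g₁ volume 0 T) (hM : ∀ t ∈ Ioo 0 T, |g₁ t| ≤ M)
    (hg : ∀ t ∈ Icc 0 T, g t = g₀ + ∫ s in (0 : ℝ)..t, g₁ s) (ht : t ∈ Ioc 0 T)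
    (hi : IntervalIntegrable (fun s => rlKernel (1 - α) (t - s) * halfConv (relaxKernel α l) g₁ s)
      volume 0 t) :
    halfConv (rlKernel (1 - α)) (fun s => relaxKernel α l s * g₀ + halfConv (relaxKernel α l) g₁ s)
      t = g t - l * halfConv (relaxKernel α l) g t := by
  have ht0 := ht.1
  have hE := intervalIntegrable_relaxKernel (l := l) hα ht0.le
  have hg₁t : IntervalIntegrable g₁ volume 0 t := hg₁.mono_set (by
    rw [uIcc_of_le ht0.le, uIcc_of_le (ht0.le.trans ht.2)]; exact Icc_subset_Icc_right ht.2)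
  have hk' := intervalIntegrable_rlKernel (sub_pos.2 hα₁) 0 t
  -- Associativity is needed at every t. It holds because g₁ is bounded, so that |E| * |g₁| is
  -- bounded as well.
  have hassoc : halfConv (halfConv (rlKernel (1 - α)) (relaxKernel α l)) g₁ t
      = halfConv (rlKernel (1 - α)) (halfConv (relaxKernel α l) g₁) t := by
    refine halfConv_assoc_of_bounded ht0.le hk' hE hg₁t
      (M := (∫ s in (0 : ℝ)..t, |relaxKernel α l s|) * M) fun s hs => ?_
    have hs0 := hs.1
    have hEs : IntervalIntegrable (fun x => |relaxKernel α l x|) volume 0 s :=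
      (intervalIntegrable_relaxKernel (l := l) hα hs0.le).abs
    have hnn : 0 ≤ halfConv (fun x => |g₁ x|) (fun x => |relaxKernel α l x|) s :=
      intervalIntegral.integral_nonneg hs0.le fun _ _ => mul_nonneg (abs_nonneg _) (abs_nonneg _)
    rw [halfConv_comm, abs_of_nonneg hnn]
    have hM0 : 0 ≤ M := (abs_nonneg _).trans (hM s ⟨hs0, hs.2.trans_le ht.2⟩)
    calc halfConv (fun x => |g₁ x|) (fun x => |relaxKernel α l x|) s
        ≤ ∫ x in (0 : ℝ)..s, |relaxKernel α l x| * M := by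
          have hint : IntervalIntegrable (fun x => |g₁ (s - x)| * |relaxKernel α l x|)
              volume 0 s := by
            have hm : AEStronglyMeasurable (fun x => g₁ (s - x)) (volume.restrict (Ioc 0 s)) := by
              refine aestronglyMeasurable_comp_sub ?_
              have := hg₁t.aestronglyMeasurable
              exact this.mono_measure (Measure.restrict_mono (Ioc_subset_Ioc_right hs.2.le) le_rfl)
            rw [intervalIntegrable_iff_integrableOn_Ioo_of_le hs0.le] at hEs ⊢
            rw [← restrict_Ioo_eq_restrict_Ioc] at hm
            refine hEs.bdd_mul (c := M) hm.norm ?_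
            refine (ae_restrict_mem measurableSet_Ioo).mono fun x hx => ?_
            rw [Real.norm_eq_abs, abs_abs]
            exact hM _ ⟨by linarith [hx.2], by linarith [hx.1, hs.2, ht.2]⟩
          refine intervalIntegral.integral_mono_on_of_le_Ioo hs0.le hint (hEs.mul_const M)
            fun x hx => ?_
          rw [mul_comm]
          exact mul_le_mul_of_nonneg_left (hM _ ⟨by linarith [hx.2], by linarith [hx.1, hs.2, ht.2]⟩)
            (abs_nonneg _)
      _ = (∫ x in (0 : ℝ)..s, |relaxKernel α l x|) * M :=
          intervalIntegral.integral_mul_const _ _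
      _ ≤ _ := mul_le_mul_of_nonneg_right (intervalIntegral.integral_mono_interval le_rfl hs0.le
          hs.2.le (Eventually.of_forall fun _ => abs_nonneg _) hE.abs) hM0
  -- κ_{1-α} * E = 1 - l (1 * E): convolved with g₁ this gives ∫g₁ - l ∫(E * g₁), and multiplied by
  -- g₀ it gives g₀ - l g₀ ∫E. Together they are g - l E * g.
  have hkE : ∀ s ∈ Ioo 0 t, halfConv (rlKernel (1 - α)) (relaxKernel α l) s
      = 1 + (-l) * halfConv (fun _ => 1) (relaxKernel α l) s := fun s hs => by
    rw [halfConv_rlKernel_relaxKernel hα hα₁ hs.1, halfConv_one_left]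
    ring
  have h1 : halfConv (halfConv (rlKernel (1 - α)) (relaxKernel α l)) g₁ t
      = (∫ s in (0 : ℝ)..t, g₁ s) - l * ∫ s in (0 : ℝ)..t, halfConv (relaxKernel α l) g₁ s := by
    rw [halfConv_congr ht0.le hkE (fun _ _ => rfl), halfConv_add_const_mul_left (b := fun _ => 1),
      halfConv_one_left, halfConv_one_assoc ht0.le hE hg₁t, halfConv_one_left]
    · ring
    · simpa using hg₁t
    · simp only [halfConv_one_left]
      refine hg₁t.continuousOn_mul ?_
      have h2 := intervalIntegral.continuousOn_primitive_interval' hE left_mem_uIcc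
      refine h2.comp (by fun_prop) fun x hx => ?_
      rw [uIcc_of_le ht0.le] at hx ⊢
      exact ⟨by linarith [hx.2], by linarith [hx.1]⟩
  have h2 : halfConv (rlKernel (1 - α))
      (fun s => relaxKernel α l s * g₀ + halfConv (relaxKernel α l) g₁ s) t
      = halfConv (rlKernel (1 - α)) (relaxKernel α l) t * g₀
        + halfConv (rlKernel (1 - α)) (halfConv (relaxKernel α l) g₁) t := by
    have hi2 := (isWeaklySingular_rlKernel (sub_pos.2 hα₁) t).intervalIntegrable_mul
      (isWeaklySingular_relaxKernel (l := l) hα ht0) (sub_pos.2 hα₁) hα ht0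
    simp only [halfConv] at hi ⊢
    rw [← intervalIntegral.integral_mul_const, ← intervalIntegral.integral_add
      (hi2.mul_const g₀) hi]
    exact intervalIntegral.integral_congr fun s _ => by ring
  rw [h2, ← hassoc, h1, halfConv_relaxKernel_eq_integral hα hg₁ hg (Ioc_subset_Icc_self ht),
    halfConv_rlKernel_relaxKernel hα hα₁ ht0, hg t (Ioc_subset_Icc_self ht),
    intervalIntegral.integral_add (hE.mul_const g₀) (intervalIntegrable_halfConv ht0.le hE hg₁t),
    intervalIntegral.integral_mul_const]
  ring

end Relaxation

/-! ### Fourier multipliers with respect to a Hilbert basis -/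

section Multiplier

variable {H : Type*} [NormedAddCommGroup H] [InnerProductSpace ℝ H]
  (φ : HilbertBasis ℕ ℝ H)

lemma hilbertBasis_ext {x y : H} (h : ∀ j, inner ℝ (φ j) x = inner ℝ (φ j) y) : x = y := by
  apply φ.repr.injective
  ext j
  rw [φ.repr_apply_apply, φ.repr_apply_apply, h]

lemma hilbertBasis_hasSum (x : H) : HasSum (fun j => inner ℝ (φ j) x • φ j) x := by
  have := φ.hasSum_repr x
  simpa only [φ.repr_apply_apply] using this

lemma hilbertBasis_hasSum_sq (x : H) : HasSum (fun j => (inner ℝ (φ j) x) ^ 2) (‖x‖ ^ 2) := by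
  have := φ.hasSum_inner_mul_inner x x
  rw [real_inner_self_eq_norm_sq] at this
  simpa only [real_inner_comm (φ _) x, ← sq] using this

/-- A vector is the limit of its partial Fourier sums. Measurability in time is thereby reduced to
scalar kernels, and no strong continuity of the solution operator has to be shown. -/
lemma aestronglyMeasurable_of_coeff {X : Type*} [MeasurableSpace X] {ν : Measure X} {h : X → H}
    (hh : ∀ j, AEStronglyMeasurable (fun x => inner ℝ (φ j) (h x)) ν) :
    AEStronglyMeasurable h ν := by
  refine aestronglyMeasurable_of_tendsto_ae atTop
    (f := fun n x => ∑ j ∈ Finset.range n, inner ℝ (φ j) (h x) • φ j) (fun n => ?_)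
    (Eventually.of_forall fun x => (hilbertBasis_hasSum φ (h x)).tendsto_sum_nat)
  exact Finset.aestronglyMeasurable_fun_sum _ fun j _ => (hh j).smul_const _

lemma norm_le_of_coeff {x y : H} {M : ℝ} (hM : 0 ≤ M)
    (h : ∀ j, |inner ℝ (φ j) x| ≤ M * |inner ℝ (φ j) y|) : ‖x‖ ≤ M * ‖y‖ := by
  have h1 := hilbertBasis_hasSum_sq φ x
  have h2 := (hilbertBasis_hasSum_sq φ y).mul_left (M ^ 2)
  have h3 : ‖x‖ ^ 2 ≤ M ^ 2 * ‖y‖ ^ 2 := hasSum_le (fun j => by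
    rw [← sq_abs (inner ℝ (φ j) x), ← sq_abs (inner ℝ (φ j) y), ← mul_pow]
    exact pow_le_pow_left₀ (abs_nonneg _) (h j) 2) h1 h2
  rw [← mul_pow] at h3
  exact le_of_sq_le_sq h3 (by positivity)

/-- The Fourier multiplier with symbol `m`. -/
noncomputable def multiplier (m : ℕ → ℝ) (v : H) : H := ∑' j, (m j * inner ℝ (φ j) v) • φ j

variable {φ}

/-- A bounded symbol keeps the coefficients square summable; this makes the defining series
converge, instead of taking the default value 0. -/
lemma inner_multiplier {m : ℕ → ℝ} {M : ℝ} (hm : ∀ j, |m j| ≤ M) (v : H) (j : ℕ) :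
    inner ℝ (φ j) (multiplier φ m v) = m j * inner ℝ (φ j) v := by
  have hmem : Memℓp (fun j => m j * inner ℝ (φ j) v) 2 := by
    refine memℓp_gen ?_
    refine Summable.of_nonneg_of_le (fun j => by positivity) (fun j => ?_)
      ((hilbertBasis_hasSum_sq φ v).summable.mul_left (M ^ 2))
    simp only [ENNReal.toReal_ofNat, Real.rpow_ofNat, Real.norm_eq_abs, abs_mul, mul_pow, sq_abs]
    refine mul_le_mul_of_nonneg_right ?_ (sq_nonneg _)
    rw [← sq_abs (m j)]
    exact pow_le_pow_left₀ (abs_nonneg _) (hm j) 2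
  set f : lp (fun _ : ℕ => ℝ) 2 := ⟨_, hmem⟩ with hf
  have h1 : multiplier φ m v = φ.repr.symm f := (φ.hasSum_repr_symm f).tsum_eq
  rw [h1, ← φ.repr_apply_apply, LinearIsometryEquiv.apply_symm_apply]

lemma norm_multiplier_le {m : ℕ → ℝ} {M : ℝ} (hm : ∀ j, |m j| ≤ M) (v : H) :
    ‖multiplier φ m v‖ ≤ M * ‖v‖ := by
  refine norm_le_of_coeff φ ((abs_nonneg _).trans (hm 0)) fun j => ?_
  rw [inner_multiplier hm, abs_mul]
  exact mul_le_mul_of_nonneg_right (hm j) (abs_nonneg _)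

/-- Finite sections of `A^r v`. -/
noncomputable def powSection (φ : HilbertBasis ℕ ℝ H) (μ : ℕ → ℝ) (J : Finset ℕ) (r : ℝ) (v : H) :
    H := ∑ j ∈ J, (μ j ^ r * inner ℝ (φ j) v) • φ j

lemma norm_sq_sum_smul (J : Finset ℕ) (a : ℕ → ℝ) :
    ‖∑ j ∈ J, a j • φ j‖ ^ 2 = ∑ j ∈ J, a j ^ 2 := by
  rw [← real_inner_self_eq_norm_sq, φ.orthonormal.inner_sum]
  exact Finset.sum_congr rfl fun j _ => by simp [sq]

lemma norm_sum_smul_le {J : Finset ℕ} {a b : ℕ → ℝ} {c : ℝ} (hc : 0 ≤ c)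
    (h : ∀ j ∈ J, |a j| ≤ c * |b j|) :
    ‖∑ j ∈ J, a j • φ j‖ ≤ c * ‖∑ j ∈ J, b j • φ j‖ := by
  refine le_of_sq_le_sq ?_ (by positivity)
  rw [mul_pow, norm_sq_sum_smul, norm_sq_sum_smul, Finset.mul_sum]
  refine Finset.sum_le_sum fun j hj => ?_
  rw [← sq_abs (a j), ← sq_abs (b j), ← mul_pow]
  exact pow_le_pow_left₀ (abs_nonneg _) (h j hj) 2

variable {μ : ℕ → ℝ}

lemma powSection_add (J : Finset ℕ) (r : ℝ) (v w : H) :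
    powSection φ μ J r (v + w) = powSection φ μ J r v + powSection φ μ J r w := by
  simp only [powSection, inner_add_right, mul_add, add_smul, Finset.sum_add_distrib]

lemma norm_powSection_zero_le (J : Finset ℕ) (v : H) : ‖powSection φ μ J 0 v‖ ≤ ‖v‖ := by
  refine le_of_sq_le_sq ?_ (norm_nonneg v)
  rw [powSection, norm_sq_sum_smul]
  simp only [Real.rpow_zero, one_mul]
  exact sum_le_hasSum _ (fun _ _ => sq_nonneg _) (hilbertBasis_hasSum_sq φ v)

lemma norm_le_of_powSection_zero {v : H} {B : ℝ} (h : ∀ J, ‖powSection φ μ J 0 v‖ ≤ B) :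
    ‖v‖ ≤ B := by
  have h1 := (hilbertBasis_hasSum φ v).norm
  refine le_of_tendsto h1 (Eventually.of_forall fun J => ?_)
  have := h J
  simpa only [powSection, Real.rpow_zero, one_mul] using this

end Multiplier

/-! ### The solution operator -/

section Evolution

lemma intervalIntegrable_rlKernel_mul_norm {E : Type*} [NormedAddCommGroup E] {α t M : ℝ}
    (hα : 0 < α) {g : ℝ → E} (ht : 0 < t)
    (hg : IntervalIntegrable g volume 0 t) (hM : ∀ s ∈ Icc 0 t, ‖g s‖ ≤ M) :
    IntervalIntegrable (fun s => rlKernel α (t - s) * ‖g s‖) volume 0 t := by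
  have h1 := ((intervalIntegrable_rlKernel hα 0 t).comp_sub_left t).symm
  simp only [sub_zero, sub_self] at h1
  have h2 := hg.norm
  rw [intervalIntegrable_iff_integrableOn_Ioc_of_le ht.le] at h1 h2 ⊢
  refine h1.mul_bdd (c := M) h2.aestronglyMeasurable ?_
  refine (ae_restrict_mem measurableSet_Ioc).mono fun s hs => ?_
  rw [norm_norm]
  exact hM s (Ioc_subset_Icc_self hs)

variable {H : Type*} [NormedAddCommGroup H] [InnerProductSpace ℝ H]
  {φ : HilbertBasis ℕ ℝ H} {μ : ℕ → ℝ} {α T t : ℝ}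

/-- The operator `v ↦ ∑ⱼ E_{μⱼ}(t) (v, φⱼ) φⱼ`. -/
noncomputable def evol (φ : HilbertBasis ℕ ℝ H) (μ : ℕ → ℝ) (α t : ℝ) (v : H) : H :=
  multiplier φ (fun j => relaxKernel α (μ j) t) v

/-- The time derivative of `evol`. -/
noncomputable def evolDeriv (φ : HilbertBasis ℕ ℝ H) (μ : ℕ → ℝ) (α t : ℝ) (v : H) : H :=
  multiplier φ (fun j => relaxDeriv α (μ j) t) v

/-- Duhamel's formula. -/
noncomputable def duhamel (φ : HilbertBasis ℕ ℝ H) (μ : ℕ → ℝ) (α : ℝ) (g : ℝ → H) (t : ℝ) : H :=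
  ∫ s in (0 : ℝ)..t, evol φ μ α (t - s) (g s)

lemma abs_relaxKernel_le (hα : 0 < α) (hα₁ : α < 1) (hμ : ∀ j, 0 ≤ μ j) (ht : 0 < t) (j : ℕ) :
    |relaxKernel α (μ j) t| ≤ rlKernel α t := by
  rw [abs_of_nonneg (relaxKernel_nonneg hα hα₁ (hμ j) ht)]
  exact relaxKernel_le hα hα₁ (hμ j) ht

lemma inner_evol (hα : 0 < α) (hα₁ : α < 1) (hμ : ∀ j, 0 ≤ μ j) (ht : 0 < t) (v : H) (j : ℕ) :
    inner ℝ (φ j) (evol φ μ α t v) = relaxKernel α (μ j) t * inner ℝ (φ j) v :=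
  inner_multiplier (abs_relaxKernel_le hα hα₁ hμ ht) v j

lemma norm_evol_le (hα : 0 < α) (hα₁ : α < 1) (hμ : ∀ j, 0 ≤ μ j) (ht : 0 < t) (v : H) :
    ‖evol φ μ α t v‖ ≤ rlKernel α t * ‖v‖ :=
  norm_multiplier_le (abs_relaxKernel_le hα hα₁ hμ ht) v

lemma inner_evolDeriv (hα : 0 < α) (hα₁ : α < 1) (hμ : ∀ j, 0 ≤ μ j) (ht : 0 < t) (v : H)
    (j : ℕ) : inner ℝ (φ j) (evolDeriv φ μ α t v) = relaxDeriv α (μ j) t * inner ℝ (φ j) v :=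
  inner_multiplier (fun j => abs_relaxDeriv_le hα hα₁ (hμ j) ht) v j

lemma norm_evolDeriv_le (hα : 0 < α) (hα₁ : α < 1) (hμ : ∀ j, 0 ≤ μ j) (ht : 0 < t) (v : H) :
    ‖evolDeriv φ μ α t v‖ ≤ 5 / Real.Gamma α * t ^ (α - 2) * ‖v‖ :=
  norm_multiplier_le (fun j => abs_relaxDeriv_le hα hα₁ (hμ j) ht) v

lemma intervalIntegrable_coeff {g : ℝ → H} {a b : ℝ} (hg : IntervalIntegrable g volume a b)
    (x : H) : IntervalIntegrable (fun s => inner ℝ x (g s)) volume a b :=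
  ⟨hg.1.const_inner x, hg.2.const_inner x⟩

variable [CompleteSpace H]

lemma inner_intervalIntegral {g : ℝ → H} {a b : ℝ} (hg : IntervalIntegrable g volume a b) (x : H) :
    inner ℝ x (∫ s in a..b, g s) = ∫ s in a..b, inner ℝ x (g s) :=
  ((innerSL ℝ x).intervalIntegral_comp_comm hg).symm

variable (hα : 0 < α) (hα₁ : α < 1) (hμ : ∀ j, 0 ≤ μ j)

include hα hα₁ hμ

-- Measurability is checked on coefficients, and ‖E(t-s)‖ ≤ κ_α(t-s) supplies the dominating
-- function.
omit [CompleteSpace H] in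
lemma intervalIntegrable_evol_comp_sub {g : ℝ → H} (ht : 0 < t)
    (hg : AEStronglyMeasurable g (volume.restrict (Ioc 0 t)))
    (hi : IntervalIntegrable (fun s => rlKernel α (t - s) * ‖g s‖) volume 0 t) :
    IntervalIntegrable (fun s => evol φ μ α (t - s) (g s)) volume 0 t := by
  refine hi.mono_fun' ?_ ?_
  all_goals rw [uIoc_of_le ht.le, ← restrict_Ioo_eq_restrict_Ioc]
  · refine aestronglyMeasurable_of_coeff φ fun j => ?_
    have h1 : AEStronglyMeasurable (fun s => relaxKernel α (μ j) (t - s) * inner ℝ (φ j) (g s))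
        (volume.restrict (Ioo 0 t)) := by
      rw [restrict_Ioo_eq_restrict_Ioc]
      exact (aestronglyMeasurable_comp_sub (isWeaklySingular_relaxKernel hα ht).meas).mul
        (hg.const_inner (c := φ j))
    refine h1.congr ?_
    filter_upwards [ae_restrict_mem measurableSet_Ioo] with s hs
    rw [inner_evol hα hα₁ hμ (sub_pos.2 hs.2)]
  · filter_upwards [ae_restrict_mem measurableSet_Ioo] with s hs
    exact norm_evol_le hα hα₁ hμ (sub_pos.2 hs.2) _

lemma inner_duhamel {g : ℝ → H} (ht : 0 < t)
    (hi : IntervalIntegrable (fun s => evol φ μ α (t - s) (g s)) volume 0 t) (j : ℕ) :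
    inner ℝ (φ j) (duhamel φ μ α g t)
      = halfConv (relaxKernel α (μ j)) (fun s => inner ℝ (φ j) (g s)) t := by
  rw [duhamel, inner_intervalIntegral hi, halfConv, intervalIntegral.integral_of_le ht.le,
    intervalIntegral.integral_of_le ht.le, ← restrict_Ioo_eq_restrict_Ioc]
  exact setIntegral_congr_fun measurableSet_Ioo fun s hs =>
    inner_evol hα hα₁ hμ (sub_pos.2 hs.2) _ j

omit [CompleteSpace H] in
lemma norm_duhamel_le {g : ℝ → H} (ht : 0 < t)
    (hi : IntervalIntegrable (fun s => rlKernel α (t - s) * ‖g s‖) volume 0 t) :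
    ‖duhamel φ μ α g t‖ ≤ halfConv (rlKernel α) (fun s => ‖g s‖) t := by
  refine intervalIntegral.norm_integral_le_of_norm_le ht.le ?_ hi
  have h0 : ∀ᵐ s : ℝ, s ≠ t := by simp [ae_iff, measure_singleton]
  filter_upwards [h0] with s hst hs
  exact norm_evol_le hα hα₁ hμ (sub_pos.2 (lt_of_le_of_ne hs.2 hst)) _

omit [CompleteSpace H] in
lemma ae_intervalIntegrable_evol {g : ℝ → H} (hT : 0 < T) (hg : IntervalIntegrable g volume 0 T) :
    ∀ᵐ t ∂(volume.restrict (Ioo 0 T)),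
      IntervalIntegrable (fun s => rlKernel α (t - s) * ‖g s‖) volume 0 t ∧
      IntervalIntegrable (fun s => evol φ μ α (t - s) (g s)) volume 0 t := by
  filter_upwards [ae_intervalIntegrable_halfConv hT.le (intervalIntegrable_rlKernel hα 0 T)
    hg.norm, ae_restrict_mem measurableSet_Ioo] with t h ht
  refine ⟨h, intervalIntegrable_evol_comp_sub hα hα₁ hμ ht.1 ?_ h⟩
  exact hg.1.aestronglyMeasurable.mono_measure
    (Measure.restrict_mono (Ioc_subset_Ioc_right ht.2.le) le_rfl)

lemma intervalIntegrable_duhamel {g : ℝ → H} (hT : 0 < T) (hg : IntervalIntegrable g volume 0 T) :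
    IntervalIntegrable (duhamel φ μ α g) volume 0 T := by
  have h := ae_intervalIntegrable_evol (φ := φ) hα hα₁ hμ hT hg
  refine (intervalIntegrable_halfConv hT.le (intervalIntegrable_rlKernel hα 0 T)
    hg.norm).mono_fun' ?_ ?_
  all_goals rw [uIoc_of_le hT.le, ← restrict_Ioo_eq_restrict_Ioc]
  · refine aestronglyMeasurable_of_coeff φ fun j => ?_
    have h1 := intervalIntegrable_halfConv hT.le
      (intervalIntegrable_relaxKernel (l := μ j) hα hT.le) (intervalIntegrable_coeff hg (φ j))
    rw [intervalIntegrable_iff_integrableOn_Ioo_of_le hT.le] at h1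
    refine h1.aestronglyMeasurable.congr ?_
    filter_upwards [h, ae_restrict_mem measurableSet_Ioo] with t ht ht0
    rw [inner_duhamel hα hα₁ hμ ht0.1 ht.2]
  · filter_upwards [h, ae_restrict_mem measurableSet_Ioo] with t ht ht0
    exact norm_duhamel_le hα hα₁ hμ ht0.1 ht.1

omit [CompleteSpace H] in
lemma intervalIntegrable_evol_of_continuousOn {g : ℝ → H} (hg : ContinuousOn g (Icc 0 T))
    (ht : t ∈ Ioc 0 T) : IntervalIntegrable (fun s => rlKernel α (t - s) * ‖g s‖) volume 0 t ∧
      IntervalIntegrable (fun s => evol φ μ α (t - s) (g s)) volume 0 t := by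
  have hgt := hg.mono (Icc_subset_Icc_right ht.2)
  obtain ⟨M, hM⟩ := isCompact_Icc.exists_bound_of_continuousOn hgt
  have hgi : IntervalIntegrable g volume 0 t := hgt.intervalIntegrable_of_Icc ht.1.le
  have := intervalIntegrable_rlKernel_mul_norm hα ht.1 hgi hM
  exact ⟨this, intervalIntegrable_evol_comp_sub hα hα₁ hμ ht.1 hgi.1.aestronglyMeasurable this⟩

lemma inner_duhamel_of_continuousOn {g : ℝ → H} (hg : ContinuousOn g (Icc 0 T))
    (ht : t ∈ Icc 0 T) (j : ℕ) :
    inner ℝ (φ j) (duhamel φ μ α g t)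
      = halfConv (relaxKernel α (μ j)) (fun s => inner ℝ (φ j) (g s)) t := by
  rcases ht.1.eq_or_lt with rfl | h0
  · simp [duhamel, halfConv]
  · exact inner_duhamel hα hα₁ hμ h0
      (intervalIntegrable_evol_of_continuousOn hα hα₁ hμ hg ⟨h0, ht.2⟩).2 j

omit [CompleteSpace H] in
lemma norm_duhamel_le_of_continuousOn {g : ℝ → H} {M : ℝ} (hg : ContinuousOn g (Icc 0 T))
    (hM : ∀ s ∈ Icc 0 T, ‖g s‖ ≤ M) (ht : t ∈ Ioc 0 T) :
    ‖duhamel φ μ α g t‖ ≤ M * rlKernel (1 + α) t := by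
  refine (norm_duhamel_le hα hα₁ hμ ht.1
    (intervalIntegrable_evol_of_continuousOn (φ := φ) hα hα₁ hμ hg ht).1).trans ?_
  rw [halfConv_comm, ← integral_rlKernel hα ht.1, ← intervalIntegral.integral_const_mul]
  have h1 := ((intervalIntegrable_evol_of_continuousOn (φ := φ) hα hα₁ hμ hg
    ht).1.comp_sub_left t).symm
  simp only [sub_zero, sub_self, sub_sub_cancel] at h1
  refine intervalIntegral.integral_mono_on_of_le_Ioo ht.1.le
    (h1.congr fun s _ => mul_comm _ _) ((intervalIntegrable_rlKernel hα 0 t).const_mul M)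
    fun s hs => ?_
  exact mul_le_mul_of_nonneg_right (hM _ ⟨by linarith [hs.2], by linarith [hs.1, ht.2]⟩)
    (rlKernel_nonneg hα hs.1.le)

/-- The estimate behind the bounds for `u` and `u'`. -/
lemma norm_powSection_duhamel_le (hμ' : ∀ j, 0 < μ j) {g : ℝ → H} {M r ε : ℝ}
    (hg : ContinuousOn g (Icc 0 T)) (ht : t ∈ Ioc 0 T) (hε : ε ∈ Ioo (0 : ℝ) 1) (J : Finset ℕ)
    (hM : ∀ᵐ s ∂(volume.restrict (Ioo 0 t)), ‖powSection φ μ J r (g s)‖ ≤ M) :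
    ‖powSection φ μ J (r + 1 - ε / 2) (duhamel φ μ α g t)‖
      ≤ max 1 (Real.Gamma α)⁻¹ * (2 / α) * (ε⁻¹ * t ^ (α * ε / 2)) * M := by
  have ht0 := ht.1
  have hε0 := hε.1
  set K := max 1 (Real.Gamma α)⁻¹ with hK
  have hcoef : ∀ j, IntervalIntegrable
      (fun s => relaxKernel α (μ j) (t - s) * inner ℝ (φ j) (g s)) volume 0 t := fun j => by
    have h1 := ((intervalIntegrable_relaxKernel (l := μ j) hα ht0.le).comp_sub_left t).symm
    simp only [sub_zero, sub_self] at h1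
    refine h1.mul_continuousOn ?_
    rw [uIcc_of_le ht0.le]
    exact continuousOn_const.inner (hg.mono (Icc_subset_Icc_right ht.2))
  -- Finitely many modes: the powers of μⱼ and the sum pass under the time integral.
  have hrep : powSection φ μ J (r + 1 - ε / 2) (duhamel φ μ α g t)
      = ∫ s in (0 : ℝ)..t, ∑ j ∈ J, (μ j ^ (r + 1 - ε / 2) *
        (relaxKernel α (μ j) (t - s) * inner ℝ (φ j) (g s))) • φ j := by
    rw [intervalIntegral.integral_finsetSum
      fun j _ => ⟨(((hcoef j).const_mul _).1).smul_const _, (((hcoef j).const_mul _).2).smul_const _⟩]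
    refine Finset.sum_congr rfl fun j _ => ?_
    rw [intervalIntegral.integral_smul_const, intervalIntegral.integral_const_mul,
      inner_duhamel_of_continuousOn hα hα₁ hμ hg (Ioc_subset_Icc_self ht), halfConv]
  have hexp : -1 < -1 + α * ε / 2 := by linarith [mul_pos hα hε0]
  -- The primitive of s^(-1+αε/2) has the factor 1/(αε/2) = (2/α) ε⁻¹.
  have hint : ∫ s in (0 : ℝ)..t, K * (t - s) ^ (-1 + α * ε / 2) * M
      = K * (2 / α) * (ε⁻¹ * t ^ (α * ε / 2)) * M := by
    rw [intervalIntegral.integral_mul_const, intervalIntegral.integral_const_mul,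
      intervalIntegral.integral_comp_sub_left (fun s => s ^ (-1 + α * ε / 2)), sub_self, sub_zero,
      integral_rpow (Or.inl hexp), neg_add_cancel_comm, Real.zero_rpow (by positivity), sub_zero]
    field_simp
  rw [hrep, ← hint]
  refine intervalIntegral.norm_integral_le_of_norm_le ht0.le ?_ ?_
  · have h0 : ∀ᵐ s : ℝ, s ≠ t := by simp [ae_iff, measure_singleton]
    rw [ae_restrict_iff' measurableSet_Ioo] at hM
    filter_upwards [h0, hM] with s hst hMs hs
    have hs' : s ∈ Ioo 0 t := ⟨hs.1, lt_of_le_of_ne hs.2 hst⟩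
    have hts : 0 < t - s := sub_pos.2 hs'.2
    have hKt : 0 ≤ K * (t - s) ^ (-1 + α * ε / 2) :=
      mul_nonneg (by positivity) (Real.rpow_nonneg hts.le _)
    refine (norm_sum_smul_le hKt (b := fun j => μ j ^ r * inner ℝ (φ j) (g s)) fun j _ => ?_).trans
      (mul_le_mul_of_nonneg_left (hMs hs') hKt)
    -- With θ = 1 - ε/2 the kernel absorbs μⱼ^(1-ε/2) out of μⱼ^(r+1-ε/2), and μⱼ^r stays with g.
    have h1 := rpow_mul_relaxKernel_le (θ := 1 - ε / 2) hα hα₁ (hμ j) hts (by linarith [hε.2])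
      (by linarith)
    rw [sub_sub_cancel, ← mul_div_assoc] at h1
    have h2 : μ j ^ (r + 1 - ε / 2) * (relaxKernel α (μ j) (t - s) * inner ℝ (φ j) (g s))
        = (μ j ^ (1 - ε / 2) * relaxKernel α (μ j) (t - s)) * (μ j ^ r * inner ℝ (φ j) (g s)) := by
      rw [add_sub_assoc, Real.rpow_add (hμ' j)]
      ring
    rw [h2, abs_mul, abs_of_nonneg (mul_nonneg (Real.rpow_nonneg (hμ j) _)
      (relaxKernel_nonneg hα hα₁ (hμ j) hts))]
    exact mul_le_mul_of_nonneg_right h1 (abs_nonneg _)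
  · have := ((intervalIntegral.intervalIntegrable_rpow' hexp (a := 0) (b := t)).comp_sub_left
      t).symm
    simp only [sub_zero, sub_self] at this
    exact (this.const_mul K).mul_const M

end Evolution

/-! ### Time regularity and Caputo derivative of Duhamel's formula -/

section Solution

variable {H : Type*} [NormedAddCommGroup H] [InnerProductSpace ℝ H]
  {φ : HilbertBasis ℕ ℝ H} {μ : ℕ → ℝ} {α T t : ℝ}

/-- The first time derivative of `duhamel φ μ α f`, where `f' = f₁`. -/
noncomputable def solDeriv (φ : HilbertBasis ℕ ℝ H) (μ : ℕ → ℝ) (α : ℝ) (f f₁ : ℝ → H) (t : ℝ) : H :=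
  evol φ μ α t (f 0) + duhamel φ μ α f₁ t

/-- The second time derivative of `duhamel φ μ α f`, where `f' = f₁` and `f'' = f₂`. -/
noncomputable def solDeriv₂ (φ : HilbertBasis ℕ ℝ H) (μ : ℕ → ℝ) (α : ℝ) (f f₁ f₂ : ℝ → H)
    (t : ℝ) : H :=
  evolDeriv φ μ α t (f 0) + solDeriv φ μ α f₁ f₂ t

lemma intervalIntegrable_mono_right {E : Type*} [NormedAddCommGroup E] {T t : ℝ} {g : ℝ → E}
    (hg : IntervalIntegrable g volume 0 T) (ht : t ∈ Icc 0 T) :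
    IntervalIntegrable g volume 0 t := hg.mono_set (by
  rw [uIcc_of_le ht.1, uIcc_of_le (ht.1.trans ht.2)]; exact Icc_subset_Icc_right ht.2)

variable (hα : 0 < α) (hα₁ : α < 1) (hμ : ∀ j, 0 ≤ μ j)

include hα in
lemma continuousOn_relaxDeriv (l : ℝ) : ContinuousOn (relaxDeriv α l) (Ioi 0) := by
  unfold relaxDeriv
  exact ((continuousOn_const.mul (continuousOn_relaxKernel hα)).sub
    (continuousOn_const.mul (continuousOn_const.mul (continuousOn_relaxSquare hα)))).div
    continuousOn_id fun x hx => ne_of_gt hx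

include hα hα₁ hμ

lemma intervalIntegrable_evol (hT : 0 < T) (v : H) :
    IntervalIntegrable (fun t => evol φ μ α t v) volume 0 T := by
  refine ((intervalIntegrable_rlKernel hα 0 T).mul_const ‖v‖).mono_fun' ?_ ?_
  all_goals rw [uIoc_of_le hT.le]
  · refine aestronglyMeasurable_of_coeff φ fun j => ?_
    refine ((isWeaklySingular_relaxKernel (l := μ j) hα hT).meas.mul_const
      (inner ℝ (φ j) v)).congr ?_
    filter_upwards [ae_restrict_mem measurableSet_Ioc] with s hs
    rw [inner_evol hα hα₁ hμ hs.1]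
  · filter_upwards [ae_restrict_mem measurableSet_Ioc] with s hs
    exact norm_evol_le hα hα₁ hμ hs.1 _

lemma intervalIntegrable_evolDeriv {s : ℝ} (hs : 0 < s) (hst : s ≤ t) (v : H) :
    IntervalIntegrable (fun t => evolDeriv φ μ α t v) volume s t := by
  refine (intervalIntegrable_const (c := 5 / Real.Gamma α * s ^ (α - 2) * ‖v‖)).mono_fun' ?_ ?_
  all_goals rw [uIoc_of_le hst]
  · refine aestronglyMeasurable_of_coeff φ fun j => ?_
    have h1 : ContinuousOn (fun τ => relaxDeriv α (μ j) τ * inner ℝ (φ j) v) (Ioc s t) :=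
      ((continuousOn_relaxDeriv hα (μ j)).mono fun x hx => hs.trans hx.1).mul continuousOn_const
    refine (h1.aestronglyMeasurable measurableSet_Ioc).congr ?_
    filter_upwards [ae_restrict_mem measurableSet_Ioc] with τ hτ
    rw [inner_evolDeriv hα hα₁ hμ (hs.trans hτ.1)]
  · filter_upwards [ae_restrict_mem measurableSet_Ioc] with τ hτ
    refine (norm_evolDeriv_le hα hα₁ hμ (hs.trans hτ.1) v).trans ?_
    have hG := Real.Gamma_pos_of_pos hα
    refine mul_le_mul_of_nonneg_right (mul_le_mul_of_nonneg_left ?_ (by positivity))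
      (norm_nonneg v)
    exact Real.rpow_le_rpow_of_nonpos hs hτ.1.le (by linarith)

variable [CompleteSpace H]

lemma intervalIntegrable_solDeriv {f f₁ : ℝ → H} (hT : 0 < T)
    (hf₁ : IntervalIntegrable f₁ volume 0 T) :
    IntervalIntegrable (solDeriv φ μ α f f₁) volume 0 T :=
  (intervalIntegrable_evol hα hα₁ hμ hT (f 0)).add (intervalIntegrable_duhamel hα hα₁ hμ hT hf₁)

/-- `d/dt (duhamel f) = solDeriv f f'`. -/
lemma duhamel_eq_integral {f f₁ : ℝ → H} (hf : ContinuousOn f (Icc 0 T))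
    (hf₁ : IntervalIntegrable f₁ volume 0 T)
    (hff₁ : ∀ t ∈ Icc 0 T, f t = f 0 + ∫ s in (0 : ℝ)..t, f₁ s) (ht : t ∈ Icc 0 T) :
    duhamel φ μ α f t = ∫ s in (0 : ℝ)..t, solDeriv φ μ α f f₁ s := by
  rcases ht.1.eq_or_lt with rfl | ht0
  · simp [duhamel]
  have hf₁t := intervalIntegrable_mono_right hf₁ ht
  refine hilbertBasis_ext φ fun j => ?_
  rw [inner_duhamel_of_continuousOn hα hα₁ hμ hf ht,
    inner_intervalIntegral (intervalIntegrable_solDeriv hα hα₁ hμ ht0 hf₁t),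
    halfConv_relaxKernel_eq_integral hα (intervalIntegrable_coeff hf₁ (φ j))
      (g₀ := inner ℝ (φ j) (f 0)) (fun s hs => ?_) ht,
    intervalIntegral.integral_of_le ht0.le, intervalIntegral.integral_of_le ht0.le,
    ← restrict_Ioo_eq_restrict_Ioc]
  · refine integral_congr_ae ?_
    filter_upwards [ae_intervalIntegrable_evol (φ := φ) hα hα₁ hμ ht0 hf₁t,
      ae_restrict_mem measurableSet_Ioo] with s h1 hs
    rw [solDeriv, inner_add_right, inner_evol hα hα₁ hμ hs.1, inner_duhamel hα hα₁ hμ hs.1 h1.2]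
  · rw [hff₁ s hs, inner_add_right,
      inner_intervalIntegral (intervalIntegrable_mono_right hf₁ hs)]

/-- The lower limit must be positive: the available bound t^(α-2) for the derivative is not
integrable at 0. -/
lemma evol_sub_evol {s : ℝ} (hs : 0 < s) (hst : s ≤ t) (v : H) :
    evol φ μ α t v - evol φ μ α s v = ∫ τ in s..t, evolDeriv φ μ α τ v := by
  refine hilbertBasis_ext φ fun j => ?_
  rw [inner_sub_right, inner_evol hα hα₁ hμ (hs.trans_le hst), inner_evol hα hα₁ hμ hs,
    inner_intervalIntegral (intervalIntegrable_evolDeriv hα hα₁ hμ hs hst v), ← sub_mul]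
  have hsub : uIcc s t ⊆ Ioi 0 := by
    rw [uIcc_of_le hst]; exact fun x hx => hs.trans_le hx.1
  rw [← intervalIntegral.integral_eq_sub_of_hasDerivAt
    (fun τ hτ => hasDerivAt_relaxKernel hα (hsub hτ))
    (((continuousOn_relaxDeriv hα (μ j)).mono hsub).intervalIntegrable),
    ← intervalIntegral.integral_mul_const]
  exact intervalIntegral.integral_congr fun τ hτ => (inner_evolDeriv hα hα₁ hμ (hsub hτ) v j).symm

lemma intervalIntegrable_solDeriv₂ {f f₁ f₂ : ℝ → H} {s : ℝ} (hs : 0 < s) (hst : s ≤ t)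
    (htT : t ≤ T) (hf₂ : IntervalIntegrable f₂ volume 0 T) :
    IntervalIntegrable (solDeriv₂ φ μ α f f₁ f₂) volume s t := by
  refine (intervalIntegrable_evolDeriv hα hα₁ hμ hs hst (f 0)).add ?_
  refine (intervalIntegrable_solDeriv hα hα₁ hμ (hs.trans_le (hst.trans htT)) hf₂).mono_set ?_
  rw [uIcc_of_le hst, uIcc_of_le (hs.le.trans (hst.trans htT))]
  exact Icc_subset_Icc hs.le htT

lemma solDeriv_sub_solDeriv {f f₁ f₂ : ℝ → H} {s : ℝ} (hs : 0 < s) (hst : s ≤ t) (htT : t ≤ T)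
    (hf₁ : ContinuousOn f₁ (Icc 0 T)) (hf₂ : IntervalIntegrable f₂ volume 0 T)
    (hf₁f₂ : ∀ t ∈ Icc 0 T, f₁ t = f₁ 0 + ∫ s in (0 : ℝ)..t, f₂ s) :
    solDeriv φ μ α f f₁ t - solDeriv φ μ α f f₁ s
      = ∫ τ in s..t, solDeriv₂ φ μ α f f₁ f₂ τ := by
  have hT := hs.trans_le (hst.trans htT)
  have ht : t ∈ Icc 0 T := ⟨(hs.trans_le hst).le, htT⟩
  have hs' : s ∈ Icc 0 T := ⟨hs.le, hst.trans htT⟩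
  have hi := intervalIntegrable_solDeriv (φ := φ) (f := f₁) hα hα₁ hμ hT hf₂
  have hi0t := intervalIntegrable_mono_right hi ht
  have hi0s := intervalIntegrable_mono_right hi hs'
  simp only [solDeriv₂]
  rw [intervalIntegral.integral_add (intervalIntegrable_evolDeriv hα hα₁ hμ hs hst (f 0))
    (hi0s.symm.trans hi0t), ← evol_sub_evol hα hα₁ hμ hs hst, solDeriv, solDeriv,
    duhamel_eq_integral hα hα₁ hμ hf₁ hf₂ hf₁f₂ ht, duhamel_eq_integral hα hα₁ hμ hf₁ hf₂ hf₁f₂ hs',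
    ← intervalIntegral.integral_interval_sub_left hi0t hi0s]
  abel

/-- On [t/2, T], a neighbourhood of t relative to (0, T], the function is a constant plus the
primitive of an integrable function. -/
lemma continuousOn_solDeriv {f f₁ f₂ : ℝ → H} (hf₁ : ContinuousOn f₁ (Icc 0 T))
    (hf₂ : IntervalIntegrable f₂ volume 0 T)
    (hf₁f₂ : ∀ t ∈ Icc 0 T, f₁ t = f₁ 0 + ∫ s in (0 : ℝ)..t, f₂ s) :
    ContinuousOn (solDeriv φ μ α f f₁) (Ioc 0 T) := by
  intro t ht
  have hd : 0 < t / 2 := half_pos ht.1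
  have hdT : t / 2 ≤ T := (half_le_self ht.1.le).trans ht.2
  have h1 : ContinuousOn (fun x => solDeriv φ μ α f f₁ (t / 2)
      + ∫ τ in (t / 2)..x, solDeriv₂ φ μ α f f₁ f₂ τ) (Icc (t / 2) T) := by
    have := intervalIntegral.continuousOn_primitive_interval'
      (intervalIntegrable_solDeriv₂ (φ := φ) (f := f) (f₁ := f₁) hα hα₁ hμ hd hdT le_rfl hf₂)
      left_mem_uIcc
    rw [uIcc_of_le hdT] at this
    exact continuousOn_const.add this
  have h2 : ContinuousOn (solDeriv φ μ α f f₁) (Icc (t / 2) T) := h1.congr fun x hx => by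
    beta_reduce
    rw [← solDeriv_sub_solDeriv hα hα₁ hμ hd hx.1 hx.2 hf₁ hf₂ hf₁f₂]
    abel
  refine (h2 t ⟨half_le_self ht.1.le, ht.2⟩).mono_of_mem_nhdsWithin ?_
  have : Ioi (t / 2) ∈ 𝓝 t := Ioi_mem_nhds (half_lt_self ht.1)
  filter_upwards [mem_nhdsWithin_of_mem_nhds this, self_mem_nhdsWithin] with x hx1 hx2
  exact ⟨le_of_lt hx1, hx2.2⟩

lemma continuousOn_duhamel {f f₁ : ℝ → H} (hT : 0 < T) (hf : ContinuousOn f (Icc 0 T))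
    (hf₁ : IntervalIntegrable f₁ volume 0 T)
    (hff₁ : ∀ t ∈ Icc 0 T, f t = f 0 + ∫ s in (0 : ℝ)..t, f₁ s) :
    ContinuousOn (duhamel φ μ α f) (Icc 0 T) := by
  have := intervalIntegral.continuousOn_primitive_interval'
    (intervalIntegrable_solDeriv (φ := φ) (f := f) hα hα₁ hμ hT hf₁) left_mem_uIcc
  rw [uIcc_of_le hT.le] at this
  exact this.congr fun x hx => duhamel_eq_integral hα hα₁ hμ hf hf₁ hff₁ hx

lemma hasDerivWithinAt_duhamel {f f₁ f₂ : ℝ → H} (hf : ContinuousOn f (Icc 0 T))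
    (hf₁ : ContinuousOn f₁ (Icc 0 T)) (hf₂ : IntervalIntegrable f₂ volume 0 T)
    (hff₁ : ∀ t ∈ Icc 0 T, f t = f 0 + ∫ s in (0 : ℝ)..t, f₁ s)
    (hf₁f₂ : ∀ t ∈ Icc 0 T, f₁ t = f₁ 0 + ∫ s in (0 : ℝ)..t, f₂ s) (ht : t ∈ Ioc 0 T) :
    HasDerivWithinAt (duhamel φ μ α f) (solDeriv φ μ α f f₁ t) (Icc 0 T) t := by
  have hT : 0 < T := ht.1.trans_le ht.2
  have hc := continuousOn_solDeriv (φ := φ) (f := f) hα hα₁ hμ hf₁ hf₂ hf₁f₂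
  have hf₁i : IntervalIntegrable f₁ volume 0 T := hf₁.intervalIntegrable_of_Icc hT.le
  have hi := intervalIntegrable_solDeriv (φ := φ) (f := f) hα hα₁ hμ hT hf₁i
  have hit := intervalIntegrable_mono_right hi (Ioc_subset_Icc_self ht)
  -- Freezing the integrand after T makes it continuous on all of (0, ∞). The fundamental theorem
  -- then gives a two-sided derivative also at t = T, which is restricted to [0, T] afterwards.
  set g : ℝ → H := fun x => solDeriv φ μ α f f₁ (min x T) with hg
  have hgc : ContinuousOn g (Ioi 0) := hc.comp (by fun_prop) fun x hx =>
    ⟨lt_min hx hT, min_le_right _ _⟩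
  have hgeq : ∀ x ∈ Icc 0 T, g x = solDeriv φ μ α f f₁ x := fun x hx => by
    rw [hg]; simp only [min_eq_left hx.2]
  have hgit : IntervalIntegrable g volume 0 t := hit.congr fun x hx => by
    rw [uIoc_of_le ht.1.le] at hx
    exact (hgeq x ⟨hx.1.le, hx.2.trans ht.2⟩).symm
  have h1 : HasDerivAt (fun x => ∫ s in (0 : ℝ)..x, g s) (g t) t :=
    intervalIntegral.integral_hasDerivAt_right hgit
      (hgc.stronglyMeasurableAtFilter isOpen_Ioi t ht.1) (hgc.continuousAt (Ioi_mem_nhds ht.1))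
  rw [hgeq t (Ioc_subset_Icc_self ht)] at h1
  refine h1.hasDerivWithinAt.congr_of_mem (fun x hx => ?_) (Ioc_subset_Icc_self ht)
  rw [duhamel_eq_integral hα hα₁ hμ hf hf₁i hff₁ hx]
  refine intervalIntegral.integral_congr fun s hs => ?_
  rw [uIcc_of_le hx.1] at hs
  exact (hgeq s ⟨hs.1, hs.2.trans hx.2⟩).symm

/-- Lebesgue differentiation on each interval (1/(n+1), T), where u'' is integrable up to the left
end; countably many exceptional null sets are united. -/
lemma ae_hasDerivAt_solDeriv {f f₁ f₂ : ℝ → H} (hf₁ : ContinuousOn f₁ (Icc 0 T))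
    (hf₂ : IntervalIntegrable f₂ volume 0 T)
    (hf₁f₂ : ∀ t ∈ Icc 0 T, f₁ t = f₁ 0 + ∫ s in (0 : ℝ)..t, f₂ s) :
    ∀ᵐ t ∂(volume.restrict (Ioo 0 T)),
      HasDerivAt (solDeriv φ μ α f f₁) (solDeriv₂ φ μ α f f₁ f₂ t) t := by
  have key : ∀ n : ℕ, ∀ᵐ t : ℝ, t ∈ Ioo (1 / ((n : ℝ) + 1)) T →
      HasDerivAt (solDeriv φ μ α f f₁) (solDeriv₂ φ μ α f f₁ f₂ t) t := by
    intro n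
    set d := 1 / ((n : ℝ) + 1) with hd
    have hd0 : 0 < d := by positivity
    rcases le_or_gt T d with hTd | hdT
    · exact Eventually.of_forall fun t ht => absurd (ht.1.trans ht.2) (not_lt.2 hTd)
    have hi := intervalIntegrable_solDeriv₂ (φ := φ) (f := f) (f₁ := f₁) hα hα₁ hμ hd0 hdT.le
      le_rfl hf₂
    filter_upwards [hi.ae_hasDerivAt_integral] with t h ht
    have h1 := h (by rw [uIcc_of_le hdT.le]; exact Ioo_subset_Icc_self ht) d left_mem_uIcc
    refine (h1.const_add (solDeriv φ μ α f f₁ d)).congr_of_eventuallyEq ?_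
    filter_upwards [Ioo_mem_nhds ht.1 ht.2] with x hx
    rw [← solDeriv_sub_solDeriv hα hα₁ hμ hd0 hx.1.le hx.2.le hf₁ hf₂ hf₁f₂]
    abel
  rw [ae_restrict_iff' measurableSet_Ioo]
  filter_upwards [ae_all_iff.2 key] with t h ht
  obtain ⟨n, hn⟩ := exists_nat_one_div_lt ht.1
  exact h n ⟨hn, ht.2⟩

omit [CompleteSpace H] in
lemma ae_norm_solDeriv₂_le {f f₁ f₂ : ℝ → H} (hT : 0 < T)
    (hf₂ : IntervalIntegrable f₂ volume 0 T) {C : ℝ} (hC₁ : 1 ≤ C) (hC : 5 / Real.Gamma α ≤ C) :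
    ∀ᵐ t ∂(volume.restrict (Ioo 0 T)), ‖solDeriv₂ φ μ α f f₁ f₂ t‖
      ≤ C * (rlIntegral α (fun s => ‖f₂ s‖) t + t ^ (α - 1) * ‖f₁ 0‖ + t ^ (α - 2) * ‖f 0‖) := by
  filter_upwards [ae_intervalIntegrable_evol (φ := φ) hα hα₁ hμ hT hf₂,
    ae_restrict_mem measurableSet_Ioo] with t h ht
  have hG := Real.Gamma_pos_of_pos hα
  have h1 := norm_evolDeriv_le (φ := φ) hα hα₁ hμ ht.1 (f 0)
  have h2 := norm_evol_le (φ := φ) hα hα₁ hμ ht.1 (f₁ 0)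
  have h3 := norm_duhamel_le (φ := φ) hα hα₁ hμ ht.1 h.1
  have h4 : rlIntegral α (fun s => ‖f₂ s‖) t = halfConv (rlKernel α) (fun s => ‖f₂ s‖) t := rfl
  have h5 : 0 ≤ halfConv (rlKernel α) (fun s => ‖f₂ s‖) t := (norm_nonneg _).trans h3
  have h6 : 0 ≤ t ^ (α - 1) * ‖f₁ 0‖ := mul_nonneg (Real.rpow_nonneg ht.1.le _) (norm_nonneg _)
  have h7 : 0 ≤ t ^ (α - 2) * ‖f 0‖ := mul_nonneg (Real.rpow_nonneg ht.1.le _) (norm_nonneg _)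
  have h8 : (Real.Gamma α)⁻¹ ≤ C := by
    refine le_trans ?_ hC
    rw [div_eq_mul_inv]
    have := inv_pos.2 hG
    linarith
  have h9 : rlKernel α t * ‖f₁ 0‖ = (Real.Gamma α)⁻¹ * (t ^ (α - 1) * ‖f₁ 0‖) := by
    rw [rlKernel]; ring
  rw [h4]
  calc ‖solDeriv₂ φ μ α f f₁ f₂ t‖
      ≤ ‖evolDeriv φ μ α t (f 0)‖ + (‖evol φ μ α t (f₁ 0)‖ + ‖duhamel φ μ α f₂ t‖) :=
        (norm_add_le _ _).trans (by gcongr; exact norm_add_le _ _)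
    _ ≤ 5 / Real.Gamma α * t ^ (α - 2) * ‖f 0‖ + (rlKernel α t * ‖f₁ 0‖
        + halfConv (rlKernel α) (fun s => ‖f₂ s‖) t) := by gcongr
    _ = 5 / Real.Gamma α * (t ^ (α - 2) * ‖f 0‖) + ((Real.Gamma α)⁻¹ * (t ^ (α - 1) * ‖f₁ 0‖)
        + 1 * halfConv (rlKernel α) (fun s => ‖f₂ s‖) t) := by rw [h9]; ring
    _ ≤ C * (t ^ (α - 2) * ‖f 0‖) + (C * (t ^ (α - 1) * ‖f₁ 0‖)
        + C * halfConv (rlKernel α) (fun s => ‖f₂ s‖) t) := by gcongr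
    _ = _ := by ring

/-- The integrand of the Caputo derivative. -/
lemma intervalIntegrable_caputo {f f₁ f₂ : ℝ → H} (hf₁ : ContinuousOn f₁ (Icc 0 T))
    (hf₂ : IntervalIntegrable f₂ volume 0 T)
    (hf₁f₂ : ∀ t ∈ Icc 0 T, f₁ t = f₁ 0 + ∫ s in (0 : ℝ)..t, f₂ s) (ht : t ∈ Icc 0 T) :
    IntervalIntegrable (fun s => rlKernel (1 - α) (t - s) • solDeriv φ μ α f f₁ s) volume 0 t := by
  rcases ht.1.eq_or_lt with rfl | ht0
  · exact IntervalIntegrable.refl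
  obtain ⟨M, hM⟩ := isCompact_Icc.exists_bound_of_continuousOn hf₁
  have hM0 : 0 ≤ M := (norm_nonneg _).trans (hM t ht)
  have hc := (continuousOn_solDeriv (φ := φ) (f := f) hα hα₁ hμ hf₁ hf₂ hf₁f₂).mono
    (Ioc_subset_Ioc_right ht.2)
  have hm : AEStronglyMeasurable (solDeriv φ μ α f f₁) (volume.restrict (Ioc 0 t)) :=
    hc.aestronglyMeasurable measurableSet_Ioc
  -- u' is dominated by κ_α, because κ_{1+α}(s) = (s/α) κ_α(s) ≤ (t/α) κ_α(s). Its product with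
  -- κ_{1-α}(t-s) is then integrable at every t, by the Beta integral.
  have hws : IsWeaklySingular α t (fun s => ‖solDeriv φ μ α f f₁ s‖) := by
    refine ⟨hm.norm, ‖f 0‖ + M * (t / α), by positivity, fun s hs => ?_⟩
    have hs' : s ∈ Ioc 0 T := ⟨hs.1, hs.2.trans ht.2⟩
    have h1 := norm_evol_le (φ := φ) hα hα₁ hμ hs.1 (f 0)
    have h2 := norm_duhamel_le_of_continuousOn (φ := φ) hα hα₁ hμ hf₁ hM hs'
    have h3 := mul_rlKernel hα hs.1
    have hk := rlKernel_nonneg hα hs.1.le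
    have h4 : rlKernel (1 + α) s ≤ t / α * rlKernel α s := by
      rw [add_comm, div_mul_eq_mul_div, le_div_iff₀ hα, mul_comm, ← h3]
      exact mul_le_mul_of_nonneg_right hs.2 hk
    rw [abs_norm]
    calc ‖solDeriv φ μ α f f₁ s‖ ≤ rlKernel α s * ‖f 0‖ + M * rlKernel (1 + α) s :=
          (norm_add_le _ _).trans (add_le_add h1 h2)
      _ ≤ rlKernel α s * ‖f 0‖ + M * (t / α * rlKernel α s) := by gcongr
      _ = _ := by ring
  have hk := isWeaklySingular_rlKernel (sub_pos.2 hα₁) t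
  refine (hk.intervalIntegrable_mul hws (sub_pos.2 hα₁) hα ht0).mono_fun' ?_ ?_
  all_goals rw [uIoc_of_le ht0.le]
  · exact (aestronglyMeasurable_comp_sub hk.meas).smul hm
  · refine (ae_restrict_mem measurableSet_Ioc).mono fun s hs => ?_
    beta_reduce
    rw [norm_smul, Real.norm_eq_abs,
      abs_of_nonneg (rlKernel_nonneg (sub_pos.2 hα₁) (sub_nonneg.2 hs.2))]

/-- The equation `∂ₜ^α u = f - A u`, in Fourier coefficients. -/
lemma inner_caputo_solDeriv {f f₁ f₂ : ℝ → H} (hf : ContinuousOn f (Icc 0 T))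
    (hf₁ : ContinuousOn f₁ (Icc 0 T)) (hf₂ : IntervalIntegrable f₂ volume 0 T)
    (hff₁ : ∀ t ∈ Icc 0 T, f t = f 0 + ∫ s in (0 : ℝ)..t, f₁ s)
    (hf₁f₂ : ∀ t ∈ Icc 0 T, f₁ t = f₁ 0 + ∫ s in (0 : ℝ)..t, f₂ s) (ht : t ∈ Ioc 0 T) (j : ℕ) :
    inner ℝ (φ j) (caputo α (solDeriv φ μ α f f₁) t)
      = inner ℝ (φ j) (f t) - μ j * inner ℝ (φ j) (duhamel φ μ α f t) := by
  have ht0 := ht.1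
  have ht' := Ioc_subset_Icc_self ht
  have hT : 0 < T := ht.1.trans_le ht.2
  have hf₁i : IntervalIntegrable f₁ volume 0 T := hf₁.intervalIntegrable_of_Icc hT.le
  obtain ⟨M, hM⟩ := isCompact_Icc.exists_bound_of_continuousOn hf₁
  have hi := intervalIntegrable_caputo (φ := φ) (f := f) hα hα₁ hμ hf₁ hf₂ hf₁f₂ ht'
  have hij := intervalIntegrable_coeff hi (φ j)
  have hcoef : ∀ s ∈ Ioo 0 t, inner ℝ (φ j) (rlKernel (1 - α) (t - s) • solDeriv φ μ α f f₁ s)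
      = rlKernel (1 - α) (t - s) * (relaxKernel α (μ j) s * inner ℝ (φ j) (f 0)
        + halfConv (relaxKernel α (μ j)) (fun s => inner ℝ (φ j) (f₁ s)) s) := fun s hs => by
    rw [inner_smul_right, solDeriv, inner_add_right, inner_evol hα hα₁ hμ hs.1,
      inner_duhamel_of_continuousOn hα hα₁ hμ hf₁ ⟨hs.1.le, hs.2.le.trans ht.2⟩]
  have h1 : inner ℝ (φ j) (caputo α (solDeriv φ μ α f f₁) t)
      = halfConv (rlKernel (1 - α)) (fun s => relaxKernel α (μ j) s * inner ℝ (φ j) (f 0)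
        + halfConv (relaxKernel α (μ j)) (fun s => inner ℝ (φ j) (f₁ s)) s) t := by
    rw [caputo, rlIntegral, inner_intervalIntegral hi, halfConv,
      intervalIntegral.integral_of_le ht0.le, intervalIntegral.integral_of_le ht0.le,
      ← restrict_Ioo_eq_restrict_Ioc]
    exact setIntegral_congr_fun measurableSet_Ioo hcoef
  rw [h1, inner_duhamel_of_continuousOn hα hα₁ hμ hf ht']
  refine halfConv_rlKernel_relaxation (M := M) (g := fun s => inner ℝ (φ j) (f s)) hα hα₁ (intervalIntegrable_coeff hf₁i (φ j))
    (fun s hs => ?_) (fun s hs => ?_) ht ?_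
  · refine (abs_real_inner_le_norm _ _).trans ?_
    rw [φ.orthonormal.1 j, one_mul]
    exact hM s (Ioo_subset_Icc_self hs)
  · rw [hff₁ s hs, inner_add_right,
      inner_intervalIntegral (intervalIntegrable_mono_right hf₁i hs)]
  · have h2 := ((isWeaklySingular_rlKernel (sub_pos.2 hα₁) t).intervalIntegrable_mul
      (isWeaklySingular_relaxKernel (l := μ j) hα ht0) (sub_pos.2 hα₁) hα ht0).mul_const
      (inner ℝ (φ j) (f 0))
    rw [intervalIntegrable_iff_integrableOn_Ioo_of_le ht0.le] at hij h2 ⊢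
    refine (hij.sub h2).congr_fun (fun s hs => ?_) measurableSet_Ioo
    simp only [Pi.sub_apply]
    rw [hcoef s hs]
    ring

omit [CompleteSpace H] in
lemma norm_powSection_evol_le (hμ' : ∀ j, 0 < μ j) {r ε : ℝ} (ht : 0 < t)
    (hε : ε ∈ Ioo (0 : ℝ) 1) (J : Finset ℕ) (v : H) :
    ‖powSection φ μ J (r + 1 - ε / 2) (evol φ μ α t v)‖
      ≤ max 1 (Real.Gamma α)⁻¹ * t ^ (-1 + α * ε / 2) * ‖powSection φ μ J r v‖ := by
  have hKt : 0 ≤ max 1 (Real.Gamma α)⁻¹ * t ^ (-1 + α * ε / 2) :=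
    mul_nonneg (by positivity) (Real.rpow_nonneg ht.le _)
  refine norm_sum_smul_le hKt fun j _ => ?_
  have h1 := rpow_mul_relaxKernel_le (θ := 1 - ε / 2) hα hα₁ (hμ j) ht (by linarith [hε.2])
    (by linarith [hε.1])
  rw [sub_sub_cancel, ← mul_div_assoc] at h1
  have h2 : μ j ^ (r + 1 - ε / 2) * inner ℝ (φ j) (evol φ μ α t v)
      = (μ j ^ (1 - ε / 2) * relaxKernel α (μ j) t) * (μ j ^ r * inner ℝ (φ j) v) := by
    rw [add_sub_assoc, Real.rpow_add (hμ' j), inner_evol hα hα₁ hμ ht]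
    ring
  rw [h2, abs_mul, abs_of_nonneg (mul_nonneg (Real.rpow_nonneg (hμ j) _)
    (relaxKernel_nonneg hα hα₁ (hμ j) ht))]
  exact mul_le_mul_of_nonneg_right h1 (abs_nonneg _)

end Solution

/-! ### Weak time derivatives -/

section Weak

variable {T : ℝ}

lemma HasW11Deriv.clm_comp {X Y : Type*} [NormedAddCommGroup X] [NormedSpace ℝ X]
    [CompleteSpace X] [NormedAddCommGroup Y] [NormedSpace ℝ Y] [CompleteSpace Y] {g g' : ℝ → X}
    (h : HasW11Deriv T g g') (L : X →L[ℝ] Y) :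
    HasW11Deriv T (fun t => L (g t)) fun t => L (g' t) := by
  refine ⟨L.integrable_comp h.integrable, L.integrable_comp h.integrable_deriv,
    fun θ h1 h2 h3 => ?_⟩
  have hb : ∀ (η : ℝ → ℝ) (G : ℝ → X), Continuous η → HasCompactSupport η →
      IntegrableOn G (Ioo 0 T) →
      ∫ t in Ioo 0 T, η t • L (G t) = L (∫ t in Ioo 0 T, η t • G t) := by
    intro η G hη hηc hG
    obtain ⟨C, hC⟩ := hηc.exists_bound_of_continuous hη
    have hi : IntegrableOn (fun t => η t • G t) (Ioo 0 T) :=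
      hG.bdd_smul C hη.aestronglyMeasurable (Eventually.of_forall hC)
    rw [← L.integral_comp_comm hi]
    simp only [map_smul]
  have hd : Continuous (deriv θ) := h1.continuous_deriv (by simp)
  rw [hb _ _ hd h2.deriv h.integrable, hb _ _ h1.continuous h2 h.integrable_deriv,
    h.integral_eq θ h1 h2 h3, map_neg]

/-- The primitive from 0 vanishes before the support of ψ, and after it because the total integral
is zero. These ψ are therefore exactly the derivatives of test functions. -/
lemma exists_primitive_of_integral_eq_zero {ψ : ℝ → ℝ} (h1 : ContDiff ℝ ∞ ψ)
    (h2 : HasCompactSupport ψ) (h3 : tsupport ψ ⊆ Ioo 0 T) (h0 : ∫ s in (0 : ℝ)..T, ψ s = 0) :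
    ∃ θ : ℝ → ℝ, ContDiff ℝ ∞ θ ∧ HasCompactSupport θ ∧ tsupport θ ⊆ Ioo 0 T ∧ deriv θ = ψ := by
  have hc := h1.continuous
  have hder : ∀ t, HasDerivAt (fun t => ∫ s in (0 : ℝ)..t, ψ s) (ψ t) t := fun t =>
    intervalIntegral.integral_hasDerivAt_right (hc.intervalIntegrable _ _)
      (hc.stronglyMeasurableAtFilter _ _) hc.continuousAt
  have hderiv : deriv (fun t => ∫ s in (0 : ℝ)..t, ψ s) = ψ := funext fun t => (hder t).deriv
  obtain ⟨a, b, ha, hb, hab⟩ : ∃ a b : ℝ, 0 < a ∧ b < T ∧ tsupport ψ ⊆ Icc a b := by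
    rcases (tsupport ψ).eq_empty_or_nonempty with he | hne
    -- For ψ = 0 only 0 < a and b < T matter; the interval [a, b] may be empty.
    · exact ⟨1, T - 1, one_pos, by linarith, by rw [he]; exact empty_subset _⟩
    · obtain ⟨a, ha, ha'⟩ := h2.isCompact.exists_isLeast hne
      obtain ⟨b, hb, hb'⟩ := h2.isCompact.exists_isGreatest hne
      exact ⟨a, b, (h3 ha).1, (h3 hb).2, fun x hx => ⟨ha' hx, hb' hx⟩⟩
  have hzero : ∀ s, s ∉ Icc a b → ψ s = 0 := fun s hs => by
    by_contra h
    exact hs (hab (subset_tsupport ψ h))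
  have hsupp : tsupport (fun t => ∫ s in (0 : ℝ)..t, ψ s) ⊆ Icc a b := by
    refine closure_minimal (fun t ht => ?_) isClosed_Icc
    by_contra hn
    refine ht ?_
    rcases lt_or_ge t a with h | h
    · refine (intervalIntegral.integral_congr (g := fun _ => 0) fun s hs => hzero s fun hs' => ?_).trans
        (by simp)
      have : s ≤ max 0 t := hs.2
      exact absurd hs'.1 (not_le.2 (this.trans_lt (max_lt ha h)))
    · have h' : b < t := by
        by_contra! h''
        exact hn ⟨h, h''⟩
      beta_reduce
      rw [← intervalIntegral.integral_add_adjacent_intervals (hc.intervalIntegrable 0 T)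
        (hc.intervalIntegrable T t), h0, zero_add]
      refine (intervalIntegral.integral_congr (g := fun _ => 0) fun s hs => hzero s fun hs' => ?_).trans
        (by simp)
      have : min T t ≤ s := hs.1
      exact absurd hs'.2 (not_le.2 ((lt_min hb h').trans_le this))
  refine ⟨fun t => ∫ s in (0 : ℝ)..t, ψ s, ?_, HasCompactSupport.of_support_subset_isCompact isCompact_Icc
    ((subset_tsupport _).trans hsupp), hsupp.trans fun x hx => ⟨ha.trans_le hx.1, hx.2.trans_lt hb⟩,
    hderiv⟩
  rw [contDiff_infty_iff_deriv, hderiv]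
  exact ⟨fun t => (hder t).differentiableAt, h1⟩

/-- The du Bois-Reymond lemma for continuous functions. -/
lemma eqOn_const_of_integral_deriv_mul_eq_zero {h : ℝ → ℝ} (hT : 0 < T)
    (hc : ContinuousOn h (Icc 0 T))
    (hθ : ∀ θ : ℝ → ℝ, ContDiff ℝ ∞ θ → HasCompactSupport θ → tsupport θ ⊆ Ioo 0 T →
      ∫ t in Ioo 0 T, deriv θ t * h t = 0) : ∀ t ∈ Icc 0 T, h t = h 0 := by
  -- Any nonnegative bump in (0, T) with positive integral serves; η(T/2) = 1 ensures positivity.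
  obtain ⟨η, hη1, hη2, hη3, hη4, hη5⟩ := exists_contDiff_tsupport_subset (n := ⊤)
    (Ioo_mem_nhds (half_pos hT) (half_lt_self hT))
  have hηi : IntervalIntegrable η volume 0 T := hη3.continuous.intervalIntegrable _ _
  have hpos : 0 < ∫ s in (0 : ℝ)..T, η s := by
    refine intervalIntegral.integral_pos hT hη3.continuous.continuousOn
      (fun x _ => (hη4 (mem_range_self x)).1) ⟨T / 2, ⟨by linarith, by linarith⟩, by
        rw [hη5]; exact one_pos⟩
  set m := ∫ s in (0 : ℝ)..T, η s with hm
  have hii : ∀ ψ : ℝ → ℝ, Continuous ψ → IntegrableOn (fun t => ψ t * h t) (Ioo 0 T) :=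
    fun ψ hψ => ((hψ.continuousOn.mul hc).integrableOn_Icc).mono_set Ioo_subset_Icc_self
  set d := m⁻¹ * ∫ t in Ioo 0 T, η t * h t with hd
  have hae : ∀ᵐ t, t ∈ Ioo 0 T → h t - d = 0 := by
    refine isOpen_Ioo.ae_eq_zero_of_integral_contDiff_smul_eq_zero ?_ fun ψ hψ1 hψ2 hψ3 => ?_
    · exact (((hc.sub continuousOn_const).integrableOn_Icc).mono_set
        Ioo_subset_Icc_self).locallyIntegrableOn
    -- With this c the function ψ - c η has integral zero, hence is θ' for a test function θ; the
    -- hypothesis then says ∫ψ h = d ∫ψ.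
    set c := (∫ s in (0 : ℝ)..T, ψ s) * m⁻¹ with hcdef
    have hχ : ContDiff ℝ ∞ (fun s => ψ s - c * η s) := hψ1.sub (contDiff_const.mul hη3)
    have hsub : tsupport (fun s => ψ s - c * η s) ⊆ tsupport ψ ∪ tsupport η := by
      refine closure_minimal (fun x hx => ?_) ((isClosed_tsupport _).union (isClosed_tsupport _))
      by_contra hn
      rw [mem_union, not_or] at hn
      refine hx ?_
      beta_reduce
      rw [image_eq_zero_of_notMem_tsupport hn.1, image_eq_zero_of_notMem_tsupport hn.2]
      simp
    obtain ⟨θ, hθ1, hθ2, hθ3, hθ4⟩ := exists_primitive_of_integral_eq_zero hχ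
      (HasCompactSupport.of_support_subset_isCompact (hψ2.isCompact.union hη2.isCompact)
        ((subset_tsupport _).trans hsub)) (hsub.trans (union_subset hψ3 hη1)) (by
        rw [intervalIntegral.integral_sub (hψ1.continuous.intervalIntegrable _ _)
          (hηi.const_mul c), intervalIntegral.integral_const_mul, hcdef, ← hm]
        field_simp
        ring)
    have h1 := hθ θ hθ1 hθ2 hθ3
    rw [hθ4] at h1
    have h2 : ∫ t in Ioo 0 T, (ψ t - c * η t) * h t
        = (∫ t in Ioo 0 T, ψ t * h t) - c * ∫ t in Ioo 0 T, η t * h t := by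
      rw [← integral_const_mul, ← integral_sub (hii ψ hψ1.continuous)
        ((hii η hη3.continuous).const_mul c)]
      congr 1
      ext t
      ring
    have hψi : IntegrableOn ψ (Ioo 0 T) :=
      (hψ1.continuous.integrableOn_Icc).mono_set Ioo_subset_Icc_self
    have h3 : ∫ t, ψ t • (h t - d) = ∫ t in Ioo 0 T, ψ t * (h t - d) := by
      rw [← integral_indicator measurableSet_Ioo]
      congr 1
      ext t
      by_cases ht : t ∈ Ioo 0 T
      · rw [indicator_of_mem ht, smul_eq_mul]
      · rw [indicator_of_notMem ht, image_eq_zero_of_notMem_tsupport fun h' => ht (hψ3 h'),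
          zero_smul]
    rw [h3]
    simp only [mul_sub]
    rw [integral_sub (hii ψ hψ1.continuous) (hψi.mul_const d), integral_mul_const]
    beta_reduce at h1
    rw [h2] at h1
    have h4 : ∫ t in Ioo 0 T, ψ t = ∫ s in (0 : ℝ)..T, ψ s := by
      rw [intervalIntegral.integral_of_le hT.le, restrict_Ioo_eq_restrict_Ioc]
    rw [h4, hd]
    rw [hcdef] at h1
    linarith
  have hEq : EqOn h (fun _ => d) (Icc 0 T) := by
    refine Measure.eqOn_Icc_of_ae_eq volume hT.ne ?_ hc continuousOn_const
    rw [← restrict_Ioo_eq_restrict_Icc]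
    rw [← ae_restrict_iff' measurableSet_Ioo] at hae
    filter_upwards [hae] with t ht
    linarith
  intro t ht
  rw [hEq ht, hEq ⟨le_rfl, hT.le⟩]

/-- G minus the primitive of g' annihilates every θ', so it is constant. Since g' is merely
integrable, the integration by parts is the one for absolutely continuous functions. -/
lemma HasW11Deriv.eq_add_integral {g g' G : ℝ → ℝ} (hT : 0 < T) (h : HasW11Deriv T g g')
    (hG : ContinuousOn G (Icc 0 T)) (hgG : ∀ᵐ t ∂(volume.restrict (Ioo 0 T)), G t = g t) :
    ∀ t ∈ Icc 0 T, G t = G 0 + ∫ s in (0 : ℝ)..t, g' s := by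
  have hg' : IntervalIntegrable g' volume 0 T :=
    (intervalIntegrable_iff_integrableOn_Ioo_of_le hT.le).2 h.integrable_deriv
  set P : ℝ → ℝ := fun t => ∫ s in (0 : ℝ)..t, g' s with hP
  have hPac : AbsolutelyContinuousOnInterval P 0 T :=
    hg'.absolutelyContinuousOnInterval_intervalIntegral left_mem_uIcc
  have hPc : ContinuousOn P (Icc 0 T) := by
    have := hPac.continuousOn
    rwa [uIcc_of_le hT.le] at this
  have hPd : ∀ᵐ t ∂(volume.restrict (Ioo 0 T)), deriv P t = g' t := by
    rw [ae_restrict_iff' measurableSet_Ioo]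
    filter_upwards [hg'.ae_hasDerivAt_integral] with t ht htT
    rw [uIcc_of_le hT.le] at ht
    exact (ht (Ioo_subset_Icc_self htT) 0 ⟨le_rfl, hT.le⟩).deriv
  have key := eqOn_const_of_integral_deriv_mul_eq_zero hT (hG.sub hPc) fun θ h1 h2 h3 => ?_
  · intro t ht
    have := key t ht
    simp only [Pi.sub_apply, hP, intervalIntegral.integral_same, sub_zero] at this
    linarith
  have hθac : AbsolutelyContinuousOnInterval θ 0 T :=
    (h1.contDiffOn.of_le (by simp)).absolutelyContinuousOnInterval
  have hz : ∀ x, x ∉ Ioo 0 T → θ x = 0 := fun x hx =>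
    image_eq_zero_of_notMem_tsupport fun h' => hx (h3 h')
  have hibp := hθac.integral_mul_deriv_eq_deriv_mul hPac
  rw [hz T (by simp), hz 0 (by simp), zero_mul, zero_mul, sub_self, zero_sub,
    intervalIntegral.integral_of_le hT.le, intervalIntegral.integral_of_le hT.le,
    ← restrict_Ioo_eq_restrict_Ioc] at hibp
  have hd : Continuous (deriv θ) := h1.continuous_deriv (by simp)
  have hi : ∀ F : ℝ → ℝ, ContinuousOn F (Icc 0 T) →
      IntegrableOn (fun t => deriv θ t * F t) (Ioo 0 T) := fun F hF =>
    ((hd.continuousOn.mul hF).integrableOn_Icc).mono_set Ioo_subset_Icc_self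
  simp only [Pi.sub_apply, mul_sub]
  rw [integral_sub (hi G hG) (hi P hPc)]
  have h4 : ∫ t in Ioo 0 T, deriv θ t * G t = ∫ t in Ioo 0 T, deriv θ t • g t :=
    integral_congr_ae (hgG.mono fun t ht => by simp only [ht, smul_eq_mul])
  have h5 : ∫ t in Ioo 0 T, θ t * deriv P t = ∫ t in Ioo 0 T, θ t • g' t :=
    integral_congr_ae (hPd.mono fun t ht => by simp only [ht, smul_eq_mul])
  rw [h4, h.integral_eq θ h1 h2 h3, ← h5, hibp]
  ring

lemma HasW11Deriv.eq_add_integral_of_continuousOn {H : Type*} [NormedAddCommGroup H]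
    [InnerProductSpace ℝ H] [CompleteSpace H] {g g' : ℝ → H} (hT : 0 < T)
    (h : HasW11Deriv T g g') (hg : ContinuousOn g (Icc 0 T)) :
    ∀ t ∈ Icc 0 T, g t = g 0 + ∫ s in (0 : ℝ)..t, g' s := by
  intro t ht
  have hg' : IntervalIntegrable g' volume 0 T :=
    (intervalIntegrable_iff_integrableOn_Ioo_of_le hT.le).2 h.integrable_deriv
  refine ext_inner_left ℝ fun v => ?_
  rw [inner_add_right, inner_intervalIntegral (intervalIntegrable_mono_right hg' ht)]
  exact (h.clm_comp (innerSL ℝ v)).eq_add_integral hT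
    ((innerSL ℝ v).continuous.comp_continuousOn hg) (Eventually.of_forall fun _ => rfl) t ht

end Weak

/-! ### Regularity of weak solutions, given the spectral decomposition -/

section Regularity

variable {Ω : Set Plane} (e : EigenSystem Ω)

/-- A series of nonnegative terms is the supremum of its finite sums, and each finite sum is the
squared norm of a spectral section. Estimates in D(A^r) are thus proved on finitely many modes,
where no domain question arises. -/
lemma EigenSystem.powNorm_le_iff {r : ℝ} {v : L2 Ω} {B : ℝ≥0∞} :
    e.powNorm r v ≤ B ↔ ∀ J : Finset ℕ, ‖powSection e.φ e.μ J r v‖ₑ ≤ B := by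
  rw [EigenSystem.powNorm, one_div, ENNReal.rpow_inv_le_iff two_pos, ENNReal.tsum_eq_iSup_sum,
    iSup_le_iff]
  refine forall_congr' fun J => ?_
  have h : ∑ j ∈ J, ENNReal.ofReal (e.μ j ^ (2 * r) * (inner ℝ (e.φ j) v) ^ 2)
      = ‖powSection e.φ e.μ J r v‖ₑ ^ (2 : ℝ) := by
    rw [← ENNReal.ofReal_sum_of_nonneg fun j _ => mul_nonneg
      (Real.rpow_nonneg (e.pos j).le _) (sq_nonneg _), ← ofReal_norm,
      ENNReal.ofReal_rpow_of_nonneg (norm_nonneg _) two_pos.le, Real.rpow_two, powSection,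
      norm_sq_sum_smul]
    congr 1
    refine Finset.sum_congr rfl fun j _ => ?_
    rw [mul_pow, mul_comm 2 r, Real.rpow_mul (e.pos j).le, Real.rpow_two]
  rw [h]
  exact ENNReal.rpow_le_rpow_iff two_pos

lemma EigenSystem.enorm_powSection_le {r : ℝ} (v : L2 Ω) (J : Finset ℕ) :
    ‖powSection e.φ e.μ J r v‖ₑ ≤ e.powNorm r v := e.powNorm_le_iff.1 le_rfl J

lemma EigenSystem.ae_norm_powSection_le {r t : ℝ} {g : ℝ → L2 Ω} (h : e.supNorm r t g ≠ ⊤)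
    (J : Finset ℕ) : ∀ᵐ s ∂(volume.restrict (Ioo 0 t)),
      ‖powSection e.φ e.μ J r (g s)‖ ≤ (e.supNorm r t g).toReal := by
  filter_upwards [ae_le_essSup (f := fun s => e.powNorm r (g s)) (μ := volume.restrict (Ioo 0 t))]
    with s hs
  rw [← toReal_enorm]
  exact ENNReal.toReal_mono h ((e.enorm_powSection_le (g s) J).trans hs)

variable {α T t ε : ℝ} (hα : 0 < α) (hα₁ : α < 1)

include hα hα₁

lemma EigenSystem.enorm_powSection_duhamel_le {f : ℝ → L2 Ω} {r : ℝ}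
    (hf : ContinuousOn f (Icc 0 T)) (ht : t ∈ Icc 0 T) (hε : ε ∈ Ioo (0 : ℝ) 1) {C : ℝ}
    (hC : max 1 (Real.Gamma α)⁻¹ * (2 / α) ≤ C) (J : Finset ℕ) :
    ‖powSection e.φ e.μ J (r + 1 - ε / 2) (duhamel e.φ e.μ α f t)‖ₑ
      ≤ ENNReal.ofReal (C * (ε⁻¹ * t ^ (α * ε / 2))) * e.supNorm r t f := by
  rcases ht.1.eq_or_lt with rfl | ht0
  · simp [duhamel, powSection]
  have hε0 := hε.1
  have hC0 : 0 < C := lt_of_lt_of_le (by positivity) hC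
  have hx : 0 < ε⁻¹ * t ^ (α * ε / 2) := mul_pos (inv_pos.2 hε0) (Real.rpow_pos_of_pos ht0 _)
  -- With an infinite norm the right side is ∞ only because its other factor is nonzero; 0 · ∞ = 0,
  -- so t = 0 was treated before.
  by_cases hs : e.supNorm r t f = ⊤
  · rw [hs, ENNReal.mul_top (by simpa using mul_pos hC0 hx)]
    exact le_top
  have h1 := norm_powSection_duhamel_le hα hα₁ (fun j => (e.pos j).le) e.pos hf ⟨ht0, ht.2⟩ hε J
    (e.ae_norm_powSection_le hs J)
  rw [← ofReal_norm, ← ENNReal.ofReal_toReal hs, ← ENNReal.ofReal_mul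
    (mul_pos hC0 hx).le]
  refine ENNReal.ofReal_le_ofReal (h1.trans ?_)
  exact mul_le_mul_of_nonneg_right (mul_le_mul_of_nonneg_right hC hx.le) ENNReal.toReal_nonneg

lemma EigenSystem.powNorm_duhamel_le {f : ℝ → L2 Ω} {r : ℝ}
    (hf : ContinuousOn f (Icc 0 T)) (ht : t ∈ Icc 0 T) (hε : ε ∈ Ioo (0 : ℝ) 1) {C : ℝ}
    (hC : max 1 (Real.Gamma α)⁻¹ * (2 / α) ≤ C) :
    e.powNorm (r + 1 - ε / 2) (duhamel e.φ e.μ α f t)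
      ≤ ENNReal.ofReal (C * (ε⁻¹ * t ^ (α * ε / 2))) * e.supNorm r t f :=
  e.powNorm_le_iff.2 (e.enorm_powSection_duhamel_le hα hα₁ hf ht hε hC)

lemma EigenSystem.powNorm_solDeriv_le {f f₁ : ℝ → L2 Ω} {r : ℝ}
    (hf₁ : ContinuousOn f₁ (Icc 0 T)) (ht : t ∈ Ioc 0 T) (hε : ε ∈ Ioo (0 : ℝ) 1) {C : ℝ}
    (hC : max 1 (Real.Gamma α)⁻¹ * (2 / α) ≤ C) (hC' : max 1 (Real.Gamma α)⁻¹ ≤ C) :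
    e.powNorm (r + 1 - ε / 2) (solDeriv e.φ e.μ α f f₁ t)
      ≤ ENNReal.ofReal (C * (ε⁻¹ * t ^ (α * ε / 2))) * e.supNorm r t f₁
        + ENNReal.ofReal (C * t ^ (-1 + α * ε / 2)) * e.powNorm r (f 0) := by
  refine e.powNorm_le_iff.2 fun J => ?_
  rw [solDeriv, powSection_add, add_comm]
  refine (enorm_add_le _ _).trans (add_le_add
    (e.enorm_powSection_duhamel_le hα hα₁ hf₁ (Ioc_subset_Icc_self ht) hε hC J) ?_)
  have h1 := norm_powSection_evol_le (φ := e.φ) hα hα₁ (fun j => (e.pos j).le) e.pos ht.1 hε J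
    (f 0) (r := r)
  have hp : 0 ≤ t ^ (-1 + α * ε / 2) := Real.rpow_nonneg ht.1.le _
  refine le_trans ?_ (mul_le_mul_right (e.enorm_powSection_le (f 0) J) _)
  rw [← ofReal_norm, ← ofReal_norm, ← ENNReal.ofReal_mul
    (mul_nonneg ((by positivity : (0 : ℝ) ≤ max 1 (Real.Gamma α)⁻¹).trans hC') hp)]
  refine ENNReal.ofReal_le_ofReal (h1.trans ?_)
  gcongr

lemma EigenSystem.enorm_caputo_le {f f₁ f₂ : ℝ → L2 Ω} (hf : ContinuousOn f (Icc 0 T))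
    (hf₁ : ContinuousOn f₁ (Icc 0 T)) (hf₂ : IntervalIntegrable f₂ volume 0 T)
    (hff₁ : ∀ t ∈ Icc 0 T, f t = f 0 + ∫ s in (0 : ℝ)..t, f₁ s)
    (hf₁f₂ : ∀ t ∈ Icc 0 T, f₁ t = f₁ 0 + ∫ s in (0 : ℝ)..t, f₂ s) (ht : t ∈ Icc 0 T)
    (hε : ε ∈ Ioo (0 : ℝ) 1) {C : ℝ} (hC : max 1 (Real.Gamma α)⁻¹ * (2 / α) ≤ C) (hC₁ : 1 ≤ C) :
    ‖caputo α (solDeriv e.φ e.μ α f f₁) t‖ₑ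
      ≤ ENNReal.ofReal (C * (ε⁻¹ * t ^ (α * ε / 2))) * e.supNorm (ε / 2) t f
        + ENNReal.ofReal (C * ‖f t‖) := by
  rcases ht.1.eq_or_lt with rfl | ht0
  · simp [caputo, rlIntegral]
  have hε0 := hε.1
  have hC0 : 0 < C := one_pos.trans_le hC₁
  have hx : 0 < ε⁻¹ * t ^ (α * ε / 2) := mul_pos (inv_pos.2 hε0) (Real.rpow_pos_of_pos ht0 _)
  by_cases hs : e.supNorm (ε / 2) t f = ⊤
  · rw [hs, ENNReal.mul_top (by simpa using mul_pos hC0 hx), top_add]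
    exact le_top
  have hsec : ∀ J, ‖powSection e.φ e.μ J 0 (caputo α (solDeriv e.φ e.μ α f f₁) t)‖
      ≤ C * (ε⁻¹ * t ^ (α * ε / 2)) * (e.supNorm (ε / 2) t f).toReal + C * ‖f t‖ := by
    intro J
    have h1 := norm_powSection_duhamel_le hα hα₁ (fun j => (e.pos j).le) e.pos hf ⟨ht0, ht.2⟩ hε J
      (e.ae_norm_powSection_le hs J)
    -- The choice r = ε/2 makes the gained exponent exactly 1, so h1 bounds A u in ∂ₜ^α u = f - A u.
    rw [show ε / 2 + 1 - ε / 2 = 1 by ring] at h1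
    have h2 : powSection e.φ e.μ J 0 (caputo α (solDeriv e.φ e.μ α f f₁) t)
        = powSection e.φ e.μ J 0 (f t) - powSection e.φ e.μ J 1 (duhamel e.φ e.μ α f t) := by
      simp only [powSection, ← Finset.sum_sub_distrib, ← sub_smul, Real.rpow_zero, one_mul,
        Real.rpow_one]
      refine Finset.sum_congr rfl fun j _ => ?_
      rw [inner_caputo_solDeriv hα hα₁ (fun j => (e.pos j).le) hf hf₁ hf₂ hff₁ hf₁f₂ ⟨ht0, ht.2⟩]
    rw [h2, add_comm]
    refine (norm_sub_le _ _).trans (add_le_add ((norm_powSection_zero_le J (f t)).trans ?_)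
      (h1.trans ?_))
    · exact le_mul_of_one_le_left (norm_nonneg _) hC₁
    · exact mul_le_mul_of_nonneg_right (mul_le_mul_of_nonneg_right hC hx.le)
        ENNReal.toReal_nonneg
  rw [← ofReal_norm, ← ENNReal.ofReal_toReal hs,
    ← ENNReal.ofReal_mul (mul_pos hC0 hx).le, ← ENNReal.ofReal_add
    (mul_nonneg (mul_pos hC0 hx).le ENNReal.toReal_nonneg) (by positivity)]
  exact ENNReal.ofReal_le_ofReal (norm_le_of_powSection_zero hsec)

/-- Weak solutions are given by Duhamel's formula. -/
lemma EigenSystem.ae_duhamel_eq_of_isWeakSolution (hT : 0 < T)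
    (heig : ∀ j, ∃ v : H20 Ω, H20.toL2 Ω v = e.φ j ∧
      ∀ w : H20 Ω, aForm w v = e.μ j * inner ℝ (e.φ j) (H20.toL2 Ω w))
    {f : ℝ → L2 Ω} (hf : ContinuousOn f (Icc 0 T)) {u : ℝ → H20 Ω}
    (hu : IsWeakSolution α T (fun t => toDual (f t)) 0 u) :
    ∀ᵐ t ∂(volume.restrict (Ioo 0 T)), duhamel e.φ e.μ α f t = H20.toL2 Ω (u t) := by
  obtain ⟨hui, u', hW, heq, U, hUc, hUu, hU0⟩ := hu
  -- Evaluating functionals at the eigenfunction v turns the weak equation into the scalar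
  -- relaxation equation with l = μⱼ. The null set may depend on j, as there are countably many j.
  have hcoef : ∀ j, ∀ᵐ t ∂(volume.restrict (Ioo 0 T)),
      inner ℝ (e.φ j) (H20.toL2 Ω (u t)) = inner ℝ (e.φ j) (duhamel e.φ e.μ α f t) := by
    intro j
    obtain ⟨v, hv, hav⟩ := heig j
    set ev : H20Dual Ω →L[ℝ] ℝ := ContinuousLinearMap.apply ℝ ℝ v with hev
    have hevd : ∀ x : L2 Ω, ev (toDual x) = inner ℝ (e.φ j) x := fun x => by
      rw [hev, ContinuousLinearMap.apply_apply, toDual, ContinuousLinearMap.comp_apply, hv,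
        innerSL_apply_apply, real_inner_comm]
    have hWj := hW.clm_comp ev
    have hUj : ContinuousOn (fun t => ev (U t)) (Icc 0 T) := ev.continuous.comp_continuousOn hUc
    have hUuj : ∀ᵐ t ∂(volume.restrict (Ioo 0 T)),
        ev (U t) = ev (toDual (H20.toL2 Ω (u t))) := hUu.mono fun t ht => by rw [ht]
    -- The initial condition is a limit from the right; continuity of U at 0 within [0, T]
    -- identifies that limit with U 0.
    have hU00 : U 0 = 0 := by
      have h1 : Tendsto U (𝓝[>] 0) (𝓝 (U 0)) :=
        (hUc 0 ⟨le_rfl, hT.le⟩).mono_left (by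
          rw [nhdsWithin_le_iff]
          filter_upwards [Ioo_mem_nhdsGT hT] with x hx
          exact Ioo_subset_Icc_self hx)
      have h2 : Tendsto U (𝓝[>] 0) (𝓝 0) := by
        rw [tendsto_zero_iff_norm_tendsto_zero]
        simpa [toDual] using hU0
      exact tendsto_nhds_unique h1 h2
    have hprim := hWj.eq_add_integral hT hUj hUuj
    have hwi : IntervalIntegrable (fun t => ev (u' t)) volume 0 T :=
      (intervalIntegrable_iff_integrableOn_Ioo_of_le hT.le).2 hWj.integrable_deriv
    have hgi : IntervalIntegrable (fun t => inner ℝ (e.φ j) (f t)) volume 0 T :=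
      intervalIntegrable_coeff (hf.intervalIntegrable_of_Icc hT.le) (e.φ j)
    have huniq := relaxation_unique (l := e.μ j) hα hα₁ hT (w := fun t => ev (U t)) hwi hgi
      (fun t ht => by
        rw [hprim t (Ioo_subset_Icc_self ht), hU00, map_zero, zero_add]) (by
        filter_upwards [heq v, hUuj] with t h1 h2
        rw [h2, hevd]
        have h3 : toDual (f t) v = inner ℝ (e.φ j) (f t) := hevd (f t)
        rw [hav, h3] at h1
        exact h1)
    filter_upwards [huniq, hUuj, ae_restrict_mem measurableSet_Ioo] with t h1 h2 ht
    rw [inner_duhamel_of_continuousOn hα hα₁ (fun j => (e.pos j).le) hf (Ioo_subset_Icc_self ht),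
      ← h1, h2, hevd]
  filter_upwards [ae_all_iff.2 hcoef] with t ht
  exact hilbertBasis_ext e.φ fun j => (ht j).symm

end Regularity

/-! ### Test functions -/

section Test

variable {Ω : Set Plane} {φ ψ : Plane → ℝ}

lemma IsTest.continuous (h : IsTest Ω φ) : Continuous φ := h.1.continuous

lemma IsTest.differentiable (h : IsTest Ω φ) : Differentiable ℝ φ := h.1.differentiable (by simp)

lemma IsTest.eq_zero (h : IsTest Ω φ) {x : Plane} (hx : x ∉ Ω) : φ x = 0 :=
  image_eq_zero_of_notMem_tsupport fun h' => hx (h.2.2 h')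

lemma tsupport_partialD_subset (i : Fin 2) : tsupport (partialD i φ) ⊆ tsupport φ := by
  refine closure_minimal (fun x hx => ?_) (isClosed_tsupport φ)
  refine support_fderiv_subset ℝ (fun h => hx ?_)
  rw [partialD, h]
  simp

lemma IsTest.partialD (h : IsTest Ω φ) (i : Fin 2) : IsTest Ω (partialD i φ) :=
  ⟨(h.1.fderiv_right (m := ∞) (by simp)).clm_apply contDiff_const,
    h.2.1.mono' (subset_closure.trans (tsupport_partialD_subset i)),
    (tsupport_partialD_subset i).trans h.2.2⟩

lemma IsTest.add (hφ : IsTest Ω φ) (hψ : IsTest Ω ψ) : IsTest Ω (φ + ψ) :=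
  ⟨hφ.1.add hψ.1, hφ.2.1.add hψ.2.1,
    (tsupport_add φ ψ).trans (union_subset hφ.2.2 hψ.2.2)⟩

lemma IsTest.const_smul (hφ : IsTest Ω φ) (c : ℝ) : IsTest Ω (c • φ) :=
  ⟨hφ.1.const_smul c, hφ.2.1.smul_left (f := fun _ => c),
    (tsupport_smul_subset_right (fun _ => c) φ).trans hφ.2.2⟩

lemma isTest_zero : IsTest Ω (0 : Plane → ℝ) :=
  ⟨contDiff_const, HasCompactSupport.zero, by simp [tsupport]⟩

lemma partialD_add (i : Fin 2) (hφ : Differentiable ℝ φ) (hψ : Differentiable ℝ ψ) :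
    partialD i (φ + ψ) = partialD i φ + partialD i ψ := by
  ext x
  simp only [partialD, Pi.add_apply]
  rw [fderiv_add (hφ x) (hψ x)]
  rfl

lemma partialD_const_smul (i : Fin 2) (hφ : Differentiable ℝ φ) (c : ℝ) :
    partialD i (c • φ) = c • partialD i φ := by
  ext x
  simp only [partialD, Pi.smul_apply]
  rw [fderiv_const_smul (hφ x)]
  rfl

lemma partialD_zero (i : Fin 2) : partialD i (0 : Plane → ℝ) = 0 := by
  ext x
  simp [partialD]

lemma IsTest.partialD_partialD_apply (h : IsTest Ω φ) (i j : Fin 2) (x : Plane) :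
    TimeFracBiharmonic.partialD j (TimeFracBiharmonic.partialD i φ) x
      = fderiv ℝ (fderiv ℝ φ) x (EuclideanSpace.single j 1) (EuclideanSpace.single i 1) := by
  have hd : DifferentiableAt ℝ (fderiv ℝ φ) x :=
    (h.1.fderiv_right (m := ∞) (by simp)).differentiable (by simp) x
  rw [TimeFracBiharmonic.partialD]
  unfold TimeFracBiharmonic.partialD
  rw [fderiv_clm_apply hd (differentiableAt_const _)]
  simp

lemma IsTest.partialD_comm (h : IsTest Ω φ) (i j : Fin 2) :
    TimeFracBiharmonic.partialD j (TimeFracBiharmonic.partialD i φ)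
      = TimeFracBiharmonic.partialD i (TimeFracBiharmonic.partialD j φ) := by
  ext x
  rw [h.partialD_partialD_apply, h.partialD_partialD_apply]
  have h2 : minSmoothness ℝ 2 ≤ ((⊤ : ℕ∞) : WithTop ℕ∞) := by
    rw [minSmoothness_of_isRCLikeNormedField]
    exact WithTop.coe_le_coe.2 le_top
  exact (h.1.contDiffAt.isSymmSndFDerivAt h2) _ _

lemma IsTest.laplacian_eq (h : IsTest Ω φ) :
    Laplacian.laplacian φ = fun x => ∑ i, TimeFracBiharmonic.partialD i
      (TimeFracBiharmonic.partialD i φ) x := by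
  rw [InnerProductSpace.laplacian_eq_iteratedFDeriv_orthonormalBasis φ (EuclideanSpace.basisFun (Fin 2) ℝ)]
  ext x
  refine Finset.sum_congr rfl fun i _ => ?_
  rw [iteratedFDeriv_two_apply, h.partialD_partialD_apply]
  simp

lemma IsTest.laplacian (h : IsTest Ω φ) : IsTest Ω (Laplacian.laplacian φ) := by
  have h1 : Laplacian.laplacian φ = TimeFracBiharmonic.partialD 0 (TimeFracBiharmonic.partialD 0 φ)
      + TimeFracBiharmonic.partialD 1 (TimeFracBiharmonic.partialD 1 φ) := by
    rw [h.laplacian_eq]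
    ext x
    simp [Fin.sum_univ_two]
  rw [h1]
  exact ((h.partialD 0).partialD 0).add ((h.partialD 1).partialD 1)

lemma IsTest.mul_integrable (hφ : IsTest Ω φ) (hψ : Continuous ψ) :
    Integrable fun x => φ x * ψ x :=
  (hφ.continuous.mul hψ).integrable_of_hasCompactSupport hφ.2.1.mul_right

lemma IsTest.integral_mul_partialD (hφ : IsTest Ω φ) (hψ : IsTest Ω ψ) (i : Fin 2) :
    ∫ x, φ x * TimeFracBiharmonic.partialD i ψ x
      = - ∫ x, TimeFracBiharmonic.partialD i φ x * ψ x :=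
  integral_mul_fderiv_eq_neg_fderiv_mul_of_integrable
    ((hφ.partialD i).mul_integrable hψ.continuous) (hφ.mul_integrable (hψ.partialD i).continuous)
    (hφ.mul_integrable hψ.continuous) (fun x _ => hφ.differentiable x)
    (fun x _ => hψ.differentiable x)

lemma IsTest.setIntegral_mul (hφ : IsTest Ω φ) (F : Plane → ℝ) (hΩ : MeasurableSet Ω) :
    ∫ x in Ω, F x * φ x = ∫ x, F x * φ x := by
  rw [← integral_indicator hΩ]
  congr 1
  ext x
  by_cases hx : x ∈ Ω
  · rw [indicator_of_mem hx]
  · rw [indicator_of_notMem hx, hφ.eq_zero hx, mul_zero]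

/-- `∫ D²φ : D²ψ = ∫ φ Δ²ψ`. -/
lemma IsTest.integral_hess_mul_hess (hφ : IsTest Ω φ) (hψ : IsTest Ω ψ) :
    ∑ i, ∑ j, ∫ x, TimeFracBiharmonic.partialD j (TimeFracBiharmonic.partialD i φ) x
        * TimeFracBiharmonic.partialD j (TimeFracBiharmonic.partialD i ψ) x
      = ∫ x, φ x * Laplacian.laplacian (Laplacian.laplacian ψ) x := by
  have hterm : ∀ i j, ∫ x, TimeFracBiharmonic.partialD j (TimeFracBiharmonic.partialD i φ) x
        * TimeFracBiharmonic.partialD j (TimeFracBiharmonic.partialD i ψ) x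
      = ∫ x, φ x * TimeFracBiharmonic.partialD i (TimeFracBiharmonic.partialD i
        (TimeFracBiharmonic.partialD j (TimeFracBiharmonic.partialD j ψ))) x := fun i j => by
    -- Two integrations by parts, whose signs cancel; commuting the derivatives of ψ then brings
    -- them into the order of Δ²ψ.
    have h1 := (hφ.partialD i).integral_mul_partialD (((hψ.partialD i).partialD j)) j
    have h2 := hφ.integral_mul_partialD (((hψ.partialD i).partialD j).partialD j) i
    have h3 : TimeFracBiharmonic.partialD j (TimeFracBiharmonic.partialD j
        (TimeFracBiharmonic.partialD i ψ)) = TimeFracBiharmonic.partialD i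
        (TimeFracBiharmonic.partialD j (TimeFracBiharmonic.partialD j ψ)) := by
      rw [hψ.partialD_comm i j, (hψ.partialD j).partialD_comm i j]
    rw [h3] at h1 h2
    linarith
  have hlap : Laplacian.laplacian (Laplacian.laplacian ψ) = fun x => ∑ i, ∑ j,
      TimeFracBiharmonic.partialD i (TimeFracBiharmonic.partialD i
        (TimeFracBiharmonic.partialD j (TimeFracBiharmonic.partialD j ψ))) x := by
    rw [hψ.laplacian.laplacian_eq]
    have h1 : Laplacian.laplacian ψ
        = TimeFracBiharmonic.partialD 0 (TimeFracBiharmonic.partialD 0 ψ)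
        + TimeFracBiharmonic.partialD 1 (TimeFracBiharmonic.partialD 1 ψ) := by
      rw [hψ.laplacian_eq]
      ext x
      simp [Fin.sum_univ_two]
    ext x
    refine Finset.sum_congr rfl fun i _ => ?_
    have t0 := (hψ.partialD 0).partialD 0
    have t1 := (hψ.partialD 1).partialD 1
    rw [h1, partialD_add i t0.differentiable t1.differentiable,
      partialD_add i (t0.partialD i).differentiable (t1.partialD i).differentiable,
      Fin.sum_univ_two]
    rfl
  simp only [hterm, hlap, Finset.mul_sum]
  rw [integral_finsetSum _ fun i _ => integrable_finsetSum _ fun j _ => hφ.mul_integrable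
    ((((hψ.partialD j).partialD j).partialD i).partialD i).continuous]
  refine Finset.sum_congr rfl fun i _ => ?_
  rw [integral_finsetSum _ fun j _ => hφ.mul_integrable
    ((((hψ.partialD j).partialD j).partialD i).partialD i).continuous]

lemma IsTest.memLp (hφ : IsTest Ω φ) : MemLp φ 2 (volume.restrict Ω) :=
  (hφ.continuous.memLp_of_hasCompactSupport hφ.2.1).restrict Ω

/-! ### Test functions as elements of `H²₀(Ω)` -/

/-- The class of a test function in `L²(Ω)`. -/
noncomputable def IsTest.toLp (hφ : IsTest Ω φ) : L2 Ω := hφ.memLp.toLp φ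

lemma IsTest.coeFn_toLp (hφ : IsTest Ω φ) : (hφ.toLp : Plane → ℝ) =ᵐ[volume.restrict Ω] φ :=
  hφ.memLp.coeFn_toLp

/-- The entries of the jet of a test function. -/
noncomputable def IsTest.jetEntry (hφ : IsTest Ω φ) : JetIdx → L2 Ω
  | Sum.inl _ => hφ.toLp
  | Sum.inr (Sum.inl i) => (hφ.partialD i).toLp
  | Sum.inr (Sum.inr p) => ((hφ.partialD p.1).partialD p.2).toLp

lemma IsTest.jet_mem (hφ : IsTest Ω φ) : WithLp.toLp 2 hφ.jetEntry ∈ testJets Ω :=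
  ⟨φ, hφ, hφ.coeFn_toLp, fun i => (hφ.partialD i).coeFn_toLp,
    fun i j => ((hφ.partialD i).partialD j).coeFn_toLp⟩

/-- A test function as an element of `H²₀(Ω)`. -/
noncomputable def IsTest.toH20 (hφ : IsTest Ω φ) : H20 Ω :=
  ⟨WithLp.toLp 2 hφ.jetEntry, Submodule.le_topologicalClosure _ (Submodule.subset_span hφ.jet_mem)⟩

lemma IsTest.toL2_toH20 (hφ : IsTest Ω φ) : H20.toL2 Ω hφ.toH20 = hφ.toLp := rfl

lemma IsTest.hess_toH20 (hφ : IsTest Ω φ) (i j : Fin 2) :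
    hφ.toH20.hess i j = ((hφ.partialD i).partialD j).toLp := rfl

/-- Sums and multiples of test jets are test jets, so taking the span adds nothing. Density of the
span is therefore density of the test functions. -/
lemma exists_isTest_of_mem_span {J : H2Jet Ω} (hJ : J ∈ Submodule.span ℝ (testJets Ω)) :
    ∃ φ, ∃ hφ : IsTest Ω φ, J = WithLp.toLp 2 hφ.jetEntry := by
  have hof : ∀ J ∈ testJets Ω, ∃ φ, ∃ hφ : IsTest Ω φ, J = WithLp.toLp 2 hφ.jetEntry := by
    rintro J ⟨φ, hφ, h0, h1, h2⟩
    refine ⟨φ, hφ, ?_⟩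
    ext1 k
    apply Lp.ext
    rcases k with k | k | k
    · exact h0.trans hφ.coeFn_toLp.symm
    · exact (h1 k).trans (hφ.partialD k).coeFn_toLp.symm
    · exact (h2 k.1 k.2).trans ((hφ.partialD k.1).partialD k.2).coeFn_toLp.symm
  refine Submodule.span_induction (p := fun J _ => ∃ φ, ∃ hφ : IsTest Ω φ,
    J = WithLp.toLp 2 hφ.jetEntry) (fun J hJ => hof J hJ) ?_ ?_ ?_ hJ
  · refine hof 0 ⟨0, isTest_zero, Lp.coeFn_zero _ _ _, fun i => ?_, fun i j => ?_⟩
    · rw [partialD_zero]; exact Lp.coeFn_zero _ _ _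
    · rw [partialD_zero, partialD_zero]; exact Lp.coeFn_zero _ _ _
  · rintro _ _ _ _ ⟨φ, hφ, rfl⟩ ⟨ψ, hψ, rfl⟩
    refine hof _ ⟨φ + ψ, hφ.add hψ, ?_, fun i => ?_, fun i j => ?_⟩
    · exact (Lp.coeFn_add _ _).trans (hφ.coeFn_toLp.add hψ.coeFn_toLp)
    · rw [partialD_add i hφ.differentiable hψ.differentiable]
      exact (Lp.coeFn_add _ _).trans ((hφ.partialD i).coeFn_toLp.add (hψ.partialD i).coeFn_toLp)
    · rw [partialD_add i hφ.differentiable hψ.differentiable,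
        partialD_add j (hφ.partialD i).differentiable (hψ.partialD i).differentiable]
      exact (Lp.coeFn_add _ _).trans
        (((hφ.partialD i).partialD j).coeFn_toLp.add ((hψ.partialD i).partialD j).coeFn_toLp)
  · rintro c _ _ ⟨φ, hφ, rfl⟩
    refine hof _ ⟨c • φ, hφ.const_smul c, ?_, fun i => ?_, fun i j => ?_⟩
    · exact (Lp.coeFn_smul _ _).trans (hφ.coeFn_toLp.const_smul c)
    · rw [partialD_const_smul i hφ.differentiable]
      exact (Lp.coeFn_smul _ _).trans ((hφ.partialD i).coeFn_toLp.const_smul c)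
    · rw [partialD_const_smul i hφ.differentiable,
        partialD_const_smul j (hφ.partialD i).differentiable]
      exact (Lp.coeFn_smul _ _).trans (((hφ.partialD i).partialD j).coeFn_toLp.const_smul c)

/-- Test functions are dense in `H²₀(Ω)`. -/
lemma dense_setOf_toH20 : Dense {v : H20 Ω | ∃ φ, ∃ hφ : IsTest Ω φ, v = hφ.toH20} := by
  intro v
  have hv : v.1 ∈ closure ((Submodule.span ℝ (testJets Ω) : Submodule ℝ (H2Jet Ω)) : Set (H2Jet Ω)) :=
    v.2
  refine closure_subtype.2 (closure_mono ?_ hv)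
  intro J hJ
  obtain ⟨φ, hφ, rfl⟩ := exists_isTest_of_mem_span hJ
  exact ⟨hφ.toH20, ⟨φ, hφ, rfl⟩, rfl⟩

lemma H20.induction {p : H20 Ω → Prop} (hp : IsClosed {v | p v})
    (h : ∀ φ (hφ : IsTest Ω φ), p hφ.toH20) (v : H20 Ω) : p v := by
  refine dense_setOf_toH20.induction (P := p) ?_ hp v
  rintro _ ⟨φ, hφ, rfl⟩
  exact h φ hφ

lemma H20.continuous_hess (i j : Fin 2) : Continuous fun v : H20 Ω => v.hess i j :=
  ((PiLp.proj 2 (fun _ : JetIdx => L2 Ω) (Sum.inr (Sum.inr (i, j)))).comp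
    (H20.jet Ω)).continuous

lemma IsTest.inner_toLp (hφ : IsTest Ω φ) (g : L2 Ω) :
    inner ℝ g hφ.toLp = ∫ x in Ω, g x * φ x := by
  rw [L2.inner_def]
  refine integral_congr_ae (hφ.coeFn_toLp.mono fun x hx => ?_)
  simp only [hx, RCLike.inner_apply, conj_trivial, mul_comm]

lemma IsTest.inner_toLp_toLp (hφ : IsTest Ω φ) (hψ : IsTest Ω ψ) (hΩ : MeasurableSet Ω) :
    inner ℝ hφ.toLp hψ.toLp = ∫ x, φ x * ψ x := by
  rw [hψ.inner_toLp, ← hψ.setIntegral_mul _ hΩ]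
  exact integral_congr_ae (hφ.coeFn_toLp.mono fun x hx => by simp only [hx])

lemma continuous_aForm_left (w : H20 Ω) : Continuous fun v : H20 Ω => aForm v w :=
  continuous_finsetSum _ fun i _ => continuous_finsetSum _ fun j _ =>
    (H20.continuous_hess i j).inner continuous_const

lemma aForm_comm (v w : H20 Ω) : aForm v w = aForm w v := by
  simp only [aForm, real_inner_comm]

/-- Green's formula. -/
lemma aForm_toH20 (hΩ : MeasurableSet Ω) (v : H20 Ω) (hψ : IsTest Ω ψ) :
    aForm v hψ.toH20 = ∫ x in Ω, H20.toL2 Ω v x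
      * Laplacian.laplacian (Laplacian.laplacian ψ) x := by
  rw [← hψ.laplacian.laplacian.inner_toLp]
  refine H20.induction (p := fun v => aForm v hψ.toH20
    = inner ℝ (H20.toL2 Ω v) hψ.laplacian.laplacian.toLp)
    (isClosed_eq (continuous_aForm_left _) ((H20.toL2 Ω).continuous.inner continuous_const))
    (fun φ hφ => ?_) v
  rw [hφ.toL2_toH20, hφ.inner_toLp_toLp hψ.laplacian.laplacian hΩ,
    ← hφ.integral_hess_mul_hess hψ]
  refine Finset.sum_congr rfl fun i _ => Finset.sum_congr rfl fun j _ => ?_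
  rw [hφ.hess_toH20, hψ.hess_toH20, IsTest.inner_toLp_toLp _ _ hΩ]

/-- The weak form of `A v = g`. -/
lemma hasBilaplacian_iff (hΩ : MeasurableSet Ω) {v : H20 Ω} {g : L2 Ω} :
    HasBilaplacian v g ↔ ∀ w : H20 Ω, aForm w v = inner ℝ g (H20.toL2 Ω w) := by
  refine ⟨fun h w => ?_, fun h ψ hψ => ?_⟩
  · refine H20.induction (p := fun w => aForm w v = inner ℝ g (H20.toL2 Ω w))
      (isClosed_eq (continuous_aForm_left _) (continuous_const.inner (H20.toL2 Ω).continuous))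
      (fun ψ hψ => ?_) w
    rw [aForm_comm, aForm_toH20 hΩ, hψ.toL2_toH20, hψ.inner_toLp]
    exact h ψ hψ
  · rw [← aForm_toH20 hΩ v hψ, ← hψ.inner_toLp, ← hψ.toL2_toH20, aForm_comm]
    exact h _

end Test

/-! ### The mixed second derivative controls test functions in the plane -/

/-- Cauchy-Schwarz by the discriminant: ∫(|G| - l)² ≥ 0 for all l, evaluated at l = I/V. -/
lemma sq_setIntegral_abs_le {X : Type*} [MeasurableSpace X] {ν : Measure X} {S : Set X}
    (hS : ν S ≠ ⊤) {G : X → ℝ} (hG : IntegrableOn G S ν) (hG2 : IntegrableOn (fun x => G x ^ 2) S ν) :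
    (∫ x in S, |G x| ∂ν) ^ 2 ≤ ν.real S * ∫ x in S, G x ^ 2 ∂ν := by
  set I := ∫ x in S, |G x| ∂ν with hI
  set V := ν.real S with hV
  have hquad : ∀ l : ℝ, 0 ≤ (∫ x in S, G x ^ 2 ∂ν) - 2 * l * I + l ^ 2 * V := by
    intro l
    have hc : IntegrableOn (fun _ : X => l ^ 2) S ν := integrableOn_const hS
    have h1 : 0 ≤ ∫ x in S, (|G x| - l) ^ 2 ∂ν := integral_nonneg fun x => sq_nonneg _
    have h2 : ∫ x in S, (|G x| - l) ^ 2 ∂ν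
        = (∫ x in S, G x ^ 2 ∂ν) - 2 * l * I + l ^ 2 * V := by
      have h3 : ∀ x, (|G x| - l) ^ 2 = G x ^ 2 - 2 * l * |G x| + l ^ 2 := fun x => by
        rw [← sq_abs (G x)]; ring
      simp only [h3]
      have h4 : IntegrableOn (fun x => 2 * l * |G x|) S ν := hG.abs.const_mul _
      have h5 : IntegrableOn (fun x => G x ^ 2 - 2 * l * |G x|) S ν := hG2.sub h4
      rw [integral_add h5 hc, integral_sub hG2 h4, integral_const_mul,
        setIntegral_const, smul_eq_mul]
      ring
    rwa [h2] at h1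
  rcases eq_or_lt_of_le (measureReal_nonneg : 0 ≤ ν.real S) with h0 | hpos
  · have hz : ν S = 0 := (measureReal_eq_zero_iff hS).1 h0.symm
    have : I = 0 := by rw [hI, setIntegral_measure_zero _ hz]
    rw [this, hV, ← h0]
    simp
  · have h := hquad (I / V)
    rw [← hV] at hpos
    have h5 : (∫ x in S, G x ^ 2 ∂ν) - 2 * (I / V) * I + (I / V) ^ 2 * V
        = (∫ x in S, G x ^ 2 ∂ν) - I ^ 2 / V := by
      field_simp
      ring
    rw [h5, sub_nonneg, div_le_iff₀ hpos] at h
    linarith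

/-- F(a,b) - F(a',b) is the integral of D(s,b) over (a', a), and D(s,b) is the integral of G(s,·)
from -R, where D vanishes. So the increment is at most ∫|G| over a rectangle of area 2R(a - a'), and
Cauchy-Schwarz yields Hölder exponent 1/2. The functions are abstract so that the variables can be
exchanged. -/
lemma sq_sub_le_of_mixed_deriv {F D G : ℝ → ℝ → ℝ} {R a a' : ℝ} (hR : 0 < R) (ha : a' ≤ a)
    (hF : ∀ s b, HasDerivAt (fun s => F s b) (D s b) s)
    (hD : ∀ s b, HasDerivAt (fun b => D s b) (G s b) b)
    (hDc : ∀ b, Continuous fun s => D s b) (hG : Continuous fun p : ℝ × ℝ => G p.1 p.2)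
    (hD0 : ∀ s b, R ≤ |b| → D s b = 0)
    (hG2 : Integrable fun p : ℝ × ℝ => G p.1 p.2 ^ 2) (b : ℝ) :
    (F a b - F a' b) ^ 2 ≤ 2 * R * (a - a') * ∫ p : ℝ × ℝ, G p.1 p.2 ^ 2 := by
  have hGs : ∀ s, Continuous fun r => |G s r| := fun s =>
    (hG.comp (by fun_prop : Continuous fun r : ℝ => (s, r))).abs
  have hDle : ∀ s b, |D s b| ≤ ∫ r in (-R)..R, |G s r| := by
    intro s b
    have hnn : 0 ≤ ∫ r in (-R)..R, |G s r| :=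
      intervalIntegral.integral_nonneg (by linarith) fun _ _ => abs_nonneg _
    rcases le_or_gt R |b| with h | h
    · rwa [hD0 s b h, abs_zero]
    · rw [abs_lt] at h
      have h1 : ∫ r in (-R)..b, G s r = D s b - D s (-R) :=
        intervalIntegral.integral_eq_sub_of_hasDerivAt (fun r _ => hD s r)
          ((hG.comp (by fun_prop : Continuous fun r => (s, r))).intervalIntegrable _ _)
      rw [hD0 s (-R) (by rw [abs_neg, abs_of_pos hR]), sub_zero] at h1
      rw [← h1]
      refine (intervalIntegral.abs_integral_le_integral_abs h.1.le).trans ?_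
      exact intervalIntegral.integral_mono_interval le_rfl h.1.le h.2.le
        (Eventually.of_forall fun _ => abs_nonneg _) ((hGs s).intervalIntegrable _ _)
  set S : Set (ℝ × ℝ) := Ioc a' a ×ˢ Ioc (-R) R with hS
  have hvol : (volume : Measure (ℝ × ℝ)).real S = 2 * R * (a - a') := by
    rw [hS, measureReal_def, Measure.volume_eq_prod, Measure.prod_prod, Real.volume_Ioc,
      Real.volume_Ioc, ENNReal.toReal_mul, ENNReal.toReal_ofReal (by linarith),
      ENNReal.toReal_ofReal (by linarith)]
    ring
  have hSfin : (volume : Measure (ℝ × ℝ)) S ≠ ⊤ := by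
    rw [hS, Measure.volume_eq_prod, Measure.prod_prod, Real.volume_Ioc, Real.volume_Ioc]
    exact ENNReal.mul_ne_top ENNReal.ofReal_ne_top ENNReal.ofReal_ne_top
  have hGi : IntegrableOn (fun p : ℝ × ℝ => G p.1 p.2) S :=
    (hG.continuousOn.integrableOn_compact (isCompact_Icc.prod isCompact_Icc)).mono_set
      (prod_mono Ioc_subset_Icc_self Ioc_subset_Icc_self)
  have h1 : |F a b - F a' b| ≤ ∫ p in S, |G p.1 p.2| := by
    have hFTC : ∫ s in a'..a, D s b = F a b - F a' b :=
      intervalIntegral.integral_eq_sub_of_hasDerivAt (fun s _ => hF s b)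
        ((hDc b).intervalIntegrable _ _)
    rw [← hFTC, hS, Measure.volume_eq_prod, setIntegral_prod _ hGi.abs]
    refine (intervalIntegral.abs_integral_le_integral_abs ha).trans ?_
    rw [intervalIntegral.integral_of_le ha]
    refine setIntegral_mono_on ?_ ?_ measurableSet_Ioc fun s _ => ?_
    · exact ((hDc b).abs.integrableOn_Icc).mono_set Ioc_subset_Icc_self
    · have h2 : Integrable (fun p : ℝ × ℝ => |G p.1 p.2|)
          ((volume.restrict (Ioc a' a)).prod (volume.restrict (Ioc (-R) R))) := by
        rw [Measure.prod_restrict]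
        exact hGi.abs
      exact h2.integral_prod_left
    · rw [← intervalIntegral.integral_of_le (by linarith)]
      exact hDle s b
  calc (F a b - F a' b) ^ 2 = |F a b - F a' b| ^ 2 := (sq_abs _).symm
    _ ≤ (∫ p in S, |G p.1 p.2|) ^ 2 := pow_le_pow_left₀ (abs_nonneg _) h1 2
    _ ≤ 2 * R * (a - a') * ∫ p in S, G p.1 p.2 ^ 2 := by
        rw [← hvol]
        exact sq_setIntegral_abs_le hSfin hGi hG2.integrableOn
    _ ≤ _ := by
        refine mul_le_mul_of_nonneg_left ?_ (mul_nonneg (by linarith) (by linarith))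
        exact setIntegral_le_integral hG2 (Eventually.of_forall fun _ => sq_nonneg _)

/-- The point of the plane with given coordinates. -/
noncomputable def planePt (p : ℝ × ℝ) : Plane :=
  p.1 • EuclideanSpace.single 0 1 + p.2 • EuclideanSpace.single 1 1

lemma planePt_zero (p : ℝ × ℝ) : planePt p 0 = p.1 := by simp [planePt]

lemma planePt_one (p : ℝ × ℝ) : planePt p 1 = p.2 := by simp [planePt]

lemma planePt_coord (x : Plane) : planePt (x 0, x 1) = x := by
  ext i
  fin_cases i
  · exact planePt_zero _
  · exact planePt_one _

lemma continuous_planePt : Continuous planePt := by unfold planePt; fun_prop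

lemma measurePreserving_planePt : MeasurePreserving planePt volume volume := by
  have h := (EuclideanSpace.volume_preserving_symm_measurableEquiv_toLp (Fin 2)).symm.comp
    (volume_preserving_finTwoArrow ℝ).symm
  have he : planePt = (MeasurableEquiv.toLp 2 (Fin 2 → ℝ)) ∘ MeasurableEquiv.finTwoArrow.symm := by
    funext p
    refine PiLp.ext fun i => ?_
    fin_cases i
    · exact planePt_zero _
    · exact planePt_one _
  rw [he]
  exact h

lemma integral_comp_planePt {g : Plane → ℝ} (hg : Continuous g) :
    ∫ p, g (planePt p) = ∫ x, g x := by
  rw [← measurePreserving_planePt.map_eq, integral_map measurePreserving_planePt.aemeasurable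
    hg.aestronglyMeasurable]

/-! ### Sup and Hölder-1/2 bounds for test functions -/

section Test

variable {Ω : Set Plane} {φ : Plane → ℝ}

lemma IsTest.hasDerivAt_planePt_left (hφ : IsTest Ω φ) (s b : ℝ) :
    HasDerivAt (fun s => φ (planePt (s, b))) (TimeFracBiharmonic.partialD 0 φ (planePt (s, b))) s := by
  have h1 : HasDerivAt (fun s => planePt (s, b)) (EuclideanSpace.single 0 1) s := by
    simpa [planePt] using ((hasDerivAt_id s).smul_const
      (EuclideanSpace.single (0 : Fin 2) (1 : ℝ))).add_const (b • EuclideanSpace.single 1 1)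
  exact (hφ.differentiable _).hasFDerivAt.comp_hasDerivAt s h1

lemma IsTest.hasDerivAt_planePt_right (hφ : IsTest Ω φ) (s b : ℝ) :
    HasDerivAt (fun b => φ (planePt (s, b))) (TimeFracBiharmonic.partialD 1 φ (planePt (s, b))) b := by
  have h1 : HasDerivAt (fun b => planePt (s, b)) (EuclideanSpace.single 1 1) b := by
    simpa [planePt] using ((hasDerivAt_id b).smul_const
      (EuclideanSpace.single (1 : Fin 2) (1 : ℝ))).const_add (s • EuclideanSpace.single 0 1)
  exact (hφ.differentiable _).hasFDerivAt.comp_hasDerivAt b h1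

lemma abs_le_norm_planePt_left (s b : ℝ) : |s| ≤ ‖planePt (s, b)‖ := by
  simpa [planePt_zero] using PiLp.norm_apply_le (planePt (s, b)) 0

lemma abs_le_norm_planePt_right (s b : ℝ) : |b| ≤ ‖planePt (s, b)‖ := by
  simpa [planePt_one] using PiLp.norm_apply_le (planePt (s, b)) 1

/-- The squared `L²`-norm of the mixed second derivative. -/
noncomputable def mixedEnergy (φ : Plane → ℝ) : ℝ := ∫ x, partialD 1 (partialD 0 φ) x ^ 2

lemma mixedEnergy_nonneg (φ : Plane → ℝ) : 0 ≤ mixedEnergy φ :=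
  integral_nonneg fun _ => sq_nonneg _

lemma IsTest.eq_zero_of_le_norm (hφ : IsTest Ω φ) {R : ℝ} (hΩ : Ω ⊆ Metric.ball 0 R) {x : Plane}
    (hx : R ≤ ‖x‖) : φ x = 0 :=
  hφ.eq_zero fun h => absurd (mem_ball_zero_iff.1 (hΩ h)) hx.not_gt

lemma IsTest.integrable_sq_comp_planePt (hφ : IsTest Ω φ) :
    Integrable fun p : ℝ × ℝ => φ (planePt p) ^ 2 := by
  have h : Integrable fun x => φ x ^ 2 := by
    simpa only [sq] using hφ.mul_integrable hφ.continuous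
  exact measurePreserving_planePt.integrable_comp_of_integrable h

lemma IsTest.sq_sub_le_left (hφ : IsTest Ω φ) {R a a' : ℝ} (hR : 0 < R)
    (hΩ : Ω ⊆ Metric.ball 0 R) (ha : a' ≤ a) (b : ℝ) :
    (φ (planePt (a, b)) - φ (planePt (a', b))) ^ 2 ≤ 2 * R * (a - a') * mixedEnergy φ := by
  have hc := ((hφ.partialD 0).partialD 1).continuous.comp continuous_planePt
  have h := sq_sub_le_of_mixed_deriv (F := fun s b => φ (planePt (s, b)))
    (D := fun s b => TimeFracBiharmonic.partialD 0 φ (planePt (s, b)))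
    (G := fun s b => TimeFracBiharmonic.partialD 1 (TimeFracBiharmonic.partialD 0 φ)
      (planePt (s, b))) hR ha hφ.hasDerivAt_planePt_left
    (hφ.partialD 0).hasDerivAt_planePt_right
    (fun b => (hφ.partialD 0).continuous.comp (continuous_planePt.comp (by fun_prop)))
    hc (fun s b hb => (hφ.partialD 0).eq_zero_of_le_norm hΩ
      (hb.trans (abs_le_norm_planePt_right s b)))
    ((hφ.partialD 0).partialD 1).integrable_sq_comp_planePt b
  rwa [integral_comp_planePt (g := fun x => TimeFracBiharmonic.partialD 1
    (TimeFracBiharmonic.partialD 0 φ) x ^ 2)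
    (((hφ.partialD 0).partialD 1).continuous.pow 2)] at h

lemma IsTest.sq_sub_le_right (hφ : IsTest Ω φ) {R a a' : ℝ} (hR : 0 < R)
    (hΩ : Ω ⊆ Metric.ball 0 R) (ha : a' ≤ a) (b : ℝ) :
    (φ (planePt (b, a)) - φ (planePt (b, a'))) ^ 2 ≤ 2 * R * (a - a') * mixedEnergy φ := by
  have t := (hφ.partialD 0).partialD 1
  have hc : Continuous fun p : ℝ × ℝ => TimeFracBiharmonic.partialD 1
      (TimeFracBiharmonic.partialD 0 φ) (planePt p.swap) :=
    t.continuous.comp (continuous_planePt.comp continuous_swap)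
  have h := sq_sub_le_of_mixed_deriv (F := fun s b => φ (planePt (b, s)))
    (D := fun s b => TimeFracBiharmonic.partialD 1 φ (planePt (b, s)))
    (G := fun s b => TimeFracBiharmonic.partialD 1 (TimeFracBiharmonic.partialD 0 φ)
      (planePt (b, s))) hR ha (fun s b => hφ.hasDerivAt_planePt_right b s)
    (fun s b => by
      rw [hφ.partialD_comm 0 1]
      exact (hφ.partialD 1).hasDerivAt_planePt_left b s)
    (fun b => (hφ.partialD 1).continuous.comp (continuous_planePt.comp (by fun_prop)))
    hc (fun s b hb => (hφ.partialD 1).eq_zero_of_le_norm hΩ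
      (hb.trans (abs_le_norm_planePt_left b s))) t.integrable_sq_comp_planePt.swap b
  have h2 : ∫ p : ℝ × ℝ, TimeFracBiharmonic.partialD 1 (TimeFracBiharmonic.partialD 0 φ)
      (planePt (p.2, p.1)) ^ 2 = mixedEnergy φ := by
    rw [mixedEnergy, ← integral_comp_planePt (g := fun x => TimeFracBiharmonic.partialD 1
      (TimeFracBiharmonic.partialD 0 φ) x ^ 2) (t.continuous.pow 2)]
    exact integral_prod_swap (fun p : ℝ × ℝ => TimeFracBiharmonic.partialD 1
      (TimeFracBiharmonic.partialD 0 φ) (planePt p) ^ 2)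
  rwa [h2] at h

/-- The increment is taken from the point with first coordinate -R, where φ vanishes; the length is
at most 2R, hence 4R². -/
lemma IsTest.sq_le_mixedEnergy (hφ : IsTest Ω φ) {R : ℝ} (hR : 0 < R)
    (hΩ : Ω ⊆ Metric.ball 0 R) (x : Plane) : φ x ^ 2 ≤ 4 * R ^ 2 * mixedEnergy φ := by
  have hq := mixedEnergy_nonneg φ
  rcases le_or_gt R ‖x‖ with hx | hx
  · rw [hφ.eq_zero_of_le_norm hΩ hx, zero_pow two_ne_zero]
    exact mul_nonneg (by positivity) hq
  · have h0 : |x 0| < R := (PiLp.norm_apply_le x 0).trans_lt hx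
    rw [abs_lt] at h0
    have h := hφ.sq_sub_le_left hR hΩ h0.1.le (x 1)
    rw [planePt_coord, hφ.eq_zero_of_le_norm hΩ (x := planePt (-R, x 1))
      ((le_abs_self R).trans_eq (abs_neg R).symm |>.trans (abs_le_norm_planePt_left _ _)),
      sub_zero] at h
    refine h.trans (mul_le_mul_of_nonneg_right ?_ hq)
    nlinarith

lemma IsTest.sq_sub_le (hφ : IsTest Ω φ) {R : ℝ} (hR : 0 < R)
    (hΩ : Ω ⊆ Metric.ball 0 R) (x y : Plane) :
    (φ x - φ y) ^ 2 ≤ 8 * R * ‖x - y‖ * mixedEnergy φ := by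
  have hq := mixedEnergy_nonneg φ
  have hl : ∀ a a' b : ℝ, (φ (planePt (a, b)) - φ (planePt (a', b))) ^ 2
      ≤ 2 * R * |a - a'| * mixedEnergy φ := by
    intro a a' b
    rcases le_total a' a with h | h
    · rw [abs_of_nonneg (sub_nonneg.2 h)]
      exact hφ.sq_sub_le_left hR hΩ h b
    · rw [abs_sub_comm, abs_of_nonneg (sub_nonneg.2 h), ← neg_sub, neg_sq]
      exact hφ.sq_sub_le_left hR hΩ h b
  have hr : ∀ a a' b : ℝ, (φ (planePt (b, a)) - φ (planePt (b, a'))) ^ 2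
      ≤ 2 * R * |a - a'| * mixedEnergy φ := by
    intro a a' b
    rcases le_total a' a with h | h
    · rw [abs_of_nonneg (sub_nonneg.2 h)]
      exact hφ.sq_sub_le_right hR hΩ h b
    · rw [abs_sub_comm, abs_of_nonneg (sub_nonneg.2 h), ← neg_sub, neg_sq]
      exact hφ.sq_sub_le_right hR hΩ h b
  -- The path from x to y goes through the corner (y₀, x₁). Each leg contributes 2R‖x - y‖, and (p +
  -- q)² ≤ 2p² + 2q² makes the constant 8R.
  have h1 := hl (x 0) (y 0) (x 1)
  have h2 := hr (x 1) (y 1) (y 0)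
  rw [planePt_coord] at h1 h2
  have e0 : |x 0 - y 0| ≤ ‖x - y‖ := PiLp.norm_apply_le (x - y) 0
  have e1 : |x 1 - y 1| ≤ ‖x - y‖ := PiLp.norm_apply_le (x - y) 1
  have h1' : 2 * R * |x 0 - y 0| * mixedEnergy φ ≤ 2 * R * ‖x - y‖ * mixedEnergy φ := by gcongr
  have h2' : 2 * R * |x 1 - y 1| * mixedEnergy φ ≤ 2 * R * ‖x - y‖ * mixedEnergy φ := by gcongr
  nlinarith [sq_nonneg ((φ x - φ (planePt (y 0, x 1))) - (φ (planePt (y 0, x 1)) - φ y))]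

end Test

/-! ### Coercivity and compactness -/

section Coercive

variable {Ω : Set Plane} {φ : Plane → ℝ}

lemma IsTest.norm_sq_toLp (hφ : IsTest Ω φ) (hΩ : MeasurableSet Ω) :
    ‖hφ.toLp‖ ^ 2 = ∫ x, φ x ^ 2 := by
  rw [← real_inner_self_eq_norm_sq, hφ.inner_toLp_toLp hφ hΩ]
  simp only [sq]

lemma IsTest.norm_sq_toH20 (hφ : IsTest Ω φ) :
    ‖hφ.toH20‖ ^ 2 = ‖hφ.toLp‖ ^ 2 + (‖(hφ.partialD 0).toLp‖ ^ 2 + ‖(hφ.partialD 1).toLp‖ ^ 2)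
      + aForm hφ.toH20 hφ.toH20 := by
  have h : ‖hφ.toH20‖ ^ 2 = ∑ k, ‖hφ.jetEntry k‖ ^ 2 :=
    PiLp.norm_sq_eq_of_L2 (fun _ : JetIdx => L2 Ω) (WithLp.toLp 2 hφ.jetEntry)
  rw [h, Fintype.sum_sum_type, Fintype.sum_sum_type, Fintype.sum_prod_type]
  simp only [aForm, hφ.hess_toH20, real_inner_self_eq_norm_sq, Fin.sum_univ_two,
    Finset.univ_unique, Finset.sum_singleton, IsTest.jetEntry]
  ring

lemma aForm_self (v : H20 Ω) : aForm v v = ∑ i, ∑ j, ‖v.hess i j‖ ^ 2 := by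
  simp only [aForm, real_inner_self_eq_norm_sq]

lemma norm_sq_hess_le_aForm (v : H20 Ω) (i j : Fin 2) : ‖v.hess i j‖ ^ 2 ≤ aForm v v := by
  rw [aForm_self]
  exact (Finset.single_le_sum (f := fun j => ‖v.hess i j‖ ^ 2) (fun _ _ => sq_nonneg _)
    (Finset.mem_univ j)).trans (Finset.single_le_sum (f := fun i => ∑ j, ‖v.hess i j‖ ^ 2)
      (fun _ _ => Finset.sum_nonneg fun _ _ => sq_nonneg _) (Finset.mem_univ i))

lemma IsTest.mixedEnergy_le (hφ : IsTest Ω φ) (hΩ : MeasurableSet Ω) :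
    mixedEnergy φ ≤ aForm hφ.toH20 hφ.toH20 := by
  have h := norm_sq_hess_le_aForm hφ.toH20 0 1
  rwa [hφ.hess_toH20, ((hφ.partialD 0).partialD 1).norm_sq_toLp hΩ] at h

/-- Integration by parts gives ‖∂ᵢφ‖² = -(φ, ∂ᵢ²φ), and then 0 ≤ ‖φ + ∂ᵢ²φ‖². First derivatives are
thus controlled without a separate Poincaré inequality. -/
lemma IsTest.norm_sq_partialD_le (hφ : IsTest Ω φ) (hΩ : MeasurableSet Ω) (i : Fin 2) :
    ‖(hφ.partialD i).toLp‖ ^ 2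
      ≤ (‖hφ.toLp‖ ^ 2 + ‖((hφ.partialD i).partialD i).toLp‖ ^ 2) / 2 := by
  have h1 := hφ.inner_toLp_toLp ((hφ.partialD i).partialD i) hΩ
  rw [hφ.integral_mul_partialD (hφ.partialD i), ← (hφ.partialD i).inner_toLp_toLp (hφ.partialD i) hΩ,
    real_inner_self_eq_norm_sq] at h1
  have h2 := norm_add_sq_real hφ.toLp ((hφ.partialD i).partialD i).toLp
  nlinarith [sq_nonneg ‖hφ.toLp + ((hφ.partialD i).partialD i).toLp‖]

lemma continuous_aForm_self : Continuous fun v : H20 Ω => aForm v v := by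
  simp only [aForm_self]
  exact continuous_finsetSum _ fun i _ => continuous_finsetSum _ fun j _ =>
    (H20.continuous_hess i j).norm.pow 2

lemma aForm_self_le_norm_sq (v : H20 Ω) : aForm v v ≤ ‖v‖ ^ 2 := by
  refine H20.induction (p := fun v : H20 Ω => aForm v v ≤ ‖v‖ ^ 2)
    (isClosed_le continuous_aForm_self (continuous_norm.pow 2)) (fun φ hφ => ?_) v
  rw [hφ.norm_sq_toH20]
  have := sq_nonneg ‖hφ.toLp‖
  have := sq_nonneg ‖(hφ.partialD 0).toLp‖
  have := sq_nonneg ‖(hφ.partialD 1).toLp‖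
  linarith

lemma exists_subset_ball (hb : Bornology.IsBounded Ω) : ∃ R : ℝ, 0 < R ∧ Ω ⊆ Metric.ball 0 R := by
  obtain ⟨R, hR⟩ := hb.subset_ball 0
  exact ⟨max R 1, by positivity, hR.trans (Metric.ball_subset_ball (le_max_left _ _))⟩

lemma exists_norm_sq_le_aForm (hΩ : MeasurableSet Ω) (hb : Bornology.IsBounded Ω) :
    ∃ C : ℝ, 0 < C ∧ ∀ v : H20 Ω, ‖v‖ ^ 2 ≤ C * aForm v v := by
  obtain ⟨R, hR, hΩR⟩ := exists_subset_ball hb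
  have hV : volume Ω < ⊤ := hb.measure_lt_top
  -- The two first derivatives add at most ‖φ‖² + a(φ,φ), so ‖φ‖²_V ≤ 2‖φ‖² + 2 a(φ,φ). The sup
  -- bound integrated over Ω gives ‖φ‖² ≤ 4R² |Ω| a(φ,φ).
  refine ⟨2 * (4 * R ^ 2 * volume.real Ω) + 2, by positivity, fun v => ?_⟩
  refine H20.induction (p := fun v : H20 Ω => ‖v‖ ^ 2
      ≤ (2 * (4 * R ^ 2 * volume.real Ω) + 2) * aForm v v)
    (isClosed_le (continuous_norm.pow 2) (continuous_const.mul continuous_aForm_self))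
    (fun φ hφ => ?_) v
  have h0 : ‖hφ.toLp‖ ^ 2 ≤ 4 * R ^ 2 * volume.real Ω * aForm hφ.toH20 hφ.toH20 := by
    rw [← real_inner_self_eq_norm_sq, hφ.inner_toLp_toLp hφ hΩ, ← hφ.setIntegral_mul _ hΩ]
    have h1 := norm_setIntegral_le_of_norm_le_const (f := fun x => φ x * φ x) hV
      (C := 4 * R ^ 2 * aForm hφ.toH20 hφ.toH20) fun x _ => by
        rw [norm_mul, ← sq, Real.norm_eq_abs, sq_abs]
        exact (hφ.sq_le_mixedEnergy hR hΩR x).trans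
          (mul_le_mul_of_nonneg_left (hφ.mixedEnergy_le hΩ) (by positivity))
    calc _ ≤ _ := le_abs_self _
      _ ≤ _ := h1
      _ = _ := by ring
  have h1 := hφ.norm_sq_partialD_le hΩ 0
  have h2 := hφ.norm_sq_partialD_le hΩ 1
  have h3 : ‖((hφ.partialD 0).partialD 0).toLp‖ ^ 2 ≤ aForm hφ.toH20 hφ.toH20 :=
    norm_sq_hess_le_aForm hφ.toH20 0 0
  have h4 : ‖((hφ.partialD 1).partialD 1).toLp‖ ^ 2 ≤ aForm hφ.toH20 hφ.toH20 :=
    norm_sq_hess_le_aForm hφ.toH20 1 1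
  rw [hφ.norm_sq_toH20]
  linarith

/-- The compact embedding `H²₀(Ω) → L²(Ω)`. -/
lemma isCompactOperator_toL2 (hΩ : MeasurableSet Ω) (hb : Bornology.IsBounded Ω) :
    IsCompactOperator (H20.toL2 Ω) := by
  obtain ⟨R, hR, hΩR⟩ := exists_subset_ball hb
  set K : Set Plane := Metric.closedBall 0 R with hK
  have : CompactSpace K := isCompact_iff_compactSpace.1 (isCompact_closedBall 0 R)
  have : IsFiniteMeasure (volume.restrict Ω) := ⟨by simpa using hb.measure_lt_top⟩
  classical
  -- On Ω this is the inclusion into K; the value 0 elsewhere is irrelevant. Pushing the measure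
  -- forward along p lets continuous functions on the compact K act as elements of L²(Ω).
  set p : Plane → K := fun x => if h : x ∈ K then ⟨x, h⟩ else ⟨0, by simp [hK, hR.le]⟩ with hp
  have hpm : Measurable p :=
    Measurable.dite (s := K) (f := fun x : K => x) measurable_id measurable_const
      Metric.isClosed_closedBall.measurableSet
  set ν : Measure K := (volume.restrict Ω).map p with hν
  have hpp : MeasurePreserving p (volume.restrict Ω) ν := ⟨hpm, rfl⟩
  have : IsFiniteMeasure ν := Measure.isFiniteMeasure_map _ _
  set Φ : (BoundedContinuousFunction K ℝ) → L2 Ω := fun g =>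
    Lp.compMeasurePreserving p hpp (BoundedContinuousFunction.toLp 2 ν ℝ g) with hΦ
  have hΦc : Continuous Φ :=
    (Lp.isometry_compMeasurePreserving hpp).continuous.comp
      (BoundedContinuousFunction.toLp 2 ν ℝ).continuous
  set A : Set (BoundedContinuousFunction K ℝ) :=
    {g | ∃ φ, ∃ hφ : IsTest Ω φ, ‖hφ.toH20‖ < 1 ∧ ∀ x : K, g x = φ x} with hA
  have hen : ∀ φ, ∀ hφ : IsTest Ω φ, ‖hφ.toH20‖ < 1 → mixedEnergy φ ≤ 1 := fun φ hφ h => by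
    refine (hφ.mixedEnergy_le hΩ).trans ((aForm_self_le_norm_sq _).trans ?_)
    exact pow_le_one₀ (norm_nonneg _) h.le
  -- Mixed energy at most 1 gives the common bound 2R and the common modulus of continuity √(8R d).
  have hAc : IsCompact (closure A) := by
    refine BoundedContinuousFunction.arzela_ascoli (Icc (-(2 * R)) (2 * R)) isCompact_Icc A ?_ ?_
    · rintro g x ⟨φ, hφ, h1, hg⟩
      have h := (hφ.sq_le_mixedEnergy hR hΩR x).trans
        (mul_le_of_le_one_right (by positivity) (hen φ hφ h1))
      rw [hg]
      exact abs_le.1 (abs_le_of_sq_le_sq (by linarith) (by positivity))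
    · refine Metric.equicontinuous_of_continuity_modulus (fun d => Real.sqrt (8 * R * d)) ?_ _ ?_
      · have : Continuous fun d => Real.sqrt (8 * R * d) := by fun_prop
        simpa using this.tendsto 0
      · rintro x y ⟨g, φ, hφ, h1, hg⟩
        rw [Real.dist_eq]
        refine Real.abs_le_sqrt ?_
        change (g x - g y) ^ 2 ≤ _
        rw [hg, hg]
        refine (hφ.sq_sub_le hR hΩR x y).trans ?_
        rw [Subtype.dist_eq, dist_eq_norm]
        exact mul_le_of_le_one_right (by positivity) (hen φ hφ h1)
  refine (isCompactOperator_iff_image_ball_subset_compact (H20.toL2 Ω : H20 Ω →ₗ[ℝ] L2 Ω)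
    zero_lt_one).2 ⟨Φ '' closure A, hAc.image hΦc, ?_⟩
  rw [image_subset_iff]
  have hcl : IsClosed ((H20.toL2 Ω : H20 Ω →ₗ[ℝ] L2 Ω) ⁻¹' (Φ '' closure A)) :=
    (hAc.image hΦc).isClosed.preimage (H20.toL2 Ω).continuous
  -- The target is compact, hence closed, and test functions are dense in the open unit ball; so it
  -- suffices to treat these.
  refine (dense_setOf_toH20.open_subset_closure_inter Metric.isOpen_ball).trans
    (closure_minimal ?_ hcl)
  rintro _ ⟨hv, φ, hφ, rfl⟩
  let g : BoundedContinuousFunction K ℝ :=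
    BoundedContinuousFunction.mkOfCompact ⟨fun x => φ x, hφ.continuous.comp continuous_subtype_val⟩
  refine ⟨g, subset_closure ⟨φ, hφ, by simpa using hv, fun x => rfl⟩, ?_⟩
  change Φ g = hφ.toLp
  refine Lp.ext ?_
  have h1 := Lp.coeFn_compMeasurePreserving (BoundedContinuousFunction.toLp 2 ν ℝ g) hpp
  have h2 := hpp.quasiMeasurePreserving.ae_eq_comp (BoundedContinuousFunction.coeFn_toLp 2 ν ℝ g)
  refine h1.trans (h2.trans (EventuallyEq.trans ?_ hφ.coeFn_toLp.symm))
  refine (ae_restrict_mem hΩ).mono fun x hx => ?_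
  have hxK : x ∈ K := Metric.ball_subset_closedBall (hΩR hx)
  simp only [Function.comp_apply, hp, dif_pos hxK]
  rfl

end Coercive

/-! ### Eigenbases of compact symmetric operators -/

section Spectral

variable {H : Type*} [NormedAddCommGroup H] [InnerProductSpace ℝ H]

/-- Orthonormal vectors lie at distance √2, so balls of radius 1/2 around them are disjoint, and a
separable space has only countably many disjoint nonempty open sets. -/
lemma countable_of_orthonormal [TopologicalSpace.SeparableSpace H] {ι : Type*}
    {v : ι → H} (hv : Orthonormal ℝ v) : Countable ι := by
  have hd : Pairwise fun i j => Disjoint (Metric.ball (v i) (1 / 2)) (Metric.ball (v j) (1 / 2)) := by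
    intro i j hij
    refine Metric.ball_disjoint_ball ?_
    rw [dist_eq_norm]
    have h := norm_sub_sq_real (v i) (v j)
    rw [hv.1 i, hv.1 j, hv.2 hij] at h
    nlinarith [norm_nonneg (v i - v j)]
  have h := Set.PairwiseDisjoint.countable_of_isOpen (a := univ) (fun i _ j _ hij => hd hij)
    (fun i _ => Metric.isOpen_ball) (fun i _ => ⟨v i, Metric.mem_ball_self (by norm_num)⟩)
  exact countable_univ_iff.1 h

/-- Hilbert bases of all eigenspaces, the kernel included, are joined. They are mutually orthogonal
by symmetry and complete by the spectral theorem. Separability makes the union countable and the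
dimension makes it infinite, so it can be indexed by ℕ. -/
lemma exists_hilbertBasis_nat_eigen [CompleteSpace H] [TopologicalSpace.SeparableSpace H]
    (hdim : ¬ FiniteDimensional ℝ H) {T : H →L[ℝ] H} (hT : IsCompactOperator T)
    (hT' : (T : H →ₗ[ℝ] H).IsSymmetric) :
    ∃ (b : HilbertBasis ℕ ℝ H) (l : ℕ → ℝ), ∀ n, T (b n) = l n • b n := by
  set E : ℝ → Submodule ℝ H := fun l => Module.End.eigenspace (T : H →ₗ[ℝ] H) l with hE
  have hEmem : ∀ l x, x ∈ E l ↔ T x = l • x := fun l x => Module.End.mem_eigenspace_iff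
  have hcomp : ∀ l, CompleteSpace (E l) := fun l => by
    have hcl : IsClosed (E l : Set H) := by
      have : (E l : Set H) = {x | T x = l • x} := by ext x; exact hEmem l x
      rw [this]
      exact isClosed_eq T.continuous (continuous_const_smul l)
    exact hcl.completeSpace_coe
  choose w c hc using fun l => exists_hilbertBasis ℝ (E l)
  set v : (Σ l, w l) → H := fun a => (c a.1 a.2 : H) with hv
  have hvo : Orthonormal ℝ v :=
    hT'.orthogonalFamily_eigenspaces.orthonormal_sigma_orthonormal
      (v_family := fun l => c l) fun l => (c l).orthonormal
  have hbot : (Submodule.span ℝ (range v))ᗮ = ⊥ := by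
    rw [eq_bot_iff, ← ContinuousLinearMap.orthogonalComplement_iSup_eigenspaces_eq_bot hT hT']
    intro x hx
    rw [Submodule.mem_orthogonal'] at hx
    have hker : ∀ l, E l ≤ LinearMap.ker ((innerSL ℝ x : H →L[ℝ] ℝ) : H →ₗ[ℝ] ℝ) := by
      intro l y hy
      have h0 : (innerSL ℝ x).comp (E l).subtypeL = 0 :=
        ContinuousLinearMap.ext_on
          (Submodule.dense_iff_topologicalClosure_eq_top.2 (c l).dense_span) (by
            rintro _ ⟨i, rfl⟩
            exact hx _ (Submodule.subset_span ⟨⟨l, i⟩, rfl⟩))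
      exact DFunLike.congr_fun h0 ⟨y, hy⟩
    rw [Submodule.mem_orthogonal']
    intro y hy
    exact (iSup_le hker) hy
  have hcount : Countable (Σ l, w l) := countable_of_orthonormal hvo
  have hinf : Infinite (Σ l, w l) := by
    by_contra hfin
    rw [not_infinite_iff_finite] at hfin
    have hf : FiniteDimensional ℝ (Submodule.span ℝ (range v)) :=
      FiniteDimensional.span_of_finite ℝ (finite_range v)
    rw [Submodule.orthogonal_eq_bot_iff] at hbot
    rw [hbot] at hf
    exact hdim (Module.finite_def.2 ((Submodule.fg_top _).1 (Module.finite_def.1 hf)) )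
  obtain ⟨r⟩ := nonempty_equiv_of_countable (α := ℕ) (β := Σ l, w l)
  refine ⟨HilbertBasis.mkOfOrthogonalEqBot (hvo.comp r r.injective)
    (by rwa [EquivLike.range_comp]), fun n => (r n).1, fun n => ?_⟩
  rw [HilbertBasis.coe_mkOfOrthogonalEqBot]
  exact (hEmem _ _).1 (c (r n).1 (r n).2).2

end Spectral

/-! ### Existence of an eigenbasis of the biharmonic operator -/

section Exists

variable {Ω : Set Plane}

/-- Ω contains infinitely many disjoint nonempty open sets, whose indicators are nonzero and
orthogonal. -/
lemma not_finiteDimensional_L2 (hΩ : IsOpen Ω) (hb : Bornology.IsBounded Ω) (hne : Ω.Nonempty) :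
    ¬ FiniteDimensional ℝ (L2 Ω) := by
  intro hfin
  obtain ⟨x₀, hx₀⟩ := hne
  have : Infinite Ω := (infinite_of_mem_nhds x₀ (hΩ.mem_nhds hx₀)).to_subtype
  obtain ⟨U, hUi, hUo, hUd⟩ := exists_seq_infinite_isOpen_pairwise_disjoint Ω
  set W : ℕ → Set Plane := fun n => Subtype.val '' U n with hW
  have hWo : ∀ n, IsOpen (W n) := fun n => hΩ.isOpenMap_subtype_val _ (hUo n)
  have hWΩ : ∀ n, W n ⊆ Ω := fun n => by rintro _ ⟨x, -, rfl⟩; exact x.2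
  have hWfin : ∀ n, volume.restrict Ω (W n) ≠ ⊤ := fun n =>
    ((Measure.restrict_apply_le _ _).trans_lt ((hb.subset (hWΩ n)).measure_lt_top)).ne
  have hWd : Pairwise fun i j => Disjoint (W i) (W j) := fun i j hij =>
    (disjoint_image_iff Subtype.val_injective).2 (hUd hij)
  have hWpos : ∀ n, 0 < (volume.restrict Ω).real (W n) := fun n => by
    refine ENNReal.toReal_pos ?_ (hWfin n)
    rw [Measure.restrict_apply (hWo n).measurableSet, inter_eq_left.2 (hWΩ n)]
    exact ((hWo n).measure_pos volume ((hUi n).nonempty.image _)).ne'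
  set g : ℕ → L2 Ω := fun n => indicatorConstLp 2 (hWo n).measurableSet (hWfin n) (1 : ℝ) with hg
  have hin : ∀ i j, inner ℝ (g i) (g j) = (volume.restrict Ω).real (W i ∩ W j) := fun i j => by
    refine (L2.inner_indicatorConstLp_indicatorConstLp (𝕜 := ℝ) (hWo i).measurableSet
      (hWo j).measurableSet (hWfin i) (hWfin j) (1 : ℝ) 1).trans ?_
    simp
  have hli : LinearIndependent ℝ g := by
    refine linearIndependent_of_ne_zero_of_inner_eq_zero (𝕜 := ℝ) (fun n h0 => ?_) fun i j hij => ?_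
    · have h := hin n n
      rw [h0, inner_zero_left, inter_self] at h
      exact (hWpos n).ne h
    · change inner ℝ (g i) (g j) = 0
      rw [hin, (hWd hij).inter_eq]
      simp
  exact not_finite_iff_infinite.2 (inferInstanceAs (Infinite ℕ)) hli.finite

/-- Test functions are dense in `L²(Ω)`. -/
lemma eq_zero_of_forall_inner_toL2 (hΩ : IsOpen Ω) {g : L2 Ω}
    (h : ∀ w : H20 Ω, inner ℝ g (H20.toL2 Ω w) = 0) : g = 0 := by
  have hloc : LocallyIntegrableOn (fun x => g x) Ω volume :=
    locallyIntegrableOn_of_locallyIntegrable_restrict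
      ((Lp.memLp g).locallyIntegrable (by norm_num))
  have h1 := hΩ.ae_eq_zero_of_integral_contDiff_smul_eq_zero hloc fun ψ hψ hψc hψs => by
    have hT : IsTest Ω ψ := ⟨hψ, hψc, hψs⟩
    have h2 := h hT.toH20
    rw [hT.toL2_toH20, hT.inner_toLp, hT.setIntegral_mul _ hΩ.measurableSet] at h2
    simpa only [smul_eq_mul, mul_comm] using h2
  refine Lp.ext ?_
  refine EventuallyEq.trans ?_ (Lp.coeFn_zero _ _ _).symm
  exact (ae_restrict_iff' hΩ.measurableSet).2 h1

/-- The weak second derivative as a bounded operator. -/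
noncomputable def hessL (Ω : Set Plane) (i j : Fin 2) : H20 Ω →L[ℝ] L2 Ω :=
  (PiLp.proj 2 (fun _ : JetIdx => L2 Ω) (Sum.inr (Sum.inr (i, j)))).comp (H20.jet Ω)

/-- The form `a` as a bounded bilinear map. -/
noncomputable def aFormL (Ω : Set Plane) : H20 Ω →L[ℝ] H20 Ω →L[ℝ] ℝ :=
  ∑ i, ∑ j, (innerSL ℝ).bilinearComp (hessL Ω i j) (hessL Ω i j)

lemma aFormL_apply (v w : H20 Ω) : aFormL Ω v w = aForm v w := by
  simp only [aFormL, sum_apply]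
  rfl

/-- The solution operator of the clamped plate problem `A v = g`. -/
lemma exists_plate_solution (hΩ : MeasurableSet Ω) (hb : Bornology.IsBounded Ω) :
    ∃ S : L2 Ω →L[ℝ] H20 Ω, ∀ g w, aForm (S g) w = inner ℝ g (H20.toL2 Ω w) := by
  obtain ⟨C, hC, hcoer⟩ := exists_norm_sq_le_aForm (Ω := Ω) hΩ hb
  have hB : IsCoercive (aFormL Ω) := ⟨C⁻¹, inv_pos.2 hC, fun v => by
    rw [aFormL_apply, mul_assoc, ← sq, inv_mul_le_iff₀ hC]
    exact hcoer v⟩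
  -- Lax-Milgram: the adjoint of V → L² represents w ↦ (g, w) in the inner product of V, and the
  -- inverse of the form operator then solves the problem.
  refine ⟨(hB.continuousLinearEquivOfBilin.symm : H20 Ω →L[ℝ] H20 Ω).comp
    (ContinuousLinearMap.adjoint (H20.toL2 Ω)), fun g w => ?_⟩
  rw [← aFormL_apply, ← hB.continuousLinearEquivOfBilin_apply]
  simp [ContinuousLinearMap.adjoint_inner_left]

/-- T is the inverse of A on L²(Ω). From (g, T h) = a(S g, S h) it is symmetric, and its eigenvalues
are lⱼ = a(S bⱼ, S bⱼ); inverting them gives μⱼ. -/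
theorem nonempty_eigenSystem (hΩ : IsOpen Ω) (hb : Bornology.IsBounded Ω) (hne : Ω.Nonempty) :
    Nonempty (EigenSystem Ω) := by
  obtain ⟨S, hS⟩ := exists_plate_solution (Ω := Ω) hΩ.measurableSet hb
  set T : L2 Ω →L[ℝ] L2 Ω := (H20.toL2 Ω).comp S with hTdef
  have hTc : IsCompactOperator T := (isCompactOperator_toL2 hΩ.measurableSet hb).comp_clm S
  have hTi : ∀ g h, inner ℝ g (T h) = aForm (S g) (S h) := fun g h => (hS g (S h)).symm
  have hTs : (T : L2 Ω →ₗ[ℝ] L2 Ω).IsSymmetric := fun g h => by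
    change inner ℝ (T g) h = inner ℝ g (T h)
    rw [hTi, real_inner_comm, hTi, aForm_comm]
  have : Fact ((2 : ℝ≥0∞) ≠ ⊤) := ⟨by norm_num⟩
  obtain ⟨b, l, hbl⟩ := exists_hilbertBasis_nat_eigen (not_finiteDimensional_L2 hΩ hb hne) hTc hTs
  obtain ⟨C, hC, hcoer⟩ := exists_norm_sq_le_aForm (Ω := Ω) hΩ.measurableSet hb
  have hb1 : ∀ j, ‖b j‖ = 1 := b.orthonormal.1
  have hl : ∀ j, l j = aForm (S (b j)) (S (b j)) := fun j => by
    rw [← hTi, hbl, inner_smul_right, real_inner_self_eq_norm_sq, hb1]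
    ring
  -- Coercivity reduces positivity to S bⱼ ≠ 0; S is injective because the image of V is dense in
  -- L²(Ω).
  have hpos : ∀ j, 0 < l j := fun j => by
    have hnn : ‖S (b j)‖ ^ 2 ≤ C * l j := by rw [hl]; exact hcoer _
    have h0 : S (b j) ≠ 0 := fun h0 => by
      have : b j = 0 := eq_zero_of_forall_inner_toL2 hΩ fun w => by
        rw [← hS, h0, ← aFormL_apply, map_zero]
        rfl
      have h1 := hb1 j
      rw [this, norm_zero] at h1
      exact zero_ne_one h1
    exact pos_of_mul_pos_right ((pow_pos (norm_pos_iff.2 h0) 2).trans_le hnn) hC.le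
  refine ⟨⟨fun j => (l j)⁻¹, b, fun j => inv_pos.2 (hpos j), fun j => ⟨(l j)⁻¹ • S (b j), ?_, ?_⟩⟩⟩
  · rw [map_smul]
    change (l j)⁻¹ • T (b j) = b j
    rw [hbl, inv_smul_smul₀ (hpos j).ne']
  · refine (hasBilaplacian_iff hΩ.measurableSet).2 fun w => ?_
    rw [aForm_comm, ← aFormL_apply, map_smul, smul_apply, aFormL_apply, hS,
      inner_smul_left]
    rfl

end Exists

end TimeFracBiharmonic

theorem theorem2p3 (α : ℝ) (hα₀ : 0 < α) (hα₁ : α < 1) (T : ℝ) (hT : 0 < T) :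
    ∃ C : ℝ, 0 < C ∧
      ∀ Ω : Set Plane, IsOpen Ω → Bornology.IsBounded Ω → Ω.Nonempty →
        -- the eigenfunction expansion that defines the spaces `D(A^r)` is available
        Nonempty (EigenSystem Ω) ∧
        ∀ e : EigenSystem Ω,
        ∀ q ∈ Icc (-1 : ℝ) 1,
        ∀ f f₁ f₂ : ℝ → L2 Ω,
          MemW21 T f f₁ f₂ →
          -- `f ∈ W^{1,∞}(0, T; D(A^{q/2}))`
          e.supNorm (q / 2) T f < ⊤ → e.supNorm (q / 2) T f₁ < ⊤ →
        ∀ u : ℝ → H20 Ω,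
          IsWeakSolution α T (fun t => toDual (f t)) 0 u →
        ∃ U U₁ U₂ : ℝ → L2 Ω,
          -- `U` is the continuous representative of `u`
          ContinuousOn U (Icc 0 T) ∧
          (∀ᵐ t ∂(volume.restrict (Ioo 0 T)), U t = H20.toL2 Ω (u t)) ∧
          -- `U₁ = u'` on `(0, T]`
          (∀ t ∈ Ioc 0 T, HasDerivWithinAt U (U₁ t) (Icc 0 T) t) ∧
          -- `u'` is locally absolutely continuous on `(0, T]`, with `u'' = U₂`
          (∀ s t : ℝ, 0 < s → s ≤ t → t ≤ T →
            IntervalIntegrable U₂ volume s t ∧ U₁ t - U₁ s = ∫ τ in s..t, U₂ τ) ∧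
          (∀ᵐ t ∂(volume.restrict (Ioo 0 T)), HasDerivAt U₁ (U₂ t) t) ∧
          -- the Caputo derivative is well defined at every time
          (∀ t ∈ Icc 0 T, IntervalIntegrable
            (fun s => rlKernel (1 - α) (t - s) • U₁ s) volume 0 t) ∧
          -- the bound for `u''`
          (∀ᵐ t ∂(volume.restrict (Ioo 0 T)),
            ‖U₂ t‖ ≤ C * (rlIntegral α (fun s => ‖f₂ s‖) t
              + t ^ (α - 1) * ‖f₁ 0‖ + t ^ (α - 2) * ‖f 0‖)) ∧
          -- the bounds for `u`, `u'` and the Caputo derivative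
          ∀ ε ∈ Ioo (0 : ℝ) 1,
            (∀ t ∈ Icc 0 T, e.powNorm (q / 2 + 1 - ε / 2) (U t)
              ≤ ENNReal.ofReal (C * (ε⁻¹ * t ^ (α * ε / 2))) * e.supNorm (q / 2) t f) ∧
            (∀ t ∈ Ioc 0 T, e.powNorm (q / 2 + 1 - ε / 2) (U₁ t)
              ≤ ENNReal.ofReal (C * (ε⁻¹ * t ^ (α * ε / 2))) * e.supNorm (q / 2) t f₁
                + ENNReal.ofReal (C * t ^ (-1 + α * ε / 2)) * e.powNorm (q / 2) (f 0)) ∧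
            (∀ t ∈ Icc 0 T, ‖caputo α U₁ t‖ₑ
              ≤ ENNReal.ofReal (C * (ε⁻¹ * t ^ (α * ε / 2))) * e.supNorm (ε / 2) t f
                + ENNReal.ofReal (C * ‖f t‖)) := by
  set B := max 1 (Real.Gamma α)⁻¹
  -- B · 2/α comes from Duhamel's integral in the D(A^r) bounds, B from the term E(t) f(0) in u',
  -- and 5/Γ(α) from E'(t) f(0) in u''. B ≥ 1 also covers the coefficient 1 of ‖f(t)‖ and of
  -- I^α‖f''‖.
  refine ⟨max (B * (2 / α)) (max B (5 / Real.Gamma α)),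
    lt_max_of_lt_right (lt_max_of_lt_left (lt_max_of_lt_left one_pos)), fun Ω hΩ hb hne =>
    ⟨nonempty_eigenSystem hΩ hb hne, ?_⟩⟩
  intro e q _ f f₁ f₂ hf _ _ u hu
  have hC : B * (2 / α) ≤ max (B * (2 / α)) (max B (5 / Real.Gamma α)) := le_max_left _ _
  have hC' : B ≤ max (B * (2 / α)) (max B (5 / Real.Gamma α)) :=
    (le_max_left _ _).trans (le_max_right _ _)
  have hC₁ : 1 ≤ max (B * (2 / α)) (max B (5 / Real.Gamma α)) := (le_max_left _ _).trans hC'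
  have hC₅ : 5 / Real.Gamma α ≤ max (B * (2 / α)) (max B (5 / Real.Gamma α)) :=
    (le_max_right _ _).trans (le_max_right _ _)
  have hμ : ∀ j, 0 ≤ e.μ j := fun j => (e.pos j).le
  have heig : ∀ j, ∃ v : H20 Ω, H20.toL2 Ω v = e.φ j ∧
      ∀ w, aForm w v = e.μ j * inner ℝ (e.φ j) (H20.toL2 Ω w) := fun j => by
    obtain ⟨v, hv, hv'⟩ := e.eigen j
    refine ⟨v, hv, fun w => ?_⟩
    rw [(hasBilaplacian_iff hΩ.measurableSet).1 hv' w, inner_smul_left]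
    rfl
  have hf₁i : IntervalIntegrable f₁ volume 0 T :=
    (intervalIntegrable_iff_integrableOn_Ioo_of_le hT.le).2 hf.deriv₁.integrable_deriv
  have hf₂i : IntervalIntegrable f₂ volume 0 T :=
    (intervalIntegrable_iff_integrableOn_Ioo_of_le hT.le).2 hf.deriv₂.integrable_deriv
  have hff₁ := hf.deriv₁.eq_add_integral_of_continuousOn hT hf.cont
  have hf₁f₂ := hf.deriv₂.eq_add_integral_of_continuousOn hT hf.cont₁
  exact ⟨duhamel e.φ e.μ α f, solDeriv e.φ e.μ α f f₁, solDeriv₂ e.φ e.μ α f f₁ f₂,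
    continuousOn_duhamel hα₀ hα₁ hμ hT hf.cont hf₁i hff₁,
    e.ae_duhamel_eq_of_isWeakSolution hα₀ hα₁ hT heig hf.cont hu,
    fun t ht => hasDerivWithinAt_duhamel hα₀ hα₁ hμ hf.cont hf.cont₁ hf₂i hff₁ hf₁f₂ ht,
    fun s t hs hst htT => ⟨intervalIntegrable_solDeriv₂ hα₀ hα₁ hμ hs hst htT hf₂i,
      solDeriv_sub_solDeriv hα₀ hα₁ hμ hs hst htT hf.cont₁ hf₂i hf₁f₂⟩,
    ae_hasDerivAt_solDeriv hα₀ hα₁ hμ hf.cont₁ hf₂i hf₁f₂,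
    fun t ht => intervalIntegrable_caputo hα₀ hα₁ hμ hf.cont₁ hf₂i hf₁f₂ ht,
    ae_norm_solDeriv₂_le hα₀ hα₁ hμ hT hf₂i hC₁ hC₅,
    fun ε hε => ⟨fun t ht => e.powNorm_duhamel_le hα₀ hα₁ hf.cont ht hε hC,
      fun t ht => e.powNorm_solDeriv_le hα₀ hα₁ hf.cont₁ ht hε hC hC',
      fun t ht => e.enorm_caputo_le hα₀ hα₁ hf.cont hf.cont₁ hf₂i hff₁ hf₁f₂ ht hε hC hC₁⟩⟩
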